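/- Let $n\ge 1$ and let $X$ be a smooth Hausdorff manifold of dimension $2n+1$ with a CR structure $T^{1,0}X\subset\mathbb C TX$ (an involutive smooth complex subbundle of rank $n$ with $T^{1,0}X\cap T^{0,1}X=0$, $T^{0,1}X=\overline{T^{1,0}X}$). Let $HX\subset TX$ be the Levi distribution, $HX\otimes\mathbb C=T^{1,0}X\oplus T^{0,1}X$, with complex structure $J(u+\bar u)=iu-i\bar u$ for $u\in T^{1,0}X$. Let $\omega_0$ be a smooth real one-form with $\ker\omega_0=HX$ whose Levi form $\mathcal L(u,v)=\frac i2 d\omega_0(u,\bar v)$ on $T^{1,0}X$ is positive definite, where $d\omega_0(U,V)=U\omega_0(V)-V\omega_0(U)-\omega_0([U,V])$. Let $\mathcal T$ be the vector field with $\omega_0(\mathcal T)=-1$, $\iota_{\mathcal T}d\omega_0=0$. The Levi metric on $TX$ is the one for which $\langle u+\bar u+a\mathcal T,\,v+\bar v+b\mathcal T\rangle=2\operatorname{Re}\mathcal L(u,v)+ab$ ($u,v\in T^{1,0}X$, $a,b\in\mathbb R$). Let $\nabla$ be the Tanaka--Webster connection, i.e. the smooth affine connection such that $\nabla$ preserves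 $HX$; $\nabla\mathcal T=0$, $\nabla J=0$, $\nabla d\omega_0=0$; and its torsion satisfies $\tau(U,V)=-d\omega_0(U,V)\mathcal T$ and $\tau(\mathcal T,JU)=-J\tau(\mathcal T,U)$ for $U,V\in HX$. It gives the splitting $TT^*X=\mathrm{Hor}(T^*X)\oplus\mathrm{Ver}(T^*X)\simeq\pi^*TX\oplus\pi^*T^*X$. Let $H^*X\subset T^*X$ be the annihilator of $\mathcal T$, with the dual complex structure $J\beta=\beta\circ J$. Let $J_{T^*X}:TT^*X\to TT^*X$ be the morphism which is the lift of $J$ on the horizontal lift of $HX$, minus the lift of $J$ on the vertical lift of $H^*X$, and $0$ on the horizontal lift of $\mathcal T$ and on the vertical lift of $\omega_0$. Let $\omega_{T^*X}$ be the standard symplectic form, $\omega_{T^*X}=\sum_j dx_j\wedge d\xi_j$ in the coordinates $(x,\xi)$ on $T^*X$ induced by local coordinates $x$ on $X$; let $X_F$ be the Hamiltonian vector field of $F$, $\omega_{T^*X}(X_F,\cdot)=-dF$, so that $X_F=\sum_j\partial_{x_j}F\,\partial_{\xi_j}-\partial_{\xi_j}F\,\partial_{x_j}$; and let $\operatorname{Div}$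 be the divergence with respect to the Liouville volume form. Put $$P(F)=-\tfrac12\operatorname{Div}(J_{T^*X}X_F).$$ Then $P$ is a well-defined linear differential operator $C^\infty(T^*X)\to C^\infty(T^*X)$ (the value of $-\frac12\operatorname{Div}(J_{T^*X}X_F)$ may be computed in the coordinates on $T^*X$ induced by any chart of $X$, divergence and symplectic form being the standard ones there). Moreover, let $p\in X$ and let $x=(x_1,\dots,x_{2n+1})$ be smooth local coordinates on an open neighbourhood $D$ of $p$, $x(p)=0$, such that, with $z_j=x_{2j-1}+ix_{2j}$ and $\partial_{z_j}=\frac12(\partial_{x_{2j-1}}-i\partial_{x_{2j}})$: 1. $\omega_0=dx_{2n+1}+\frac i2\sum_{j=1}^n(\bar z_jdz_j-z_jd\bar z_j)+O(|x|^3)$; 2. there is a smooth frame $Z_1,\dots,Z_n$ of $T^{1,0}X|_D$, orthonormal for $\mathcal L$, with $Z_j=\sqrt2\left(\partial_{z_j}-\frac i2\bar z_j\partial_{x_{2n+1}}\right)+O(|x|^3)$; 3. $\mathcal T=-\partial_{x_{2n+1}}+O(|x|^2)$; 4. the volume density of the Levi metric is $\lambda\,|dx_1\cdots dx_{2n+1}|$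 with $\lambda(0)=1$ and $\partial_{x_j}\lambda(0)=0$ for all $j$. Then, for every $F\in C^\infty(T^*X)$, in the induced coordinates $(x,\xi)$, $$P(F)(0,-\omega_0(0))=\sum_{j=1}^n\left[\partial_{x_{2j}}\partial_{\xi_{2j-1}}F-\partial_{x_{2j-1}}\partial_{\xi_{2j}}F\right](0,-\omega_0(0)).$$ This holds for real-valued $F$, and for complex-valued $F$ with $P$ extended complex-linearly. -/

import Mathlib

open Bundle VectorField
open scoped Manifold ContDiff TensorProduct Topology

namespace CRGeom

noncomputable section

/-- The model space `ℝ^{2n+1}`. -/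
abbrev RVec (n : ℕ) : Type := EuclideanSpace ℝ (Fin (2 * n + 1))

section Coordinates

variable {n : ℕ}

/-- The index of `x_{2j-1}`. Here `j : Fin n` stands for the index `j + 1` of the usual notation
`j = 1, ..., n`, and `Fin (2 * n + 1)` for the indices `1, ..., 2n+1` in the same way. -/
def iOdd (j : Fin n) : Fin (2 * n + 1) := ⟨2 * j.1, by omega⟩

/-- The index of `x_{2j}`. -/
def iEven (j : Fin n) : Fin (2 * n + 1) := ⟨2 * j.1 + 1, by omega⟩

/-- The index of `x_{2n+1}`. -/
def iLast (n : ℕ) : Fin (2 * n + 1) := Fin.last (2 * n)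

/-- The standard basis vectors of `ℝ^{2n+1}`. -/
def stdVec (k : Fin (2 * n + 1)) : RVec n := EuclideanSpace.single k (1 : ℝ)

/-- `z_j = x_{2j-1} + i x_{2j}`. -/
def zCoord (x : RVec n) (j : Fin n) : ℂ := (x (iOdd j) : ℂ) + Complex.I * (x (iEven j) : ℂ)

/-- The value at `x`, on the vector `v`, of
`dx_{2n+1} + (i/2) ∑ⱼ (z̄ⱼ dzⱼ - zⱼ dz̄ⱼ)`. -/
def heisenbergForm (x v : RVec n) : ℂ :=
  (v (iLast n) : ℂ) + Complex.I / 2 * ∑ j : Fin n,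
    (starRingEnd ℂ (zCoord x j) * zCoord v j - zCoord x j * starRingEnd ℂ (zCoord v j))

/-- The coefficient of `∂_{x_k}` in `√2 (∂_{z_j} - (i/2) z̄_j ∂_{x_{2n+1}})`, where
`∂_{z_j} = (1/2) (∂_{x_{2j-1}} - i ∂_{x_{2j}})`. -/
def heisenbergFrame (j : Fin n) (x : RVec n) (k : Fin (2 * n + 1)) : ℂ :=
  (Real.sqrt 2 : ℂ) *
    (1 / 2 * ((if k = iOdd j then 1 else 0) - Complex.I * (if k = iEven j then 1 else 0))
      - Complex.I / 2 * starRingEnd ℂ (zCoord x j) * (if k = iLast n then 1 else 0))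

end Coordinates

section Manifold

variable {n : ℕ} {X : Type*} [TopologicalSpace X] [ChartedSpace (RVec n) X]

/-- The complexified tangent space `ℂ T_x X`. -/
abbrev CTangent (n : ℕ) {X : Type*} [TopologicalSpace X] [ChartedSpace (RVec n) X] (x : X) : Type :=
  ℂ ⊗[ℝ] TangentSpace (𝓡 (2 * n + 1)) x

/-- The complex tangent vector `a + i b`. -/
def cvec {x : X} (a b : TangentSpace (𝓡 (2 * n + 1)) x) : CTangent n x :=
  (1 : ℂ) ⊗ₜ[ℝ] a + Complex.I ⊗ₜ[ℝ] b

/-- Complex conjugation on `ℂ T_x X`. -/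
def conjC (x : X) : CTangent n x →ₗ[ℝ] CTangent n x :=
  LinearMap.rTensor (TangentSpace (𝓡 (2 * n + 1)) x) Complex.conjAe.toLinearMap

lemma conjC_smul (x : X) (c : ℂ) (u : CTangent n x) :
    conjC x (c • u) = starRingEnd ℂ c • conjC x u := by
  induction u using TensorProduct.induction_on with
  | zero => simp
  | tmul a v => simp [conjC, TensorProduct.smul_tmul']
  | add u v hu hv => simp only [smul_add, map_add, hu, hv]

/-- The complex conjugate of a complex subspace of `ℂ T_x X`. -/
def conjSub {x : X} (W : Submodule ℂ (CTangent n x)) : Submodule ℂ (CTangent n x) where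
  carrier := {u | conjC x u ∈ W}
  add_mem' := fun {u v} hu hv => by
    simpa only [Set.mem_ofPred_eq, map_add] using W.add_mem hu hv
  zero_mem' := by simp
  smul_mem' := fun c u hu => by
    simpa only [Set.mem_ofPred_eq, conjC_smul] using W.smul_mem _ hu

/-- Vector fields on `X` (without regularity). -/
abbrev VField (n : ℕ) (X : Type*) [TopologicalSpace X] [ChartedSpace (RVec n) X] : Type _ :=
  ∀ x : X, TangentSpace (𝓡 (2 * n + 1)) x

/-- A vector field, as a map from `X` to the tangent bundle. -/
def VField.toBundle (V : VField n X) : X → TangentBundle (𝓡 (2 * n + 1)) X := fun x => ⟨x, V x⟩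

/-- `V` is of class `C^∞` on the set `U`. -/
def VField.SmoothOn [IsManifold (𝓡 (2 * n + 1)) ∞ X] (V : VField n X) (U : Set X) : Prop :=
  ContMDiffOn (𝓡 (2 * n + 1)) (𝓡 (2 * n + 1)).tangent ∞ V.toBundle U

/-- The Lie bracket of two vector fields. -/
def VField.bracket (U V : VField n X) : VField n X := mlieBracket (𝓡 (2 * n + 1)) U V

/-- A smooth local frame `Z_j = A_j + i B_j`, over the set `U`, of a family of complex subspaces of
the complexified tangent spaces. -/
structure IsComplexFrameOn [IsManifold (𝓡 (2 * n + 1)) ∞ X]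
    (W : ∀ x : X, Submodule ℂ (CTangent n x)) (U : Set X) (A B : Fin n → VField n X) : Prop where
  smooth_re : ∀ j, (A j).SmoothOn U
  smooth_im : ∀ j, (B j).SmoothOn U
  linearIndependent : ∀ x ∈ U, LinearIndependent ℂ fun j => cvec (A j x) (B j x)
  span_eq : ∀ x ∈ U, Submodule.span ℂ (Set.range fun j => cvec (A j x) (B j x)) = W x

/-- A CR structure of CR dimension `n` on a manifold `X` of dimension `2n+1`: an involutive smooth
complex subbundle `T^{1,0}X` of rank `n` of `ℂ TX` with `T^{1,0}X ∩ T^{0,1}X = 0`, where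
`T^{0,1}X` is the complex conjugate of `T^{1,0}X`. -/
structure CRStructure (n : ℕ) (X : Type*) [TopologicalSpace X] [ChartedSpace (RVec n) X]
    [IsManifold (𝓡 (2 * n + 1)) ∞ X] where
  T10 : ∀ x : X, Submodule ℂ (CTangent n x)
  exists_frame : ∀ p : X, ∃ U : Set X, IsOpen U ∧ p ∈ U ∧
    ∃ A B : Fin n → VField n X, IsComplexFrameOn T10 U A B
  inf_conj : ∀ x, T10 x ⊓ conjSub (T10 x) = ⊥
  /-- The bracket of two local sections `A + i B`, `C + i D` of `T^{1,0}X` is a section. -/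
  involutive : ∀ U : Set X, IsOpen U → ∀ A B C D : VField n X,
    A.SmoothOn U → B.SmoothOn U → C.SmoothOn U → D.SmoothOn U →
    (∀ x ∈ U, cvec (A x) (B x) ∈ T10 x) → (∀ x ∈ U, cvec (C x) (D x) ∈ T10 x) →
    ∀ x ∈ U, cvec (A.bracket C x - B.bracket D x) (A.bracket D x + B.bracket C x) ∈ T10 x

/-! ### Cotangent bundle, one-forms, exterior derivative -/

/-- The fibre `T*_x X` of the cotangent bundle. -/
abbrev CotSpace (n : ℕ) {X : Type*} [TopologicalSpace X] [ChartedSpace (RVec n) X] (x : X) : Type :=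
  TangentSpace (𝓡 (2 * n + 1)) x →L[ℝ] Bundle.Trivial X ℝ x

/-- The total space `T*X`, with Mathlib's topology and smooth structure on the total space of the
bundle of continuous linear maps from `TX` to the trivial line bundle. -/
abbrev CotBundle (n : ℕ) (X : Type*) [TopologicalSpace X] [ChartedSpace (RVec n) X] : Type _ :=
  TotalSpace (RVec n →L[ℝ] ℝ) (fun x : X => CotSpace n x)

/-- The model with corners of the manifold `T*X`. -/
abbrev cotModel (n : ℕ) : ModelWithCorners ℝ (RVec n × (RVec n →L[ℝ] ℝ))
    (ModelProd (RVec n) (RVec n →L[ℝ] ℝ)) :=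
  (𝓡 (2 * n + 1)).prod 𝓘(ℝ, RVec n →L[ℝ] ℝ)

/-- Smooth real one-forms on `X`. -/
abbrev OneForm (n : ℕ) (X : Type*) [TopologicalSpace X] [ChartedSpace (RVec n) X]
    [IsManifold (𝓡 (2 * n + 1)) ∞ X] : Type _ :=
  ContMDiffSection (𝓡 (2 * n + 1)) (RVec n →L[ℝ] ℝ) ∞ (fun x : X => CotSpace n x)

variable [IsManifold (𝓡 (2 * n + 1)) ∞ X]

/-- The value of a one-form on a tangent vector. -/
def OneForm.ev (α : OneForm n X) {x : X} (v : TangentSpace (𝓡 (2 * n + 1)) x) : ℝ := α x v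

/-- `U(α(V)) - V(α(U)) - α([U, V])`. -/
def OneForm.dAux (α : OneForm n X) (U V : VField n X) (x : X) : ℝ :=
  mvfderiv (𝓡 (2 * n + 1)) (fun y => α.ev (V y)) x (U x)
    - mvfderiv (𝓡 (2 * n + 1)) (fun y => α.ev (U y)) x (V x) - α.ev (U.bracket V x)

lemma OneForm.mdifferentiableAt_ev (α : OneForm n X) {V : VField n X} {x : X}
    (hV : MDifferentiableAt (𝓡 (2 * n + 1)) (𝓡 (2 * n + 1)).tangent V.toBundle x) :
    MDifferentiableAt (𝓡 (2 * n + 1)) 𝓘(ℝ, ℝ) (fun y => α.ev (V y)) x := by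
  have h1 := (α.contMDiff.mdifferentiable (by simp)) x
  have h2 := MDifferentiableAt.clm_bundle_apply (b := fun y : X => y) (v := V) (ϕ := fun y => α y)
    h1 hV
  rw [mdifferentiableAt_totalSpace] at h2
  exact h2.2

lemma OneForm.dAux_swap (α : OneForm n X) (U V : VField n X) (x : X) :
    α.dAux U V x = - α.dAux V U x := by
  unfold OneForm.dAux OneForm.ev VField.bracket
  rw [mlieBracket_swap_apply, map_neg]
  ring

lemma OneForm.dAux_tensorial (α : OneForm n X) (x : X) (V : VField n X) :
    TensorialAt (𝓡 (2 * n + 1)) (RVec n) (fun U => α.dAux U V x) x where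
  smul {f U} hf hU := by
    have hev : (fun y => α.ev ((f • U) y)) = f * fun y => α.ev (U y) := by
      funext y; simp [OneForm.ev]
    unfold OneForm.dAux VField.bracket
    rw [hev, mvfderiv_mul hf (α.mdifferentiableAt_ev hU), mlieBracket_smul_left hf hU]
    simp [OneForm.ev]
    ring
  add {U U'} hU hU' := by
    have hev : (fun y => α.ev ((U + U') y)) = (fun y => α.ev (U y)) + fun y => α.ev (U' y) := by
      funext y; simp [OneForm.ev]
    unfold OneForm.dAux VField.bracket
    rw [hev, mvfderiv_add (α.mdifferentiableAt_ev hU) (α.mdifferentiableAt_ev hU'),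
      mlieBracket_add_left hU hU']
    simp [OneForm.ev]
    ring

lemma OneForm.dAux_tensorial' (α : OneForm n X) (x : X) (U : VField n X) :
    TensorialAt (𝓡 (2 * n + 1)) (RVec n) (fun V => α.dAux U V x) x where
  smul {f V} hf hV := by
    have := (α.dAux_tensorial x U).smul hf hV
    simp only [α.dAux_swap U, this, smul_neg]
  add {V V'} hV hV' := by
    have := (α.dAux_tensorial x U).add hV hV'
    simp only [α.dAux_swap U, this, neg_add]

/-- The exterior derivative `dα`, as a bilinear form on every tangent space. -/
def OneForm.d (α : OneForm n X) (x : X) :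
    LinearMap.BilinForm ℝ (TangentSpace (𝓡 (2 * n + 1)) x) :=
  (TensorialAt.mkHom₂ (fun U V => α.dAux U V x) x (fun V _ => α.dAux_tensorial x V)
    (fun U _ => α.dAux_tensorial' x U)).toLinearMap₁₂

/-- `dα(U, V) = U(α(V)) - V(α(U)) - α([U, V])`. -/
lemma OneForm.d_apply (α : OneForm n X) {x : X} {U V : VField n X}
    (hU : MDifferentiableAt (𝓡 (2 * n + 1)) (𝓡 (2 * n + 1)).tangent U.toBundle x)
    (hV : MDifferentiableAt (𝓡 (2 * n + 1)) (𝓡 (2 * n + 1)).tangent V.toBundle x) :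
    α.d x (U x) (V x) = mvfderiv (𝓡 (2 * n + 1)) (fun y => α.ev (V y)) x (U x)
      - mvfderiv (𝓡 (2 * n + 1)) (fun y => α.ev (U y)) x (V x) - α.ev (U.bracket V x) :=
  TensorialAt.mkHom₂_apply (Φ := fun U V => α.dAux U V x) (fun V _ => α.dAux_tensorial x V)
    (fun U _ => α.dAux_tensorial' x U) hU hV

/-! ### Pseudohermitian geometry -/

/-- The Levi distribution `HX`: the real tangent vectors in `T^{1,0}X ⊕ T^{0,1}X`. -/
def CRStructure.levi (S : CRStructure n X) (x : X) :
    Submodule ℝ (TangentSpace (𝓡 (2 * n + 1)) x) :=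
  Submodule.comap (TensorProduct.mk ℝ ℂ (TangentSpace (𝓡 (2 * n + 1)) x) 1)
    ((S.T10 x ⊔ conjSub (S.T10 x)).restrictScalars ℝ)

/-- The Levi form `(i/2) dω₀(u, v̄)`, with `dω₀` extended complex-bilinearly to `ℂ TX`. -/
def OneForm.leviForm (ω₀ : OneForm n X) (x : X) (u v : CTangent n x) : ℂ :=
  Complex.I / 2 * (ω₀.d x).baseChange ℂ u (conjC x v)

/-- A strongly pseudoconvex CR manifold with a contact form `ω₀`: a smooth real one-form whose
kernel is `HX`, and whose Levi form is positive definite. -/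
structure PseudohermitianStructure (n : ℕ) (X : Type*) [TopologicalSpace X]
    [ChartedSpace (RVec n) X] [IsManifold (𝓡 (2 * n + 1)) ∞ X] extends CRStructure n X where
  ω₀ : OneForm n X
  ker_eq : ∀ (x : X) (v : TangentSpace (𝓡 (2 * n + 1)) x),
    ω₀.ev v = 0 ↔ v ∈ toCRStructure.levi x
  levi_pos : ∀ (x : X), ∀ u ∈ toCRStructure.T10 x, u ≠ 0 → 0 < (ω₀.leviForm x u u).re

namespace PseudohermitianStructure

variable (S : PseudohermitianStructure n X)

/-- `T` is the vector field `𝒯`: `ω₀(𝒯) = -1` and `ι_𝒯 dω₀ = 0`. -/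
structure IsReeb (T : VField n X) : Prop where
  smooth : T.SmoothOn Set.univ
  eval_eq : ∀ x, S.ω₀.ev (T x) = -1
  contract_eq : ∀ x (v : TangentSpace (𝓡 (2 * n + 1)) x), S.ω₀.d x (T x) v = 0

/-- `L` is the endomorphism of `T_xX = H_xX ⊕ ℝ 𝒯` which vanishes on `𝒯` and is the complex
structure `J(u + ū) = iu - iū`, `u ∈ T^{1,0}_xX`, on `H_xX`. -/
structure IsComplexStructureAt (T : VField n X) (x : X)
    (L : TangentSpace (𝓡 (2 * n + 1)) x →ₗ[ℝ] TangentSpace (𝓡 (2 * n + 1)) x) : Prop where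
  reeb : L (T x) = 0
  levi : ∀ (v : TangentSpace (𝓡 (2 * n + 1)) x), ∀ u ∈ S.T10 x,
    (1 : ℂ) ⊗ₜ[ℝ] v = u + conjC x u →
      (1 : ℂ) ⊗ₜ[ℝ] (L v) = Complex.I • u - Complex.I • conjC x u

open Classical in
/-- The complex structure `J` of `HX`, extended by `J 𝒯 = 0` to all of `TX`. -/
def J (T : VField n X) (x : X) :
    TangentSpace (𝓡 (2 * n + 1)) x →ₗ[ℝ] TangentSpace (𝓡 (2 * n + 1)) x :=
  if h : ∃ L, S.IsComplexStructureAt T x L then h.choose else 0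

/-- The vector field `J V`. -/
def JField (T V : VField n X) : VField n X := fun x => S.J T x (V x)

/-- The component in `T^{1,0}X` of a real tangent vector `v` with respect to
`ℂ TX = T^{1,0}X ⊕ T^{0,1}X ⊕ ℂ 𝒯`: it is `(h - i J h) / 2`, with `h` the component of `v` in
`HX`. -/
def part10 (T : VField n X) (x : X) (v : TangentSpace (𝓡 (2 * n + 1)) x) : CTangent n x :=
  cvec ((1 / 2 : ℝ) • (v + S.ω₀.ev v • T x)) (-(1 / 2 : ℝ) • S.J T x v)

/-- The Levi metric on real tangent vectors: with `u = u' + ū' + a 𝒯`, `v = v' + v̄' + b 𝒯`, it is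
`𝓛(u', v') + conj 𝓛(u', v') + a b`. -/
def leviMetric (T : VField n X) (x : X) (u v : TangentSpace (𝓡 (2 * n + 1)) x) : ℝ :=
  2 * (S.ω₀.leviForm x (S.part10 T x u) (S.part10 T x v)).re + S.ω₀.ev u * S.ω₀.ev v

/-- `∇` is the Tanaka–Webster connection. In Mathlib's notation `∇_u V`, for a tangent vector `u` at
`x`, is `∇ V x u`. -/
structure IsTanakaWebster (T : VField n X)
    (nabla : CovariantDerivative (𝓡 (2 * n + 1)) (RVec n)
      (TangentSpace (𝓡 (2 * n + 1)) : X → Type)) : Prop where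
  smooth : CovariantDerivative.ContMDiffCovariantDerivative nabla ∞
  /-- `∇_u V ∈ HX` for every section `V` of `HX`. -/
  preserves_levi : ∀ (U : Set X), IsOpen U → ∀ V : VField n X, V.SmoothOn U →
    (∀ x ∈ U, V x ∈ S.levi x) → ∀ x ∈ U, ∀ u, nabla V x u ∈ S.levi x
  /-- `∇ 𝒯 = 0`. -/
  reeb : ∀ x u, nabla T x u = 0
  /-- `∇ J = 0`. -/
  complexStructure : ∀ (U : Set X), IsOpen U → ∀ V : VField n X, V.SmoothOn U →
    (∀ x ∈ U, V x ∈ S.levi x) → ∀ x ∈ U, ∀ u, nabla (S.JField T V) x u = S.J T x (nabla V x u)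
  /-- `∇ dω₀ = 0`. -/
  dform : ∀ (U : Set X), IsOpen U → ∀ V W : VField n X, V.SmoothOn U → W.SmoothOn U →
    ∀ x ∈ U, ∀ u : TangentSpace (𝓡 (2 * n + 1)) x,
      mvfderiv (𝓡 (2 * n + 1)) (fun y => S.ω₀.d y (V y) (W y)) x u
        = S.ω₀.d x (nabla V x u) (W x) + S.ω₀.d x (V x) (nabla W x u)
  torsion_levi : ∀ x, ∀ u ∈ S.levi x, ∀ v ∈ S.levi x,
    nabla.torsion x u v = -(S.ω₀.d x u v) • T x
  torsion_reeb : ∀ x, ∀ u ∈ S.levi x,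
    nabla.torsion x (T x) (S.J T x u) = - S.J T x (nabla.torsion x (T x) u)

end PseudohermitianStructure

/-! ### Coordinates on `X` and the induced coordinates on `T*X` -/

/-- The differential at `q` of the coordinate map `φ`; its components are `dx_1, ..., dx_{2n+1}`. -/
def push (φ : OpenPartialHomeomorph X (RVec n)) (q : X) :
    TangentSpace (𝓡 (2 * n + 1)) q →L[ℝ] RVec n :=
  mfderiv (𝓡 (2 * n + 1)) (𝓡 (2 * n + 1)) φ q

/-- The inverse of the differential of `φ`: the tangent vector `∑ⱼ aⱼ ∂_{x_j}` at `q`. -/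
def pull (φ : OpenPartialHomeomorph X (RVec n)) (q : X) :
    RVec n →L[ℝ] TangentSpace (𝓡 (2 * n + 1)) q :=
  (push φ q).inverse

/-- The coordinate vector field `∂_{x_k}` (on the domain of `φ`). -/
def coordField (φ : OpenPartialHomeomorph X (RVec n)) (k : Fin (2 * n + 1)) : VField n X :=
  fun q => pull φ q (stdVec k)

/-- The covector `∑ₖ ξ_k dx_k` at the point with coordinates `x`. -/
def cotPoint (φ : OpenPartialHomeomorph X (RVec n)) (y : RVec n × RVec n) : CotBundle n X :=
  ⟨φ.symm y.1, (innerSL ℝ y.2).comp (push φ (φ.symm y.1))⟩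

/-- The induced coordinates `(x, ξ)` on `T*X`, with `ξ_k = ξ(∂_{x_k})`. -/
def cotCoord (φ : OpenPartialHomeomorph X (RVec n)) (z : CotBundle n X) : RVec n × RVec n :=
  (φ z.1, WithLp.toLp 2 fun k => z.2 (coordField φ k z.1))

/-- The coordinate vectors `∂_{x_j}` (left) and `∂_{ξ_j}` (right) of `ℝ^{2n+1} × ℝ^{2n+1}`. -/
def phaseVec : Fin (2 * n + 1) ⊕ Fin (2 * n + 1) → RVec n × RVec n
  | Sum.inl j => (stdVec j, 0)
  | Sum.inr j => (0, stdVec j)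

/-- The symplectic form `∑ⱼ dx_j ∧ dξ_j`. -/
def sympl (V W : RVec n × RVec n) : ℝ := ∑ j, (V.1 j * W.2 j - V.2 j * W.1 j)

/-- The Hamiltonian vector field `X_f = ∑ⱼ (∂_{x_j} f) ∂_{ξ_j} - (∂_{ξ_j} f) ∂_{x_j}`. -/
def hamiltonian (f : RVec n × RVec n → ℝ) (y : RVec n × RVec n) : RVec n × RVec n :=
  (WithLp.toLp 2 fun j => -fderiv ℝ f y (phaseVec (Sum.inr j)),
    WithLp.toLp 2 fun j => fderiv ℝ f y (phaseVec (Sum.inl j)))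

/-- `X_f` is the unique solution of `ω(X_f, ·) = -df`. -/
lemma hamiltonian_spec (f : RVec n × RVec n → ℝ) (y V : RVec n × RVec n) :
    (∀ W, sympl V W = -fderiv ℝ f y W) ↔ V = hamiltonian f y := by
  have key : ∀ W : RVec n × RVec n, fderiv ℝ f y W =
      ∑ j, (W.1 j * fderiv ℝ f y (phaseVec (Sum.inl j))
        + W.2 j * fderiv ℝ f y (phaseVec (Sum.inr j))) := by
    intro W
    have hW : W = ∑ j, (W.1 j • (phaseVec (Sum.inl j) : RVec n × RVec n)
        + W.2 j • phaseVec (Sum.inr j)) := by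
      refine Prod.ext ?_ ?_ <;> ext i <;>
        simp [Prod.fst_sum, Prod.snd_sum, phaseVec, stdVec, Pi.single_apply]
    conv_lhs => rw [hW]
    simp [map_sum]
  constructor
  · intro h
    refine Prod.ext ?_ ?_ <;> ext j
    · have := h (phaseVec (Sum.inr j))
      simpa [sympl, hamiltonian, phaseVec, stdVec, Pi.single_apply] using this
    · have := h (phaseVec (Sum.inl j))
      simpa [sympl, hamiltonian, phaseVec, stdVec, Pi.single_apply] using this
  · rintro rfl W
    rw [key W, ← Finset.sum_neg_distrib]
    refine Finset.sum_congr rfl fun j _ => ?_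
    simp only [hamiltonian]
    ring

/-- The divergence `∑ⱼ ∂_{x_j} V_j + ∂_{ξ_j} Ξ_j` of `∑ⱼ V_j ∂_{x_j} + Ξ_j ∂_{ξ_j}`. In the induced
coordinates the Liouville volume form is, up to sign, `dx_1 ∧ ... ∧ dξ_{2n+1}`, so this is the
divergence with respect to the Liouville volume form. -/
def divergence (V : RVec n × RVec n → RVec n × RVec n) (y : RVec n × RVec n) : ℝ :=
  ∑ j, ((fderiv ℝ V y (phaseVec (Sum.inl j))).1 j + (fderiv ℝ V y (phaseVec (Sum.inr j))).2 j)

/-- The horizontal lift at `(x, ξ)` of the tangent vector `∑ⱼ aⱼ ∂_{x_j}` with respect to a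
connection, in the induced coordinates. It is `(a, ξ̇)` with `ξ̇_l = ξ(∇_a ∂_{x_l})`: a covector
field `ξ(t)` along a curve with velocity `a` is parallel if and only if
`d/dt ξ(∂_{x_l}) = ξ(∇_a ∂_{x_l})`. -/
def horLift (nabla : CovariantDerivative (𝓡 (2 * n + 1)) (RVec n)
      (TangentSpace (𝓡 (2 * n + 1)) : X → Type))
    (φ : OpenPartialHomeomorph X (RVec n)) (y : RVec n × RVec n) (a : RVec n) :
    RVec n × RVec n :=
  (a, WithLp.toLp 2 fun l =>
    (cotPoint φ y).2 (nabla (coordField φ l) (φ.symm y.1) (pull φ (φ.symm y.1) a)))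

/-- The vertical lift of the covector `∑ⱼ bⱼ dx_j`, in the induced coordinates. -/
def verLift (b : RVec n) : RVec n × RVec n := (0, b)

namespace PseudohermitianStructure

variable (S : PseudohermitianStructure n X)

/-- The components of `J v`, for `v = ∑ⱼ aⱼ ∂_{x_j}` at the point with coordinates `x`, where `J` is
extended by `J 𝒯 = 0`. -/
def JCoord (T : VField n X) (φ : OpenPartialHomeomorph X (RVec n)) (x a : RVec n) : RVec n :=
  push φ (φ.symm x) (S.J T (φ.symm x) (pull φ (φ.symm x) a))

/-- The components of `J β = β ∘ J`, for the covector `β = ∑ₖ bₖ dx_k` at the point with coordinates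
`x`. Since `J 𝒯 = 0` and `ω₀ ∘ J = 0`, this is the dual complex structure on
`H*X = {β | β(𝒯) = 0}`, extended by `J ω₀ = 0` to all of `T*X = H*X ⊕ ℝ ω₀`. -/
def JDualCoord (T : VField n X) (φ : OpenPartialHomeomorph X (RVec n)) (x b : RVec n) : RVec n :=
  WithLp.toLp 2 fun l =>
    (cotPoint φ (x, b)).2 (S.J T (φ.symm x) (coordField φ l (φ.symm x)))

/-- The endomorphism `J_{T*X}` of `T T*X`, in the induced coordinates. A tangent vector `V` is split
as `V = a^Hor + β^Ver`; then `J_{T*X} V = (J a)^Hor - (J β)^Ver`, where `J` on `TX` and `T*X` is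
extended by `J 𝒯 = 0` and `J ω₀ = 0`. -/
def JCot (T : VField n X) (nabla : CovariantDerivative (𝓡 (2 * n + 1)) (RVec n)
      (TangentSpace (𝓡 (2 * n + 1)) : X → Type))
    (φ : OpenPartialHomeomorph X (RVec n)) (y V : RVec n × RVec n) : RVec n × RVec n :=
  horLift nabla φ y (S.JCoord T φ y.1 V.1)
    - verLift (S.JDualCoord T φ y.1 (V - horLift nabla φ y V.1).2)

/-- `-(1/2) Div(J_{T*X} X_F)`, computed in the coordinates `(x, ξ)` induced by the chart `φ`. -/
def PChart (T : VField n X) (nabla : CovariantDerivative (𝓡 (2 * n + 1)) (RVec n)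
      (TangentSpace (𝓡 (2 * n + 1)) : X → Type))
    (φ : OpenPartialHomeomorph X (RVec n)) (F : CotBundle n X → ℝ) (y : RVec n × RVec n) : ℝ :=
  -(1 / 2) * divergence
    (fun y' => S.JCot T nabla φ y' (hamiltonian (fun w => F (cotPoint φ w)) y')) y

/-- The operator `P(F) = -(1/2) Div(J_{T*X} X_F)` on functions on `T*X`; its value at `z` is computed
in the coordinates induced by Mathlib's preferred chart at the base point of `z`. -/
def P (T : VField n X) (nabla : CovariantDerivative (𝓡 (2 * n + 1)) (RVec n)
      (TangentSpace (𝓡 (2 * n + 1)) : X → Type))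
    (F : CotBundle n X → ℝ) (z : CotBundle n X) : ℝ :=
  S.PChart T nabla (chartAt (RVec n) z.1) F (cotCoord (chartAt (RVec n) z.1) z)

/-- The complex-linear extension of `P` to complex-valued functions on `T*X`. -/
def PComplex (T : VField n X) (nabla : CovariantDerivative (𝓡 (2 * n + 1)) (RVec n)
      (TangentSpace (𝓡 (2 * n + 1)) : X → Type))
    (F : CotBundle n X → ℂ) (z : CotBundle n X) : ℂ :=
  (S.P T nabla (fun w => (F w).re) z : ℂ) + Complex.I * (S.P T nabla (fun w => (F w).im) z : ℂ)

/-- The density `λ` of the volume form `dv_X = λ dx_1 ∧ ... ∧ dx_{2n+1}` of the Levi metric. -/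
def volDensity (T : VField n X) (φ : OpenPartialHomeomorph X (RVec n)) (x : RVec n) : ℝ :=
  Real.sqrt (Matrix.det (Matrix.of fun j k =>
    S.leviMetric T (φ.symm x) (coordField φ j (φ.symm x)) (coordField φ k (φ.symm x))))

/-- The chart `φ` gives normal coordinates at `p`. -/
structure IsNormalChart (T : VField n X) (p : X) (φ : OpenPartialHomeomorph X (RVec n)) :
    Prop where
  mem_atlas : φ ∈ IsManifold.maximalAtlas (𝓡 (2 * n + 1)) ∞ X
  mem_source : p ∈ φ.source
  center : φ p = 0
  /-- `ω₀ = dx_{2n+1} + (i/2) ∑ⱼ (z̄ⱼ dzⱼ - zⱼ dz̄ⱼ) + O(|x|³)`. -/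
  contact : ∀ k, (fun x : RVec n =>
      (S.ω₀.ev (coordField φ k (φ.symm x)) : ℂ) - heisenbergForm x (stdVec k))
    =O[𝓝 0] fun x => ‖x‖ ^ 3
  /-- There is an orthonormal frame `Z_j = √2 (∂_{z_j} - (i/2) z̄_j ∂_{x_{2n+1}}) + O(|x|³)` of
  `T^{1,0}X` over the domain of `φ`; here `Z_j = A_j + i B_j`. -/
  frame : ∃ A B : Fin n → VField n X, IsComplexFrameOn S.T10 φ.source A B ∧
    (∀ q ∈ φ.source, ∀ j k, S.ω₀.leviForm q (cvec (A j q) (B j q)) (cvec (A k q) (B k q))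
      = if j = k then 1 else 0) ∧
    ∀ j k, (fun x : RVec n => (push φ (φ.symm x) (A j (φ.symm x)) k : ℂ)
        + Complex.I * (push φ (φ.symm x) (B j (φ.symm x)) k : ℂ) - heisenbergFrame j x k)
      =O[𝓝 0] fun x => ‖x‖ ^ 3
  /-- `𝒯 = -∂_{x_{2n+1}} + O(|x|²)`. -/
  reeb : (fun x : RVec n => push φ (φ.symm x) (T (φ.symm x)) + stdVec (iLast n))
    =O[𝓝 0] fun x => ‖x‖ ^ 2
  /-- `λ(0) = 1` and all `∂_{x_j} λ(0)` vanish. -/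
  density : S.volDensity T φ 0 = 1
  density_deriv : HasFDerivAt (S.volDensity T φ) (0 : RVec n →L[ℝ] ℝ) 0

end PseudohermitianStructure

/-- `∂_{x_j} ∂_{ξ_k} F` at the point `z` of `T*X`, in the coordinates `(x, ξ)` induced by `φ`. -/
def mixedDeriv {G : Type*} [NormedAddCommGroup G] [NormedSpace ℝ G]
    (φ : OpenPartialHomeomorph X (RVec n)) (j k : Fin (2 * n + 1)) (F : CotBundle n X → G)
    (z : CotBundle n X) : G :=
  fderiv ℝ (fun y => fderiv ℝ (fun w => F (cotPoint φ w)) y (phaseVec (Sum.inr k)))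
    (cotCoord φ z) (phaseVec (Sum.inl j))

/-- The point `-ω₀(p)` of `T*X`, over the base point `p`. -/
def negForm (ω₀ : OneForm n X) (p : X) : CotBundle n X := ⟨p, -ω₀ p⟩

/-- `Q` is a linear differential operator on `T*X`: in the coordinates induced by any chart it is
`f ↦ ∑_{k ≤ N} ∑_s c_{k,s} ∂_{s_1} ⋯ ∂_{s_k} f`, with smooth coefficients `c_{k,s}`. -/
def IsDifferentialOperator (Q : (CotBundle n X → ℝ) → CotBundle n X → ℝ) : Prop :=
  ∀ φ ∈ IsManifold.maximalAtlas (𝓡 (2 * n + 1)) ∞ X, ∃ (N : ℕ)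
    (c : ∀ k : ℕ, (Fin k → Fin (2 * n + 1) ⊕ Fin (2 * n + 1)) → RVec n × RVec n → ℝ),
    (∀ k s, ContDiffOn ℝ ∞ (c k s) (φ.target ×ˢ Set.univ)) ∧
    ∀ F : CotBundle n X → ℝ, ContMDiff (cotModel n) 𝓘(ℝ, ℝ) ∞ F →
      ∀ y ∈ φ.target ×ˢ (Set.univ : Set (RVec n)),
        Q F (cotPoint φ y) = ∑ k ∈ Finset.range (N + 1), ∑ s,
          c k s y * iteratedFDeriv ℝ k (fun w => F (cotPoint φ w)) y (fun i => phaseVec (s i))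

end Manifold
end
end CRGeom

/-!
The operator `P` is computed in the coordinates induced by a chart, shown not to depend on the
chart, and then evaluated at one point of normal coordinates.

*Independence of the chart.* A change of the induced coordinates on `T*X` preserves the tautological
one-form `∑ⱼ ξ_j dx_j` (`inner_cotChange`), hence the symplectic form (`sympl_cotChange`), so it
carries Hamiltonian vector fields to Hamiltonian vector fields (`hamiltonian_comp`). It carries
`J_{T*X}` to `J_{T*X}` (`JCot_cotChange`), because horizontal and vertical lifts are intrinsic.
Finally a symplectic map preserves the divergence (`divergence_eq_of_symplectic`): the second
derivative of the map contributes the trace of an element of the symplectic Lie algebra, which is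
zero. This gives `PChart_cotChange`.

*The operator in coordinates.* Let `J ∂_i = ∑ⱼ J_{ji} ∂_j` and write `Γ_u` for the endomorphism with
`Γ_u ∂_l = ∇_u ∂_l`. Then (`PChart_eq`)
`P = ∑ J_{ji} ∂_{x_j} ∂_{ξ_i} + (1/2) ∑ G_{li} ∂_{ξ_l} ∂_{ξ_i} + (1/2) ∑ c_i ∂_{ξ_i}`, with
`G_{li} = ξ(Γ_{J ∂_i} ∂_l + Γ_{∂_i} J ∂_l)` and
`c_i = ∑ⱼ ∂_{x_j} J_{ji} + tr Γ_{J ∂_i} + tr (Γ_{∂_i} J)`. All coefficients are smooth.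

*Simplification of the first order part.* The conditions on the Tanaka–Webster connection imply
`∇ω₀ = 0` (`ev_nabla`) and `∇J = 0` for `J` extended by `J 𝒯 = 0` (`nabla_JField`). The trace of
`∇_{∂_j} (J ∂_i) = J ∇_{∂_j} ∂_i` over `j` expresses `tr (Γ_{∂_i} J)` through the divergence of `J`,
`tr Γ_{J ∂_i}` and traces of the torsion. The latter vanish, as the torsion is
`-dω₀ ⊗ 𝒯` up to terms in `τ(𝒯, ·)`, which takes values in `HX` and anticommutes with `J`
(`sum_torsion_J`, `sum_J_torsion`). The result is `c_i = 2 (div J)_i + 2 tr Γ_{J ∂_i}`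
(`firstCoef_eq`).

*Normal coordinates.* Let `B(a, l) = ∂_a (ω₀)_l (0)`, an antisymmetric form since
`(ω₀)_l = δ_{l, 2n+1} + B(x, l) + O(|x|³)`. As `∇ω₀ = 0`, at `ξ = -ω₀` the matrix `G` is
`-B(J ∂_i, ∂_l) - B(∂_i, J ∂_l)`, which is antisymmetric in `l` and `i` (`GCoef_swap`), so the
second order terms in `ξ` alone drop out. Since the derivatives of `dω₀` vanish at the origin, the
equation `∇dω₀ = 0` says that `Γ_a` preserves `B`, and together with `B(a, ∂_{x_{2n+1}}) = 0` this
gives `tr Γ_a = 0` (`sum_christ`). Differentiating `J A = -B`, `J B = A` and `J 𝒯 = 0`, for the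
frame `Z = A + i B` of `T^{1,0}X`, gives the one-jet of `J` at the origin (`hasFDerivAt_JMat`), whose
divergence is zero. What remains is `∑ J_{ji}(0) ∂_{x_j} ∂_{ξ_i}`, where `J(0)` maps
`∂_{x_{2j-1}}` to `∂_{x_{2j}}` and `∂_{x_{2j}}` to `-∂_{x_{2j-1}}`, and kills `∂_{x_{2n+1}}`.
-/

set_option linter.unusedSectionVars false

namespace CRGeom

noncomputable section

variable {n : ℕ} {X : Type*} [TopologicalSpace X] [ChartedSpace (RVec n) X]
  [IsManifold (𝓡 (2 * n + 1)) ∞ X] {φ ψ : OpenPartialHomeomorph X (RVec n)}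
  {nabla : CovariantDerivative (𝓡 (2 * n + 1)) (RVec n) (TangentSpace (𝓡 (2 * n + 1)) : X → Type)}

/-! ### Charts and vector fields -/

lemma mem_maximalAtlas_of_le (hφ : φ ∈ IsManifold.maximalAtlas (𝓡 (2 * n + 1)) ∞ X) :
    φ ∈ IsManifold.maximalAtlas (𝓡 (2 * n + 1)) 1 X :=
  IsManifold.maximalAtlas_subset_of_le (by simp) hφ

lemma isInvertible_push (hφ : φ ∈ IsManifold.maximalAtlas (𝓡 (2 * n + 1)) ∞ X) {q : X}
    (hq : q ∈ φ.source) : (push φ q).IsInvertible := by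
  have h1 := mem_maximalAtlas_of_le hφ
  have : φ.MDifferentiable (𝓡 (2 * n + 1)) (𝓡 (2 * n + 1)) :=
    ⟨fun x hx => (mdifferentiableAt_of_mem_maximalAtlas h1 hx).mdifferentiableWithinAt,
      fun x hx => (mdifferentiableAt_symm_of_mem_maximalAtlas h1 hx).mdifferentiableWithinAt⟩
  exact ⟨this.mfderiv hq, rfl⟩

lemma push_pull (hφ : φ ∈ IsManifold.maximalAtlas (𝓡 (2 * n + 1)) ∞ X) {q : X}
    (hq : q ∈ φ.source) (a : RVec n) : push φ q (pull φ q a) = a :=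
  (isInvertible_push hφ hq).self_apply_inverse a

lemma pull_push (hφ : φ ∈ IsManifold.maximalAtlas (𝓡 (2 * n + 1)) ∞ X) {q : X}
    (hq : q ∈ φ.source) (v : TangentSpace (𝓡 (2 * n + 1)) q) : pull φ q (push φ q v) = v :=
  (isInvertible_push hφ hq).inverse_apply_self v

lemma eq_sum_stdVec (a : RVec n) : a = ∑ k, a k • stdVec k := by
  ext i
  simp [stdVec, Pi.single_apply]

lemma pull_eq_sum (q : X) (a : RVec n) : pull φ q a = ∑ k, a k • coordField φ k q := by
  conv_lhs => rw [eq_sum_stdVec a]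
  simp [coordField]

lemma eq_sum_coordField (hφ : φ ∈ IsManifold.maximalAtlas (𝓡 (2 * n + 1)) ∞ X) {q : X}
    (hq : q ∈ φ.source) (v : TangentSpace (𝓡 (2 * n + 1)) q) :
    v = ∑ k, push φ q v k • coordField φ k q := by
  rw [← pull_eq_sum, pull_push hφ hq]

lemma push_coordField (hφ : φ ∈ IsManifold.maximalAtlas (𝓡 (2 * n + 1)) ∞ X) {q : X}
    (hq : q ∈ φ.source) (k : Fin (2 * n + 1)) : push φ q (coordField φ k q) = stdVec k :=
  push_pull hφ hq _

/-- The vector field `V` is of class `C^∞` at `q`. -/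
abbrev VField.SmoothAt (V : VField n X) (q : X) : Prop :=
  ContMDiffAt (𝓡 (2 * n + 1)) (𝓡 (2 * n + 1)).tangent ∞ V.toBundle q

lemma VField.SmoothAt.mdiff {V : VField n X} {q : X} (h : V.SmoothAt q) :
    MDifferentiableAt (𝓡 (2 * n + 1)) (𝓡 (2 * n + 1)).tangent V.toBundle q :=
  h.mdifferentiableAt (by simp)

lemma VField.SmoothOn.smoothAt {V : VField n X} {U : Set X} {q : X} (h : V.SmoothOn U)
    (hU : IsOpen U) (hq : q ∈ U) : V.SmoothAt q :=
  h.contMDiffAt (hU.mem_nhds hq)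

/-- Coordinate vector fields are smooth, being pullbacks of constant vector fields. -/
lemma coordField_smoothAt (hφ : φ ∈ IsManifold.maximalAtlas (𝓡 (2 * n + 1)) ∞ X)
    (k : Fin (2 * n + 1)) {q : X} (hq : q ∈ φ.source) : (coordField φ k).SmoothAt q := by
  have hV : ContMDiffAt (𝓡 (2 * n + 1)) (𝓡 (2 * n + 1)).tangent ∞
      (fun y : RVec n => (⟨y, stdVec k⟩ : TangentBundle (𝓡 (2 * n + 1)) (RVec n))) (φ q) :=
    contMDiffWithinAt_univ.1 (contMDiffWithinAt_vectorSpace_iff_contDiffWithinAt.2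
      contDiffWithinAt_const)
  exact hV.mpullback_vectorField_preimage (contMDiffAt_of_mem_maximalAtlas hφ hq)
    (isInvertible_push hφ hq) (by simp)

/-- The components, in a chart, of a vector field which is smooth at a point are smooth. -/
lemma contDiffAt_push (hφ : φ ∈ IsManifold.maximalAtlas (𝓡 (2 * n + 1)) ∞ X) {V : VField n X}
    {x : RVec n} (hx : x ∈ φ.target)
    (hV : V.SmoothAt (φ.symm x)) :
    ContDiffAt ℝ ∞ (fun y => push φ (φ.symm y) (V (φ.symm y))) x := by
  have hsrc := φ.map_target hx
  have h1 : ContMDiffOn (𝓡 (2 * n + 1)).tangent (𝓡 (2 * n + 1)).tangent ∞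
      (tangentMapWithin (𝓡 (2 * n + 1)) (𝓡 (2 * n + 1)) φ φ.source)
      (TotalSpace.proj ⁻¹' φ.source) :=
    (contMDiffOn_of_mem_maximalAtlas hφ).contMDiffOn_tangentMapWithin (by simp)
      φ.open_source.uniqueMDiffOn
  have hopen : IsOpen ((TotalSpace.proj : TangentBundle (𝓡 (2 * n + 1)) X → X) ⁻¹' φ.source) :=
    φ.open_source.preimage (FiberBundle.continuous_proj _ _)
  have h2 := (h1.contMDiffAt (hopen.mem_nhds (x := V.toBundle (φ.symm x)) hsrc)).comp _ hV
  have h3 := ((contMDiff_snd_tangentBundle_modelSpace (RVec n) (𝓡 (2 * n + 1)) (n := ∞)).contMDiffAt).comp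
    _ h2
  have h4 := h3.comp x (contMDiffAt_symm_of_mem_maximalAtlas hφ hx)
  refine (contMDiffAt_iff_contDiffAt.1 h4).congr_of_eventuallyEq ?_
  filter_upwards [φ.open_target.mem_nhds hx] with y hy
  have : mfderivWithin (𝓡 (2 * n + 1)) (𝓡 (2 * n + 1)) φ φ.source (φ.symm y)
      = mfderiv (𝓡 (2 * n + 1)) (𝓡 (2 * n + 1)) φ (φ.symm y) :=
    mfderivWithin_of_isOpen φ.open_source (φ.map_target hy)
  simp only [Function.comp, tangentMapWithin, VField.toBundle]
  rw [this]
  rfl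

lemma contMDiffAt_push_comp (hφ : φ ∈ IsManifold.maximalAtlas (𝓡 (2 * n + 1)) ∞ X)
    {V : VField n X} {q : X} (hq : q ∈ φ.source) (hV : V.SmoothAt q) (k : Fin (2 * n + 1)) :
    ContMDiffAt (𝓡 (2 * n + 1)) 𝓘(ℝ, ℝ) ∞ (fun q' => push φ q' (V q') k) q := by
  have h1 := contDiffAt_push hφ (φ.map_source hq) (V := V) (by rwa [φ.left_inv hq])
  have h2 := (contDiffAt_euclidean.1 h1 k).contMDiffAt.comp q
    (contMDiffAt_of_mem_maximalAtlas hφ hq)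
  refine h2.congr_of_eventuallyEq ?_
  filter_upwards [φ.open_source.mem_nhds hq] with y hy
  exact (congrArg (fun q' => push φ q' (V q') k) (φ.left_inv hy)).symm

/-- The derivative of a function along a tangent vector, in a chart. -/
lemma mvfderiv_eq_fderiv (hφ : φ ∈ IsManifold.maximalAtlas (𝓡 (2 * n + 1)) ∞ X) {q : X}
    (hq : q ∈ φ.source) {f : X → ℝ} (hf : MDifferentiableAt (𝓡 (2 * n + 1)) 𝓘(ℝ, ℝ) f q)
    (u : TangentSpace (𝓡 (2 * n + 1)) q) :
    mvfderiv (𝓡 (2 * n + 1)) f q u = fderiv ℝ (fun y => f (φ.symm y)) (φ q) (push φ q u) := by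
  have h1 := mem_maximalAtlas_of_le hφ
  have hsymm := mdifferentiableAt_symm_of_mem_maximalAtlas h1 (φ.map_source hq)
  have hf' : MDifferentiableAt (𝓡 (2 * n + 1)) 𝓘(ℝ, ℝ) f (φ.symm (φ q)) := by
    rwa [φ.left_inv hq]
  have hg : MDifferentiableAt (𝓡 (2 * n + 1)) 𝓘(ℝ, ℝ) (f ∘ φ.symm) (φ q) := hf'.comp _ hsymm
  have heq : f =ᶠ[𝓝 q] (f ∘ φ.symm) ∘ φ := by
    filter_upwards [φ.open_source.mem_nhds hq] with y hy
    simp [φ.left_inv hy]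
  have h2 : mfderiv (𝓡 (2 * n + 1)) 𝓘(ℝ, ℝ) f q
      = mfderiv (𝓡 (2 * n + 1)) 𝓘(ℝ, ℝ) ((f ∘ φ.symm) ∘ φ) q := heq.mfderiv_eq
  have h3 := mfderiv_comp_apply q hg (mdifferentiableAt_of_mem_maximalAtlas h1 hq) u
  have h4 : mfderiv (𝓡 (2 * n + 1)) 𝓘(ℝ, ℝ) (f ∘ φ.symm) (φ q) = fderiv ℝ (f ∘ φ.symm) (φ q) :=
    mfderiv_eq_fderiv
  change mfderiv (𝓡 (2 * n + 1)) 𝓘(ℝ, ℝ) f q u = _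
  rw [h2]
  refine h3.trans ?_
  rw [h4]
  rfl

lemma mlieBracket_eq_lieBracket (V W : ∀ x : RVec n, TangentSpace (𝓡 (2 * n + 1)) x) :
    mlieBracket (𝓡 (2 * n + 1)) V W = lieBracket ℝ V W := by
  rw [← mlieBracketWithin_univ, mlieBracketWithin_eq_lieBracketWithin]
  exact lieBracketWithin_univ

lemma bracket_coordField (hφ : φ ∈ IsManifold.maximalAtlas (𝓡 (2 * n + 1)) ∞ X) {q : X}
    (hq : q ∈ φ.source) (j k : Fin (2 * n + 1)) :
    (coordField φ j).bracket (coordField φ k) q = 0 := by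
  have hc : ∀ k : Fin (2 * n + 1), MDifferentiableAt (𝓡 (2 * n + 1)) (𝓡 (2 * n + 1)).tangent
      (fun y : RVec n => (⟨y, stdVec k⟩ : TangentBundle (𝓡 (2 * n + 1)) (RVec n))) (φ q) :=
    fun k => (contMDiffWithinAt_univ.1 (contMDiffWithinAt_vectorSpace_iff_contDiffWithinAt.2
      (contDiffWithinAt_const (n := 1)))).mdifferentiableAt one_ne_zero
  have : IsManifold (𝓡 (2 * n + 1)) (minSmoothness ℝ 2) X :=
    IsManifold.of_le (n := ∞) (by simpa using ENat.LEInfty.out)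
  have h := mpullback_mlieBracket (n := ∞) (hc j) (hc k) (contMDiffAt_of_mem_maximalAtlas hφ hq)
    (by simpa using ENat.LEInfty.out)
  refine h.symm.trans ?_
  rw [mpullback_apply]
  have h0 : mlieBracket (𝓡 (2 * n + 1)) (fun x : RVec n => (stdVec j : TangentSpace (𝓡 (2 * n + 1)) x))
      (fun x : RVec n => (stdVec k : TangentSpace (𝓡 (2 * n + 1)) x)) (φ q) = 0 := by
    refine (congrFun (mlieBracket_eq_lieBracket _ _) (φ q)).trans ?_
    exact (by simp [lieBracket] :
      lieBracket ℝ (fun _ : RVec n => stdVec j) (fun _ : RVec n => stdVec k) (φ q) = 0)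
  rw [h0]
  simp

/-! ### Induced coordinates on the cotangent bundle -/

lemma cotPoint_apply (y : RVec n × RVec n) (v : TangentSpace (𝓡 (2 * n + 1)) (φ.symm y.1)) :
    (cotPoint φ y).2 v = ∑ k, y.2 k * push φ (φ.symm y.1) v k := by
  change inner ℝ y.2 (push φ (φ.symm y.1) v) = _
  simp [PiLp.inner_apply, mul_comm]

lemma cotCoord_cotPoint (hφ : φ ∈ IsManifold.maximalAtlas (𝓡 (2 * n + 1)) ∞ X)
    {y : RVec n × RVec n} (hy : y.1 ∈ φ.target) : cotCoord φ (cotPoint φ y) = y := by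
  refine Prod.ext (φ.right_inv hy) ?_
  ext k
  change (cotPoint φ y).2 (coordField φ k (φ.symm y.1)) = _
  rw [cotPoint_apply, push_coordField hφ (φ.map_target hy)]
  simp [stdVec]

lemma cotPoint_cotCoord (hφ : φ ∈ IsManifold.maximalAtlas (𝓡 (2 * n + 1)) ∞ X)
    {z : CotBundle n X} (hz : z.1 ∈ φ.source) : cotPoint φ (cotCoord φ z) = z := by
  obtain ⟨q, α⟩ := z
  have hbase : φ.symm (cotCoord φ ⟨q, α⟩).1 = q := φ.left_inv hz
  have key : ∀ (q' : X) (_ : q' = q), (⟨q', (innerSL ℝ (cotCoord φ ⟨q, α⟩).2).comp (push φ q')⟩ :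
      CotBundle n X) = ⟨q, α⟩ := by
    rintro _ rfl
    congr 1
    ext v
    conv_rhs => rw [eq_sum_coordField hφ hz v]
    rw [map_sum]
    simp [cotCoord, PiLp.inner_apply]
  exact key _ hbase

/-- The induced coordinates on `T*X` are smooth. -/
lemma cotCoord_contMDiffAt (hφ : φ ∈ IsManifold.maximalAtlas (𝓡 (2 * n + 1)) ∞ X)
    {z : CotBundle n X} (hz : z.1 ∈ φ.source) :
    ContMDiffAt (cotModel n) 𝓘(ℝ, RVec n × RVec n) ∞ (cotCoord φ) z := by
  have hproj : ContMDiffAt (cotModel n) (𝓡 (2 * n + 1)) ∞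
      (fun w : CotBundle n X => w.1) z := contMDiff_proj _ z
  refine ContMDiffAt.prodMk_space ?_ ?_
  · exact (contMDiffAt_of_mem_maximalAtlas hφ hz).comp z hproj
  · have hcomp : ∀ k, ContMDiffAt (cotModel n) 𝓘(ℝ, ℝ) ∞
        (fun w : CotBundle n X => (w.2 (coordField φ k w.1) : ℝ)) z := by
      intro k
      have h1 : ContMDiffAt (cotModel n) (𝓡 (2 * n + 1)).tangent ∞
          (fun w : CotBundle n X => (coordField φ k).toBundle w.1) z :=
        (coordField_smoothAt hφ k hz).comp z hproj
      have h2 := ContMDiffAt.clm_bundle_apply (b := fun w : CotBundle n X => w.1)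
        (ϕ := fun w => w.2) (v := fun w => coordField φ k w.1)
        (contMDiffAt_id (x := z)) h1
      exact (contMDiffAt_totalSpace.1 h2).2
    exact (PiLp.contDiff_toLp (𝕜 := ℝ) (p := 2) (n := ∞)).contMDiff.contMDiffAt.comp z
      (contMDiffAt_pi_space.2 hcomp)

/-- The parametrization of `T*X` by the induced coordinates is smooth. -/
lemma cotPoint_contMDiffAt (hφ : φ ∈ IsManifold.maximalAtlas (𝓡 (2 * n + 1)) ∞ X)
    {y : RVec n × RVec n} (hy : y.1 ∈ φ.target) :
    ContMDiffAt 𝓘(ℝ, RVec n × RVec n) (cotModel n) ∞ (cotPoint φ) y := by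
  have hbase : ContMDiffAt 𝓘(ℝ, RVec n × RVec n) (𝓡 (2 * n + 1)) ∞
      (fun w : RVec n × RVec n => φ.symm w.1) y :=
    (contMDiffAt_symm_of_mem_maximalAtlas hφ hy).comp y contDiff_fst.contMDiff.contMDiffAt
  rw [contMDiffAt_hom_bundle]
  refine ⟨hbase, ?_⟩
  have h1 := ((contMDiffAt_of_mem_maximalAtlas hφ (φ.map_target hy)).mfderiv_const
    (m := ∞) (by simp)).comp y hbase
  have h2 : ContMDiffAt 𝓘(ℝ, RVec n × RVec n) 𝓘(ℝ, RVec n →L[ℝ] ℝ) ∞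
      (fun w : RVec n × RVec n => innerSL ℝ w.2) y :=
    ((innerSL ℝ).contDiff.comp contDiff_snd).contMDiff.contMDiffAt
  refine (h2.clm_comp h1).congr_of_eventuallyEq (Filter.Eventually.of_forall fun w => ?_)
  ext v
  simp [inTangentCoordinates, ContinuousLinearMap.inCoordinates, cotPoint]
  rfl

/-! ### Connections in coordinates -/

lemma nabla_congr {V W : VField n X} {q : X} (hV : V.SmoothAt q) (hW : W.SmoothAt q)
    (h : ∀ᶠ q' in 𝓝 q, V q' = W q') : nabla V q = nabla W q :=
  nabla.isCovariantDerivativeOnUniv.congr_of_eventuallyEq hV.mdiff hW.mdiff Filter.univ_mem h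

lemma nabla_sum_smul {ι : Type*} (s : Finset ι) (f : ι → X → ℝ) (V : ι → VField n X) {q : X}
    (hf : ∀ i, ContMDiffAt (𝓡 (2 * n + 1)) 𝓘(ℝ, ℝ) ∞ (f i) q) (hV : ∀ i, (V i).SmoothAt q)
    (u : TangentSpace (𝓡 (2 * n + 1)) q) :
    nabla (fun q' => ∑ i ∈ s, f i q' • V i q') q u
      = ∑ i ∈ s, (f i q • nabla (V i) q u + mvfderiv (𝓡 (2 * n + 1)) (f i) q u • V i q) := by
  classical
  induction s using Finset.induction_on with
  | empty =>
    simp only [Finset.sum_empty]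
    have := congrFun nabla.zero q
    exact DFunLike.congr_fun this u
  | insert i s hi ih =>
    simp only [Finset.sum_insert hi]
    have h1 : VField.SmoothAt (f i • V i) q := (hf i).smul_section (hV i)
    have h2 : VField.SmoothAt (fun q' => ∑ i ∈ s, f i q' • V i q') q :=
      ContMDiffAt.sum_section (t := fun i q' => f i q' • V i q')
        fun i _ => (hf i).smul_section (hV i)
    have h3 := nabla.isCovariantDerivativeOnUniv.add h1.mdiff h2.mdiff
    have h4 := nabla.isCovariantDerivativeOnUniv.leibniz (hV i).mdiff
      ((hf i).mdifferentiableAt (by simp))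
    have h5 : nabla (fun q' => f i q' • V i q' + ∑ i ∈ s, f i q' • V i q') q
      = nabla (f i • V i) q + nabla (fun q' => ∑ i ∈ s, f i q' • V i q') q := h3
    have h6 : nabla (f i • V i) q = _ := h4
    rw [h5, add_apply, ih, h6]
    simp

/-- The covariant derivative in coordinates: `∇_u V = ∑ₖ Vᵏ ∇_u ∂ₖ + dVᵏ(u) ∂ₖ`. -/
lemma nabla_eq_sum (hφ : φ ∈ IsManifold.maximalAtlas (𝓡 (2 * n + 1)) ∞ X) {V : VField n X} {q : X}
    (hq : q ∈ φ.source) (hV : V.SmoothAt q) (u : TangentSpace (𝓡 (2 * n + 1)) q) :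
    nabla V q u = ∑ k, (push φ q (V q) k • nabla (coordField φ k) q u
      + fderiv ℝ (fun y => push φ (φ.symm y) (V (φ.symm y)) k) (φ q) (push φ q u)
        • coordField φ k q) := by
  have hf := contMDiffAt_push_comp hφ hq hV
  have h1 : VField.SmoothAt (fun q' => ∑ k, push φ q' (V q') k • coordField φ k q') q :=
    ContMDiffAt.sum_section (t := fun k q' => push φ q' (V q') k • coordField φ k q')
      fun k _ => (hf k).smul_section (coordField_smoothAt hφ k hq)
  rw [nabla_congr hV h1 (by
    filter_upwards [φ.open_source.mem_nhds hq] with q' hq'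
    exact eq_sum_coordField hφ hq' _)]
  rw [nabla_sum_smul _ _ _ hf (fun k => coordField_smoothAt hφ k hq)]
  refine Finset.sum_congr rfl fun k _ => ?_
  rw [mvfderiv_eq_fderiv hφ hq ((hf k).mdifferentiableAt (by simp))]

/-- A smooth connection differentiates smooth local vector fields to smooth local vector fields.
Since smoothness of the connection concerns global vector fields, the field is multiplied with a
bump function. -/
lemma nabla_smoothAt [T2Space X] (hn : CovariantDerivative.ContMDiffCovariantDerivative nabla ∞)
    {U : Set X} (hU : IsOpen U) {V W : VField n X} {q : X} (hq : q ∈ U) (hV : V.SmoothOn U)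
    (hW : W.SmoothAt q) : VField.SmoothAt (fun q' => nabla V q' (W q')) q := by
  obtain ⟨χ, -, hχ⟩ := (SmoothBumpFunction.nhds_basis_tsupport (I := 𝓡 (2 * n + 1)) q).mem_iff.1
    (hU.mem_nhds hq)
  have hglob : ContMDiff (𝓡 (2 * n + 1)) (𝓡 (2 * n + 1)).tangent ∞
      (VField.toBundle (fun q' => χ q' • V q')) :=
    ContMDiffOn.smul_section_of_tsupport (χ.contMDiff.contMDiffOn) hU hχ hV
  have h1 := hn.contMDiff.contMDiff (σ := fun q' => χ q' • V q')
    (by simpa using! hglob.contMDiffOn)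
  have h2 : VField.SmoothAt (fun q' => nabla (fun q' => χ q' • V q') q' (W q')) q :=
    ContMDiffAt.clm_bundle_apply (b := fun q' : X => q')
      (h1.contMDiffAt Filter.univ_mem) hW
  refine h2.congr_of_eventuallyEq ?_
  filter_upwards [χ.eventuallyEq_one.eventually_nhds, hU.mem_nhds hq] with q' hq' hq'U
  simp only [VField.toBundle]
  rw [nabla_congr (hV.smoothAt hU hq'U) (hglob.contMDiffAt) (by
    filter_upwards [hq'] with q'' hq''
    simp [hq''])]

/-- The vector of Christoffel symbols: the components of `∇_{∂_j} ∂_l` at the point with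
coordinates `x`. -/
def christ (nabla : CovariantDerivative (𝓡 (2 * n + 1)) (RVec n)
      (TangentSpace (𝓡 (2 * n + 1)) : X → Type))
    (φ : OpenPartialHomeomorph X (RVec n)) (j l : Fin (2 * n + 1)) (x : RVec n) : RVec n :=
  push φ (φ.symm x) (nabla (coordField φ l) (φ.symm x) (coordField φ j (φ.symm x)))

lemma christ_contDiffAt [T2Space X]
    (hn : CovariantDerivative.ContMDiffCovariantDerivative nabla ∞)
    (hφ : φ ∈ IsManifold.maximalAtlas (𝓡 (2 * n + 1)) ∞ X) (j l : Fin (2 * n + 1)) {x : RVec n}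
    (hx : x ∈ φ.target) : ContDiffAt ℝ ∞ (christ nabla φ j l) x :=
  contDiffAt_push (V := fun q => nabla (coordField φ l) q (coordField φ j q)) hφ hx
    (nabla_smoothAt hn φ.open_source (φ.map_target hx)
      (fun _ hq => (coordField_smoothAt hφ l hq).contMDiffWithinAt)
      (coordField_smoothAt hφ j (φ.map_target hx)))

lemma push_nabla_coordField (x a : RVec n) (l : Fin (2 * n + 1)) :
    push φ (φ.symm x) (nabla (coordField φ l) (φ.symm x) (pull φ (φ.symm x) a))
      = ∑ j, a j • christ nabla φ j l x := by
  rw [pull_eq_sum]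
  simp [christ]

/-! ### The complexified tangent space -/

/-- The real part `a` of the complex tangent vector `a + i b`. -/
def reC {x : X} : CTangent n x →ₗ[ℝ] TangentSpace (𝓡 (2 * n + 1)) x :=
  (TensorProduct.lid ℝ (TangentSpace (𝓡 (2 * n + 1)) x)).toLinearMap ∘ₗ
    LinearMap.rTensor _ Complex.reLm

/-- The imaginary part `b` of the complex tangent vector `a + i b`. -/
def imC {x : X} : CTangent n x →ₗ[ℝ] TangentSpace (𝓡 (2 * n + 1)) x :=
  (TensorProduct.lid ℝ (TangentSpace (𝓡 (2 * n + 1)) x)).toLinearMap ∘ₗ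
    LinearMap.rTensor _ Complex.imLm

section

variable {x : X} (a b a' b' : TangentSpace (𝓡 (2 * n + 1)) x)

@[simp] lemma reC_cvec : reC (cvec a b) = a := by simp [reC, cvec]

@[simp] lemma imC_cvec : imC (cvec a b) = b := by simp [imC, cvec]

lemma cvec_reC_imC (u : CTangent n x) : cvec (reC u) (imC u) = u := by
  induction u using TensorProduct.induction_on with
  | zero => simp [cvec]
  | tmul c v =>
    simp only [cvec, reC, imC, LinearMap.comp_apply, LinearMap.rTensor_tmul,
      LinearEquiv.coe_coe, TensorProduct.lid_tmul, Complex.reLm_coe, Complex.imLm_coe,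
      ← TensorProduct.smul_tmul, ← TensorProduct.add_tmul]
    congr 1
    apply Complex.ext <;> simp
  | add u v hu hv =>
    rw [← hu, ← hv]
    simp only [cvec, map_add, TensorProduct.tmul_add]
    simp [reC, imC]
    abel

lemma cvec_add : cvec a b + cvec a' b' = cvec (a + a') (b + b') := by
  simp only [cvec, TensorProduct.tmul_add]
  abel

lemma conjC_cvec : conjC x (cvec a b) = cvec a (-b) := by
  simp [conjC, cvec, TensorProduct.neg_tmul, TensorProduct.tmul_neg]

lemma smul_cvec (c : ℂ) :
    c • cvec a b = cvec (c.re • a - c.im • b) (c.re • b + c.im • a) := by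
  simp only [cvec, smul_add, TensorProduct.smul_tmul', smul_eq_mul, mul_one,
    TensorProduct.tmul_sub, TensorProduct.tmul_add, ← TensorProduct.smul_tmul]
  have h1 : c ⊗ₜ[ℝ] a = (c.re • (1 : ℂ)) ⊗ₜ[ℝ] a + (c.im • Complex.I) ⊗ₜ[ℝ] a := by
    rw [← TensorProduct.add_tmul]
    congr 1
    apply Complex.ext <;> simp
  have h2 : (c * Complex.I) ⊗ₜ[ℝ] b = (c.re • Complex.I) ⊗ₜ[ℝ] b - (c.im • (1 : ℂ)) ⊗ₜ[ℝ] b := by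
    rw [← TensorProduct.sub_tmul]
    congr 1
    apply Complex.ext <;> simp
  rw [h1, h2]
  abel

lemma one_tmul_eq : (1 : ℂ) ⊗ₜ[ℝ] a = cvec a 0 := by simp [cvec]

lemma cvec_inj : cvec a b = cvec a' b' ↔ a = a' ∧ b = b' :=
  ⟨fun h => ⟨by simpa using congrArg reC h, by simpa using congrArg imC h⟩,
    fun h => by rw [h.1, h.2]⟩

lemma mem_conjSub {W : Submodule ℂ (CTangent n x)} {u : CTangent n x} :
    u ∈ conjSub W ↔ conjC x u ∈ W := Iff.rfl

lemma conjC_conjC (u : CTangent n x) : conjC x (conjC x u) = u := by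
  rw [← cvec_reC_imC u, conjC_cvec, conjC_cvec, neg_neg]

end

/-! ### The complex structure of the Levi distribution -/

/-- A real tangent vector lies in `HX` if and only if it is the real part of a vector in
`T^{1,0}X`. -/
lemma CRStructure.mem_levi_iff (S : CRStructure n X) {x : X}
    (v : TangentSpace (𝓡 (2 * n + 1)) x) : v ∈ S.levi x ↔ ∃ b, cvec v b ∈ S.T10 x := by
  constructor
  · intro h
    obtain ⟨u, hu, w, hw, huw⟩ := Submodule.mem_sup.1
      (show (1 : ℂ) ⊗ₜ[ℝ] v ∈ S.T10 x ⊔ conjSub (S.T10 x) from h)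
    -- with `v = u + w`, also `v = v̄ = w̄ + ū`, hence `v` is the real part of `u + w̄`
    refine ⟨imC (u + conjC x w), ?_⟩
    have h1 : reC (u + conjC x w) = v := by
      have h2 := congrArg reC huw
      have h3 : reC (conjC x w) = reC w := by
        conv_lhs => rw [← cvec_reC_imC w, conjC_cvec, reC_cvec]
      rw [map_add, h3, ← map_add, h2, one_tmul_eq, reC_cvec]
    rw [← h1, cvec_reC_imC]
    exact (S.T10 x).add_mem hu hw
  · rintro ⟨b, hb⟩
    change (1 : ℂ) ⊗ₜ[ℝ] v ∈ S.T10 x ⊔ conjSub (S.T10 x)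
    have h1 : (1 : ℂ) ⊗ₜ[ℝ] v = ((1 / 2 : ℂ)) • cvec v b + (1 / 2 : ℂ) • conjC x (cvec v b) := by
      rw [conjC_cvec, one_tmul_eq, smul_cvec, smul_cvec, cvec_add, cvec_inj]
      norm_num
      rw [← add_smul]
      norm_num
    rw [h1]
    refine Submodule.add_mem_sup (Submodule.smul_mem _ _ hb) (Submodule.smul_mem _ _ ?_)
    rw [mem_conjSub, conjC_conjC]
    exact hb

/-- Multiplication by `-i` maps `a + i b` to `b - i a`. -/
lemma CRStructure.cvec_rotate (S : CRStructure n X) {x : X}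
    {a b : TangentSpace (𝓡 (2 * n + 1)) x} (h : cvec a b ∈ S.T10 x) : cvec b (-a) ∈ S.T10 x := by
  have := (S.T10 x).smul_mem (-Complex.I) h
  rw [smul_cvec] at this
  simpa using this

namespace PseudohermitianStructure

variable {S : PseudohermitianStructure n X} {T : VField n X}

lemma ev_eq_zero_of_mem {x : X} {a b : TangentSpace (𝓡 (2 * n + 1)) x}
    (h : cvec a b ∈ S.T10 x) : S.ω₀.ev a = 0 :=
  (S.ker_eq x a).2 ((S.mem_levi_iff a).2 ⟨b, h⟩)

/-- The real frame `A_1, ..., A_n, B_1, ..., B_n, 𝒯` given by a complex frame `A_j + i B_j`. -/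
def realFrame (T : VField n X) (A B : Fin n → VField n X) : (Fin n ⊕ Fin n) ⊕ Unit → VField n X :=
  Sum.elim (Sum.elim A B) fun _ => T

lemma linearIndependent_realFrame (hT : S.IsReeb T) {U : Set X} {A B : Fin n → VField n X}
    (h : IsComplexFrameOn S.T10 U A B) {x : X} (hx : x ∈ U) :
    LinearIndependent ℝ fun i => realFrame T A B i x := by
  have hmem : ∀ j, cvec (A j x) (B j x) ∈ S.T10 x := fun j => by
    rw [← h.span_eq x hx]
    exact Submodule.subset_span ⟨j, rfl⟩
  rw [Fintype.linearIndependent_iff]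
  intro g hg
  simp only [Fintype.sum_sum_type, realFrame, Sum.elim_inl, Sum.elim_inr, Finset.univ_unique,
    Finset.sum_singleton] at hg
  have hc : g (Sum.inr default) = 0 := by
    have h1 := congrArg (fun v => S.ω₀.ev v) hg
    have hA : ∀ j, S.ω₀ x (A j x) = 0 := fun j => ev_eq_zero_of_mem (hmem j)
    have hB : ∀ j, S.ω₀ x (B j x) = 0 := fun j => ev_eq_zero_of_mem (S.cvec_rotate (hmem j))
    have hT' : S.ω₀ x (T x) = -1 := hT.eval_eq x
    simpa [OneForm.ev, hA, hB, hT'] using h1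
  rw [hc, zero_smul, add_zero] at hg
  -- the remaining combination is the real part of `u = ∑ⱼ c_j (A_j + i B_j)`; a vector with vanishing
  -- real part lies in `T^{1,0}X ∩ T^{0,1}X = 0`
  set c : Fin n → ℂ := fun j => ⟨g (Sum.inl (Sum.inl j)), -g (Sum.inl (Sum.inr j))⟩ with hcdef
  set u : CTangent n x := ∑ j, c j • cvec (A j x) (B j x) with hu
  have hu10 : u ∈ S.T10 x := Submodule.sum_mem _ fun j _ => Submodule.smul_mem _ _ (hmem j)
  have hre : reC u = 0 := by
    rw [hu, map_sum, ← hg, ← Finset.sum_add_distrib]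
    refine Finset.sum_congr rfl fun j _ => ?_
    rw [smul_cvec, reC_cvec]
    simp [hcdef]
  have hconj : conjC x u = -u := by
    rw [← cvec_reC_imC u, hre, conjC_cvec]
    simp [cvec, TensorProduct.tmul_neg]
  have hu0 : u = 0 := by
    have : u ∈ S.T10 x ⊓ conjSub (S.T10 x) :=
      ⟨hu10, by rw [SetLike.mem_coe, mem_conjSub, hconj]; exact Submodule.neg_mem _ hu10⟩
    rwa [S.inf_conj x, Submodule.mem_bot] at this
  have hcz := Fintype.linearIndependent_iff.1 (h.linearIndependent x hx) c hu0
  rintro ((j | j) | j)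
  · simpa [hcdef] using congrArg Complex.re (hcz j)
  · simpa [hcdef] using congrArg Complex.im (hcz j)
  · exact hc

/-- The basis of `T_x X` given by the real frame. -/
def realBasis (hT : S.IsReeb T) {U : Set X} {A B : Fin n → VField n X}
    (h : IsComplexFrameOn S.T10 U A B) {x : X} (hx : x ∈ U) :
    Module.Basis ((Fin n ⊕ Fin n) ⊕ Unit) ℝ (TangentSpace (𝓡 (2 * n + 1)) x) :=
  basisOfLinearIndependentOfCardEqFinrank (linearIndependent_realFrame hT h hx) (by
    have : Module.finrank ℝ (TangentSpace (𝓡 (2 * n + 1)) x) = 2 * n + 1 :=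
      finrank_euclideanSpace_fin (𝕜 := ℝ) (n := 2 * n + 1)
    rw [this]
    simp
    ring)

lemma realBasis_apply (hT : S.IsReeb T) {U : Set X} {A B : Fin n → VField n X}
    (h : IsComplexFrameOn S.T10 U A B) {x : X} (hx : x ∈ U) (i : (Fin n ⊕ Fin n) ⊕ Unit) :
    realBasis hT h hx i = realFrame T A B i x := by
  simp [realBasis]

/-- The complex structure of `HX` exists, so `J` is not given by the default value in its
definition. -/
lemma exists_isComplexStructureAt (hT : S.IsReeb T) (x : X) :
    ∃ L, S.IsComplexStructureAt T x L := by
  obtain ⟨U, -, hx, A, B, h⟩ := S.exists_frame x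
  let L := (realBasis hT h hx).constr ℝ
    (Sum.elim (Sum.elim (fun j => -B j x) fun j => A j x) fun _ => 0)
  have hLA : ∀ j, L (A j x) = -B j x := fun j => by
    have := (realBasis hT h hx).constr_basis ℝ
      (Sum.elim (Sum.elim (fun j => -B j x) fun j => A j x) fun _ => 0) (Sum.inl (Sum.inl j))
    rwa [realBasis_apply] at this
  have hLB : ∀ j, L (B j x) = A j x := fun j => by
    have := (realBasis hT h hx).constr_basis ℝ
      (Sum.elim (Sum.elim (fun j => -B j x) fun j => A j x) fun _ => 0) (Sum.inl (Sum.inr j))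
    rwa [realBasis_apply] at this
  have hLT : L (T x) = 0 := by
    have := (realBasis hT h hx).constr_basis ℝ
      (Sum.elim (Sum.elim (fun j => -B j x) fun j => A j x) fun _ => 0) (Sum.inr ())
    rwa [realBasis_apply] at this
  have key : ∀ u ∈ S.T10 x, L (reC u) = -imC u ∧ L (imC u) = reC u := by
    intro u hu
    rw [← h.span_eq x hx] at hu
    induction hu using Submodule.span_induction with
    | mem u hu =>
      obtain ⟨j, rfl⟩ := hu
      simp [hLA, hLB]
    | zero => simp
    | add u v _ _ hu hv =>
      simp only [map_add, hu.1, hu.2, hv.1, hv.2, and_true]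
      abel
    | smul c u _ hu =>
      rw [← cvec_reC_imC u, smul_cvec]
      simp only [reC_cvec, imC_cvec, map_sub, map_add, map_smul, hu.1, hu.2]
      constructor <;> module
  refine ⟨L, hLT, fun v u hu hv => ?_⟩
  have hv' : v = 2 • reC u := by
    have := congrArg reC hv
    rw [← cvec_reC_imC u, conjC_cvec, cvec_add, one_tmul_eq, reC_cvec, reC_cvec] at this
    rw [this]
    simp [two_smul]
  rw [hv', map_nsmul, (key u hu).1, ← cvec_reC_imC u, conjC_cvec, smul_cvec, smul_cvec,
    one_tmul_eq, imC_cvec]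
  simp [two_smul, cvec, TensorProduct.tmul_neg, TensorProduct.tmul_add]
  abel

lemma J_spec (hT : S.IsReeb T) (x : X) : S.IsComplexStructureAt T x (S.J T x) := by
  unfold J
  rw [dif_pos (exists_isComplexStructureAt hT x)]
  exact (exists_isComplexStructureAt hT x).choose_spec

lemma J_reeb (hT : S.IsReeb T) (x : X) : S.J T x (T x) = 0 := (J_spec hT x).reeb

lemma J_re (hT : S.IsReeb T) {x : X} {a b : TangentSpace (𝓡 (2 * n + 1)) x}
    (h : cvec a b ∈ S.T10 x) : S.J T x a = -b := by
  have h1 := (J_spec hT x).levi ((2 : ℝ) • a) _ h (by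
    rw [conjC_cvec, cvec_add, one_tmul_eq, cvec_inj]
    simp [two_smul])
  have h2 := congrArg reC h1
  rw [conjC_cvec, smul_cvec, smul_cvec, one_tmul_eq, reC_cvec, map_sub, reC_cvec, reC_cvec] at h2
  have h3 : (2 : ℝ) • S.J T x a = (2 : ℝ) • (-b) := by
    rw [← map_smul, h2]
    simp [two_smul]
    abel
  exact smul_right_injective _ (two_ne_zero' ℝ) h3

lemma J_im (hT : S.IsReeb T) {x : X} {a b : TangentSpace (𝓡 (2 * n + 1)) x}
    (h : cvec a b ∈ S.T10 x) : S.J T x b = a := by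
  rw [J_re hT (S.cvec_rotate h), neg_neg]

lemma J_mem_levi (hT : S.IsReeb T) {x : X} {v : TangentSpace (𝓡 (2 * n + 1)) x}
    (h : v ∈ S.levi x) : S.J T x v ∈ S.levi x := by
  obtain ⟨b, hb⟩ := (S.mem_levi_iff v).1 h
  rw [J_re hT hb, Submodule.neg_mem_iff, S.mem_levi_iff]
  exact ⟨_, S.cvec_rotate hb⟩

/-- The matrix of `J` in the coordinates given by a chart. -/
def JMat (S : PseudohermitianStructure n X) (T : VField n X)
    (φ : OpenPartialHomeomorph X (RVec n)) (x : RVec n) : RVec n →L[ℝ] RVec n :=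
  LinearMap.toContinuousLinearMap
    ((push φ (φ.symm x)).toLinearMap ∘ₗ S.J T (φ.symm x) ∘ₗ (pull φ (φ.symm x)).toLinearMap)

lemma JMat_apply (x a : RVec n) :
    S.JMat T φ x a = push φ (φ.symm x) (S.J T (φ.symm x) (pull φ (φ.symm x) a)) := rfl

lemma JMat_push (hφ : φ ∈ IsManifold.maximalAtlas (𝓡 (2 * n + 1)) ∞ X) {x : RVec n}
    (hx : x ∈ φ.target) (v : TangentSpace (𝓡 (2 * n + 1)) (φ.symm x)) :
    S.JMat T φ x (push φ (φ.symm x) v) = push φ (φ.symm x) (S.J T (φ.symm x) v) := by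
  rw [JMat_apply, pull_push hφ (φ.map_target hx)]

lemma JMat_contDiffAt (hT : S.IsReeb T)
    (hφ : φ ∈ IsManifold.maximalAtlas (𝓡 (2 * n + 1)) ∞ X) {x : RVec n} (hx : x ∈ φ.target) :
    ContDiffAt ℝ ∞ (S.JMat T φ) x := by
  obtain ⟨U, hU, hxU, A, B, h⟩ := S.exists_frame (φ.symm x)
  -- `J = E' E⁻¹`, where `E` and `E'` are the matrices of the frames `(A, B, 𝒯)` and `(-B, A, 0)`
  let E : RVec n → (((Fin n ⊕ Fin n) ⊕ Unit) → ℝ) →L[ℝ] RVec n := fun y =>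
    ∑ i, (ContinuousLinearMap.proj i).smulRight (push φ (φ.symm y) (realFrame T A B i (φ.symm y)))
  let E' : RVec n → (((Fin n ⊕ Fin n) ⊕ Unit) → ℝ) →L[ℝ] RVec n := fun y =>
    ∑ i, (ContinuousLinearMap.proj i).smulRight
      (push φ (φ.symm y) (realFrame 0 (fun j => -B j) A i (φ.symm y)))
  have hsm : ∀ i, (realFrame T A B i).SmoothAt (φ.symm x) := by
    rintro ((j | j) | j)
    · exact (h.smooth_re j).smoothAt hU hxU
    · exact (h.smooth_im j).smoothAt hU hxU
    · exact hT.smooth.smoothAt isOpen_univ trivial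
  have hsm' : ∀ i, (realFrame 0 (fun j => -B j) A i).SmoothAt (φ.symm x) := by
    rintro ((j | j) | j)
    · exact ((h.smooth_im j).smoothAt hU hxU).neg_section
    · exact (h.smooth_re j).smoothAt hU hxU
    · exact contMDiff_zeroSection ℝ (TangentSpace (𝓡 (2 * n + 1)) : X → Type) _
  have hE : ContDiffAt ℝ ∞ E x := ContDiffAt.sum fun i _ =>
    contDiffAt_const.smulRight (contDiffAt_push hφ hx (hsm i))
  have hE' : ContDiffAt ℝ ∞ E' x := ContDiffAt.sum fun i _ =>
    contDiffAt_const.smulRight (contDiffAt_push hφ hx (hsm' i))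
  have hEinv : ∀ y ∈ φ.target ∩ φ.symm ⁻¹' U, ∃ e : (((Fin n ⊕ Fin n) ⊕ Unit) → ℝ) ≃L[ℝ] RVec n,
      (e : (((Fin n ⊕ Fin n) ⊕ Unit) → ℝ) →L[ℝ] RVec n) = E y := by
    intro y hy
    obtain ⟨p, hp⟩ := isInvertible_push hφ (φ.map_target hy.1)
    refine ⟨((realBasis hT h hy.2).equivFun.symm.trans p.toLinearEquiv).toContinuousLinearEquiv, ?_⟩
    ext c : 1
    have hp' : ∀ v, p v = push φ (φ.symm y) v := fun v => by rw [← hp]; rfl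
    simp [E, Module.Basis.equivFun_symm_apply, realBasis_apply, hp']
  have hJE : ∀ y ∈ φ.target ∩ φ.symm ⁻¹' U, S.JMat T φ y ∘L E y = E' y := by
    intro y hy
    have hmem : ∀ j, cvec (A j (φ.symm y)) (B j (φ.symm y)) ∈ S.T10 (φ.symm y) := fun j => by
      rw [← h.span_eq _ hy.2]
      exact Submodule.subset_span ⟨j, rfl⟩
    have hJ : ∀ i, S.J T (φ.symm y) (realFrame T A B i (φ.symm y))
        = realFrame 0 (fun j => -B j) A i (φ.symm y) := by
      rintro ((j | j) | j)
      · exact J_re hT (hmem j)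
      · exact J_im hT (hmem j)
      · exact J_reeb hT _
    ext c : 1
    simp only [E, E', ContinuousLinearMap.comp_apply, sum_apply,
      ContinuousLinearMap.smulRight_apply, map_sum, map_smul, JMat_push hφ hy.1, hJ]
  have hnhds : φ.target ∩ φ.symm ⁻¹' U ∈ 𝓝 x :=
    (φ.isOpen_inter_preimage_symm hU).mem_nhds ⟨hx, hxU⟩
  obtain ⟨e, he⟩ := hEinv x ⟨hx, hxU⟩
  have hinv : ContDiffAt ℝ ∞ (fun y => (E y).inverse) x := by
    have h1 := contDiffAt_map_inverse (𝕜 := ℝ) (n := ∞) e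
    rw [he] at h1
    exact h1.comp x hE
  refine (hE'.clm_comp hinv).congr_of_eventuallyEq ?_
  filter_upwards [hnhds] with y hy
  obtain ⟨e, he⟩ := hEinv y hy
  rw [← hJE y hy, ← he, ContinuousLinearMap.inverse_equiv]
  ext a : 1
  simp

end PseudohermitianStructure

lemma smoothAt_of_contDiffAt_push (hφ : φ ∈ IsManifold.maximalAtlas (𝓡 (2 * n + 1)) ∞ X)
    {V : VField n X} {q : X} (hq : q ∈ φ.source)
    (hV : ContDiffAt ℝ ∞ (fun y => push φ (φ.symm y) (V (φ.symm y))) (φ q)) : V.SmoothAt q := by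
  have hf : ∀ k, ContMDiffAt (𝓡 (2 * n + 1)) 𝓘(ℝ, ℝ) ∞
      (fun q' => push φ (φ.symm (φ q')) (V (φ.symm (φ q'))) k) q := fun k =>
    (contDiffAt_euclidean.1 hV k).contMDiffAt.comp q (contMDiffAt_of_mem_maximalAtlas hφ hq)
  have h1 : VField.SmoothAt (fun q' => ∑ k, push φ (φ.symm (φ q')) (V (φ.symm (φ q'))) k
      • coordField φ k q') q :=
    ContMDiffAt.sum_section
      (t := fun k q' => push φ (φ.symm (φ q')) (V (φ.symm (φ q'))) k • coordField φ k q')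
      fun k _ => (hf k).smul_section (coordField_smoothAt hφ k hq)
  refine h1.congr_of_eventuallyEq ?_
  filter_upwards [φ.open_source.mem_nhds hq] with q' hq'
  have h2 : ∀ k, push φ (φ.symm (φ q')) (V (φ.symm (φ q'))) k = push φ q' (V q') k := fun k =>
    congrArg (fun q' => push φ q' (V q') k) (φ.left_inv hq')
  simp only [VField.toBundle, h2]
  rw [← eq_sum_coordField hφ hq']

lemma PseudohermitianStructure.JField_smoothAt {S : PseudohermitianStructure n X}
    {T V : VField n X} (hT : S.IsReeb T) (hφ : φ ∈ IsManifold.maximalAtlas (𝓡 (2 * n + 1)) ∞ X)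
    {q : X} (hq : q ∈ φ.source) (hV : V.SmoothAt q) : (S.JField T V).SmoothAt q := by
  have hq' := φ.map_source hq
  refine smoothAt_of_contDiffAt_push hφ hq ?_
  refine ((JMat_contDiffAt hT hφ hq').clm_apply
    (contDiffAt_push hφ hq' (V := V) (by rwa [φ.left_inv hq]))).congr_of_eventuallyEq ?_
  filter_upwards [φ.open_target.mem_nhds hq'] with y hy
  rw [JMat_push hφ hy]
  rfl

/-! ### Divergence and symplectic maps -/

lemma sympl_eq_inner (V W : RVec n × RVec n) :
    sympl V W = inner ℝ V.1 W.2 - inner ℝ V.2 W.1 := by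
  simp only [sympl, PiLp.inner_apply, ← Finset.sum_sub_distrib]
  refine Finset.sum_congr rfl fun j _ => ?_
  simp
  ring

lemma sympl_inr (V : RVec n × RVec n) (j : Fin (2 * n + 1)) :
    sympl V (phaseVec (Sum.inr j)) = V.1 j := by
  simp [sympl, phaseVec, stdVec]

lemma sympl_inl (V : RVec n × RVec n) (j : Fin (2 * n + 1)) :
    sympl (phaseVec (Sum.inl j)) V = V.2 j := by
  simp [sympl, phaseVec, stdVec]

lemma eq_zero_of_sympl {V : RVec n × RVec n} (h : ∀ W, sympl V W = 0) : V = 0 := by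
  refine Prod.ext ?_ ?_ <;> ext j
  · simpa [sympl_inr] using h (phaseVec (Sum.inr j))
  · simpa [sympl, phaseVec, stdVec, Pi.single_apply] using h (phaseVec (Sum.inl j))

/-- The divergence of a vector field is the trace of its derivative. -/
lemma sum_phaseVec_eq_trace (L : RVec n × RVec n →ₗ[ℝ] RVec n × RVec n) :
    ∑ j, ((L (phaseVec (Sum.inl j))).1 j + (L (phaseVec (Sum.inr j))).2 j)
      = LinearMap.trace ℝ _ L := by
  let b := (EuclideanSpace.basisFun (Fin (2 * n + 1)) ℝ).toBasis
  rw [LinearMap.trace_eq_matrix_trace ℝ (b.prod b), Matrix.trace, Fintype.sum_sum_type,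
    ← Finset.sum_add_distrib]
  refine Finset.sum_congr rfl fun j _ => ?_
  simp [LinearMap.toMatrix_apply, b, phaseVec, stdVec]

/-- The elements of the symplectic Lie algebra are traceless. -/
lemma trace_eq_zero_of_sympl {K : RVec n × RVec n →ₗ[ℝ] RVec n × RVec n}
    (hK : ∀ a b, sympl (K a) b + sympl a (K b) = 0) : LinearMap.trace ℝ _ K = 0 := by
  rw [← sum_phaseVec_eq_trace]
  refine Finset.sum_eq_zero fun j _ => ?_
  rw [← sympl_inr, ← sympl_inl]
  exact hK _ _

/-- A linear map which preserves the symplectic form, as an isomorphism. -/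
def symplEquiv (M : RVec n × RVec n →L[ℝ] RVec n × RVec n)
    (hM : ∀ a b, sympl (M a) (M b) = sympl a b) : (RVec n × RVec n) ≃ₗ[ℝ] (RVec n × RVec n) :=
  LinearEquiv.ofInjectiveEndo M.toLinearMap (by
    rw [injective_iff_map_eq_zero]
    intro a ha
    refine eq_zero_of_sympl fun b => ?_
    have ha' : M a = 0 := ha
    rw [← hM, ha']
    simp [sympl])

lemma symplEquiv_apply {M : RVec n × RVec n →L[ℝ] RVec n × RVec n}
    (hM : ∀ a b, sympl (M a) (M b) = sympl a b) (a : RVec n × RVec n) :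
    symplEquiv M hM a = M a := rfl

/-- Symplectic maps preserve the divergence. Differentiating `V' ∘ Φ = DΦ V` gives
`DV' DΦ = D²Φ(V, ·) + DΦ DV`, and `DΦ⁻¹ D²Φ(V, ·)` lies in the symplectic Lie algebra, so its trace
vanishes. -/
lemma divergence_eq_of_symplectic {Φ V V' : RVec n × RVec n → RVec n × RVec n}
    {y : RVec n × RVec n} (hΦ : ContDiffAt ℝ ∞ Φ y)
    (hsym : ∀ᶠ y' in 𝓝 y, ∀ a b, sympl (fderiv ℝ Φ y' a) (fderiv ℝ Φ y' b) = sympl a b)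
    (hV : DifferentiableAt ℝ V y) (hV' : DifferentiableAt ℝ V' (Φ y))
    (h : ∀ᶠ y' in 𝓝 y, V' (Φ y') = fderiv ℝ Φ y' (V y')) :
    divergence V' (Φ y) = divergence V y := by
  set M := fderiv ℝ Φ y with hM
  have hMs : ∀ a b, sympl (M a) (M b) = sympl a b := hsym.self_of_nhds
  set e := symplEquiv M hMs with he
  have hD : HasFDerivAt (fderiv ℝ Φ) (fderiv ℝ (fderiv ℝ Φ) y) y :=
    ((hΦ.fderiv_right (m := ∞) (by simp)).differentiableAt (by simp)).hasFDerivAt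
  set D := fderiv ℝ (fderiv ℝ Φ) y with hDdef
  have hsymm : ∀ a b, D a b = D b a := fun a b =>
    (hΦ.isSymmSndFDerivAt (by simpa using ENat.LEInfty.out)) a b
  have hcol : ∀ a, HasFDerivAt (fun y' => fderiv ℝ Φ y' a) (D.flip a) y := fun a => by
    refine (hD.clm_apply (hasFDerivAt_const a y)).congr_fderiv (ContinuousLinearMap.ext fun b => ?_)
    simp
  have hN : ∀ a b, sympl (D (V y) a) (M b) + sympl (M a) (D (V y) b) = 0 := by
    intro a b
    have h0 := ((hcol a).fst.inner ℝ (hcol b).snd).sub ((hcol a).snd.inner ℝ (hcol b).fst)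
    have h1 := h0.congr_of_eventuallyEq (f₁ := fun y' =>
      sympl (fderiv ℝ Φ y' a) (fderiv ℝ Φ y' b))
      (Filter.Eventually.of_forall fun y' => sympl_eq_inner _ _)
    have h2 : HasFDerivAt (fun y' => sympl (fderiv ℝ Φ y' a) (fderiv ℝ Φ y' b))
        (0 : RVec n × RVec n →L[ℝ] ℝ) y :=
      (hasFDerivAt_const (sympl a b) y).congr_of_eventuallyEq (hsym.mono fun y' hy' => hy' a b)
    have h3 := DFunLike.congr_fun (h1.unique h2) (V y)
    simp [fderivInnerCLM_apply] at h3
    rw [sympl_eq_inner, sympl_eq_inner]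
    linarith
  have hderiv : ∀ a, fderiv ℝ V' (Φ y) (M a) = D (V y) a + M (fderiv ℝ V y a) := by
    intro a
    have h1 : HasFDerivAt (V' ∘ Φ) ((fderiv ℝ V' (Φ y)).comp M) y :=
      hV'.hasFDerivAt.comp y (hΦ.differentiableAt (by simp)).hasFDerivAt
    have h2 := (hD.clm_apply hV.hasFDerivAt).congr_of_eventuallyEq h
    have h3 := DFunLike.congr_fun (h1.unique h2) a
    simp only [ContinuousLinearMap.comp_apply, add_apply, ContinuousLinearMap.flip_apply] at h3
    rw [h3, hsymm, add_comm]
  have hdecomp : (fderiv ℝ V' (Φ y)).toLinearMap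
      = e.toLinearMap ∘ₗ (e.symm.toLinearMap ∘ₗ (D (V y)).toLinearMap
        + (fderiv ℝ V y).toLinearMap) ∘ₗ e.symm.toLinearMap := by
    refine LinearMap.ext fun a => ?_
    obtain ⟨b, rfl⟩ := e.surjective a
    have hb : e b = M b := symplEquiv_apply hMs b
    simp only [LinearMap.comp_apply, LinearEquiv.coe_coe, LinearMap.add_apply,
      LinearEquiv.symm_apply_apply, map_add, LinearEquiv.apply_symm_apply]
    rw [hb]
    exact hderiv b
  have htr : LinearMap.trace ℝ _ (e.symm.toLinearMap ∘ₗ (D (V y)).toLinearMap) = 0 := by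
    refine trace_eq_zero_of_sympl fun a b => ?_
    rw [← hMs _ b, ← hMs a]
    have hs : ∀ c, M (e.symm c) = c := fun c => by
      rw [← symplEquiv_apply hMs, ← he, LinearEquiv.apply_symm_apply]
    simp only [LinearMap.comp_apply, LinearEquiv.coe_coe, hs]
    exact hN a b
  have hdiv : ∀ (W : RVec n × RVec n → RVec n × RVec n) (w : RVec n × RVec n),
      divergence W w = LinearMap.trace ℝ _ (fderiv ℝ W w).toLinearMap := fun W w =>
    sum_phaseVec_eq_trace _
  rw [hdiv, hdiv, hdecomp]
  have := LinearMap.trace_conj' (e.symm.toLinearMap ∘ₗ (D (V y)).toLinearMap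
        + (fderiv ℝ V y).toLinearMap) e
  rw [LinearEquiv.conj_apply] at this
  rw [LinearMap.comp_assoc] at this
  rw [this, map_add, htr, zero_add]

/-- Symplectic maps preserve Hamiltonian vector fields. -/
lemma hamiltonian_comp {Φ : RVec n × RVec n → RVec n × RVec n} {f : RVec n × RVec n → ℝ}
    {y : RVec n × RVec n} (hΦ : DifferentiableAt ℝ Φ y) (hf : DifferentiableAt ℝ f (Φ y))
    (hsym : ∀ a b, sympl (fderiv ℝ Φ y a) (fderiv ℝ Φ y b) = sympl a b) :
    hamiltonian f (Φ y) = fderiv ℝ Φ y (hamiltonian (f ∘ Φ) y) := by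
  symm
  rw [← hamiltonian_spec]
  intro W
  obtain ⟨W', rfl⟩ := (symplEquiv _ hsym).surjective W
  rw [symplEquiv_apply, hsym, (hamiltonian_spec (f ∘ Φ) y _).2 rfl W', fderiv_comp y hf hΦ]
  rfl

lemma fderiv_fst_apply {V : RVec n × RVec n → RVec n × RVec n} {y : RVec n × RVec n}
    (hV : DifferentiableAt ℝ V y) (v : RVec n × RVec n) (j : Fin (2 * n + 1)) :
    (fderiv ℝ V y v).1 j = fderiv ℝ (fun y' => (V y').1 j) y v := by
  have h := ((EuclideanSpace.proj (𝕜 := ℝ) j ∘L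
    ContinuousLinearMap.fst ℝ (RVec n) (RVec n)).hasFDerivAt.comp y hV.hasFDerivAt).fderiv
  exact (DFunLike.congr_fun h v).symm

lemma fderiv_snd_apply {V : RVec n × RVec n → RVec n × RVec n} {y : RVec n × RVec n}
    (hV : DifferentiableAt ℝ V y) (v : RVec n × RVec n) (j : Fin (2 * n + 1)) :
    (fderiv ℝ V y v).2 j = fderiv ℝ (fun y' => (V y').2 j) y v := by
  have h := ((EuclideanSpace.proj (𝕜 := ℝ) j ∘L
    ContinuousLinearMap.snd ℝ (RVec n) (RVec n)).hasFDerivAt.comp y hV.hasFDerivAt).fderiv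
  exact (DFunLike.congr_fun h v).symm

lemma contDiffAt_fderiv_apply {f : RVec n × RVec n → ℝ} {y : RVec n × RVec n}
    (hf : ContDiffAt ℝ ∞ f y) (v : RVec n × RVec n) :
    ContDiffAt ℝ ∞ (fun y' => fderiv ℝ f y' v) y :=
  (hf.fderiv_right (m := ∞) (by simp)).clm_apply contDiffAt_const

/-! ### The operator in coordinates -/

namespace PseudohermitianStructure

variable {S : PseudohermitianStructure n X} {T : VField n X}

/-- The functions `ξ(∇_{∂_j} ∂_l)` on the cotangent bundle, in the induced coordinates. -/
def chr (nabla : CovariantDerivative (𝓡 (2 * n + 1)) (RVec n)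
      (TangentSpace (𝓡 (2 * n + 1)) : X → Type))
    (φ : OpenPartialHomeomorph X (RVec n)) (j l : Fin (2 * n + 1)) (y : RVec n × RVec n) : ℝ :=
  inner ℝ y.2 (christ nabla φ j l y.1)

/-- The entries of the matrix of `J`, with `J ∂_i = ∑ⱼ J_{ji} ∂_j`, as functions on the cotangent
bundle. -/
def JEntry (S : PseudohermitianStructure n X) (T : VField n X)
    (φ : OpenPartialHomeomorph X (RVec n)) (j i : Fin (2 * n + 1)) (y : RVec n × RVec n) : ℝ :=
  S.JMat T φ y.1 (stdVec i) j

/-- The functions `G_{li} = ξ(∇_{J ∂_i} ∂_l) + ∑ₖ J_{kl} ξ(∇_{∂_i} ∂_k)`, the coefficients of the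
second order part of `P` in `ξ` alone. -/
def GCoef (S : PseudohermitianStructure n X) (T : VField n X)
    (nabla : CovariantDerivative (𝓡 (2 * n + 1)) (RVec n)
      (TangentSpace (𝓡 (2 * n + 1)) : X → Type))
    (φ : OpenPartialHomeomorph X (RVec n)) (l i : Fin (2 * n + 1)) (y : RVec n × RVec n) : ℝ :=
  ∑ j, (S.JEntry T φ j i y * chr nabla φ j l y + chr nabla φ i j y * S.JEntry T φ j l y)

lemma horLift_snd (y : RVec n × RVec n) (a : RVec n) (l : Fin (2 * n + 1)) :
    (horLift nabla φ y a).2 l = ∑ j, a j * chr nabla φ j l y := by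
  change (cotPoint φ y).2 (nabla (coordField φ l) (φ.symm y.1) (pull φ (φ.symm y.1) a)) = _
  have h : (cotPoint φ y).2 (nabla (coordField φ l) (φ.symm y.1) (pull φ (φ.symm y.1) a))
      = inner ℝ y.2 (push φ (φ.symm y.1)
        (nabla (coordField φ l) (φ.symm y.1) (pull φ (φ.symm y.1) a))) := rfl
  rw [h, push_nabla_coordField, inner_sum]
  simp [chr, inner_smul_right]

lemma JDualCoord_apply (x b : RVec n) (l : Fin (2 * n + 1)) :
    S.JDualCoord T φ x b l = ∑ k, b k * S.JMat T φ x (stdVec l) k := by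
  change (cotPoint φ (x, b)).2 (S.J T (φ.symm x) (coordField φ l (φ.symm x))) = _
  rw [cotPoint_apply]
  rfl

lemma JMat_apply_eq_sum (x a : RVec n) (j : Fin (2 * n + 1)) :
    S.JMat T φ x a j = ∑ i, a i * S.JMat T φ x (stdVec i) j := by
  conv_lhs => rw [eq_sum_stdVec a]
  simp

lemma JCot_hamiltonian_fst (f : RVec n × RVec n → ℝ) (y : RVec n × RVec n)
    (j : Fin (2 * n + 1)) :
    (S.JCot T nabla φ y (hamiltonian f y)).1 j
      = -∑ i, S.JEntry T φ j i y * fderiv ℝ f y (phaseVec (Sum.inr i)) := by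
  have h : (S.JCot T nabla φ y (hamiltonian f y)).1
      = S.JMat T φ y.1 (hamiltonian f y).1 - 0 := rfl
  rw [h, sub_zero, JMat_apply_eq_sum, ← Finset.sum_neg_distrib]
  refine Finset.sum_congr rfl fun i _ => ?_
  simp only [hamiltonian, JEntry]
  ring

lemma JCot_hamiltonian_snd (f : RVec n × RVec n → ℝ) (y : RVec n × RVec n)
    (l : Fin (2 * n + 1)) :
    (S.JCot T nabla φ y (hamiltonian f y)).2 l
      = -∑ i, (S.JEntry T φ i l y * fderiv ℝ f y (phaseVec (Sum.inl i))
        + S.GCoef T nabla φ l i y * fderiv ℝ f y (phaseVec (Sum.inr i))) := by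
  have h : (S.JCot T nabla φ y (hamiltonian f y)).2 l
      = (horLift nabla φ y (S.JMat T φ y.1 (hamiltonian f y).1)).2 l
        - S.JDualCoord T φ y.1 ((hamiltonian f y).2
          - (horLift nabla φ y (hamiltonian f y).1).2) l := rfl
  have hJ : ∀ j, S.JMat T φ y.1 (hamiltonian f y).1 j
      = -∑ i, S.JEntry T φ j i y * fderiv ℝ f y (phaseVec (Sum.inr i)) := fun j => by
    rw [← JCot_hamiltonian_fst (nabla := nabla)]
    change _ = (S.JMat T φ y.1 (hamiltonian f y).1 - 0) j
    rw [sub_zero]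
  rw [h, horLift_snd, JDualCoord_apply]
  simp only [hJ, PiLp.sub_apply, horLift_snd, GCoef]
  simp only [hamiltonian, neg_mul, Finset.sum_neg_distrib, sub_neg_eq_add,
    add_mul, Finset.sum_add_distrib, Finset.sum_mul]
  have h1 : ∀ k, S.JMat T φ y.1 (stdVec l) k = S.JEntry T φ k l y := fun k => rfl
  simp only [h1]
  rw [Finset.sum_comm (f := fun j i => S.JEntry T φ j i y *
    fderiv ℝ f y (phaseVec (Sum.inr i)) * chr nabla φ j l y)]
  rw [Finset.sum_comm (f := fun k j => fderiv ℝ f y (phaseVec (Sum.inr j)) * chr nabla φ j k y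
    * S.JEntry T φ k l y)]
  have e1 : ∑ i, ∑ j, S.JEntry T φ j i y * fderiv ℝ f y (phaseVec (Sum.inr i)) * chr nabla φ j l y
      = ∑ i, ∑ j, S.JEntry T φ j i y * chr nabla φ j l y * fderiv ℝ f y (phaseVec (Sum.inr i)) :=
    Finset.sum_congr rfl fun i _ => Finset.sum_congr rfl fun j _ => by ring
  have e2 : ∑ i, ∑ k, fderiv ℝ f y (phaseVec (Sum.inr i)) * chr nabla φ i k y * S.JEntry T φ k l y
      = ∑ i, ∑ k, chr nabla φ i k y * S.JEntry T φ k l y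
        * fderiv ℝ f y (phaseVec (Sum.inr i)) :=
    Finset.sum_congr rfl fun i _ => Finset.sum_congr rfl fun j _ => by ring
  have e3 : ∑ k, fderiv ℝ f y (phaseVec (Sum.inl k)) * S.JEntry T φ k l y
      = ∑ k, S.JEntry T φ k l y * fderiv ℝ f y (phaseVec (Sum.inl k)) :=
    Finset.sum_congr rfl fun i _ => by ring
  rw [e1, e2, e3]
  ring

lemma JEntry_contDiffAt (hT : S.IsReeb T) (hφ : φ ∈ IsManifold.maximalAtlas (𝓡 (2 * n + 1)) ∞ X)
    (j i : Fin (2 * n + 1)) {y : RVec n × RVec n} (hy : y.1 ∈ φ.target) :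
    ContDiffAt ℝ ∞ (S.JEntry T φ j i) y :=
  (contDiffAt_euclidean.1 ((JMat_contDiffAt hT hφ hy).clm_apply contDiffAt_const) j).comp y
    contDiffAt_fst

lemma fderiv_JEntry (hT : S.IsReeb T) (hφ : φ ∈ IsManifold.maximalAtlas (𝓡 (2 * n + 1)) ∞ X)
    {y : RVec n × RVec n} (hy : y.1 ∈ φ.target) (j i : Fin (2 * n + 1)) (v : RVec n × RVec n) :
    fderiv ℝ (S.JEntry T φ j i) y v = fderiv ℝ (fun x => S.JMat T φ x (stdVec i) j) y.1 v.1 := by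
  have h1 : S.JEntry T φ j i = (fun x => S.JMat T φ x (stdVec i) j) ∘ Prod.fst := rfl
  have h2 : DifferentiableAt ℝ (fun x => S.JMat T φ x (stdVec i) j) y.1 :=
    (contDiffAt_euclidean.1 ((JMat_contDiffAt hT hφ hy).clm_apply
      contDiffAt_const) j).differentiableAt (by simp)
  rw [h1, fderiv_comp y h2 differentiableAt_fst]
  simp [fderiv_fst]

lemma chr_contDiffAt [T2Space X] (hn : CovariantDerivative.ContMDiffCovariantDerivative nabla ∞)
    (hφ : φ ∈ IsManifold.maximalAtlas (𝓡 (2 * n + 1)) ∞ X)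
    (j l : Fin (2 * n + 1)) {y : RVec n × RVec n} (hy : y.1 ∈ φ.target) :
    ContDiffAt ℝ ∞ (chr nabla φ j l) y :=
  contDiffAt_snd.inner ℝ ((christ_contDiffAt hn hφ j l hy).comp y contDiffAt_fst)

lemma GCoef_contDiffAt [T2Space X] (hT : S.IsReeb T)
    (hn : CovariantDerivative.ContMDiffCovariantDerivative nabla ∞)
    (hφ : φ ∈ IsManifold.maximalAtlas (𝓡 (2 * n + 1)) ∞ X)
    (l i : Fin (2 * n + 1)) {y : RVec n × RVec n} (hy : y.1 ∈ φ.target) :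
    ContDiffAt ℝ ∞ (S.GCoef T nabla φ l i) y :=
  ContDiffAt.sum fun j _ =>
    ((JEntry_contDiffAt hT hφ j i hy).mul (chr_contDiffAt hn hφ j l hy)).add
      ((chr_contDiffAt hn hφ i j hy).mul (JEntry_contDiffAt hT hφ j l hy))

lemma JCot_hamiltonian_contDiffAt [T2Space X] (hT : S.IsReeb T)
    (hn : CovariantDerivative.ContMDiffCovariantDerivative nabla ∞)
    (hφ : φ ∈ IsManifold.maximalAtlas (𝓡 (2 * n + 1)) ∞ X)
    {f : RVec n × RVec n → ℝ} {y : RVec n × RVec n} (hy : y.1 ∈ φ.target)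
    (hf : ContDiffAt ℝ ∞ f y) :
    ContDiffAt ℝ ∞ (fun y' => S.JCot T nabla φ y' (hamiltonian f y')) y := by
  have h1 : ∀ j, ContDiffAt ℝ ∞ (fun y' => (S.JCot T nabla φ y' (hamiltonian f y')).1 j) y := by
    intro j
    simp only [JCot_hamiltonian_fst]
    exact (ContDiffAt.sum fun i _ => (JEntry_contDiffAt hT hφ j i hy).mul
      (contDiffAt_fderiv_apply hf _)).neg
  have h2 : ∀ l, ContDiffAt ℝ ∞ (fun y' => (S.JCot T nabla φ y' (hamiltonian f y')).2 l) y := by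
    intro l
    simp only [JCot_hamiltonian_snd]
    exact (ContDiffAt.sum fun i _ => ((JEntry_contDiffAt hT hφ i l hy).mul
      (contDiffAt_fderiv_apply hf _)).add ((GCoef_contDiffAt hT hn hφ l i hy).mul
      (contDiffAt_fderiv_apply hf _))).neg
  exact (contDiffAt_euclidean.2 h1).prodMk (contDiffAt_euclidean.2 h2)

/-- The coefficients of the first order part of `P`. -/
def firstCoef (S : PseudohermitianStructure n X) (T : VField n X)
    (nabla : CovariantDerivative (𝓡 (2 * n + 1)) (RVec n)
      (TangentSpace (𝓡 (2 * n + 1)) : X → Type))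
    (φ : OpenPartialHomeomorph X (RVec n)) (i : Fin (2 * n + 1)) (y : RVec n × RVec n) : ℝ :=
  ∑ j, (fderiv ℝ (S.JEntry T φ j i) y (phaseVec (Sum.inl j))
    + fderiv ℝ (S.GCoef T nabla φ j i) y (phaseVec (Sum.inr j)))

/-- The operator in coordinates: with `J_{ji}` and `G_{li}` the entries of `J` and `GCoef`, it is
`∑ J_{ji} ∂_{x_j} ∂_{ξ_i} + (1/2) ∑ G_{li} ∂_{ξ_l} ∂_{ξ_i} + (1/2) ∑ c_i ∂_{ξ_i}`. -/
lemma PChart_eq [T2Space X] (hT : S.IsReeb T)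
    (hn : CovariantDerivative.ContMDiffCovariantDerivative nabla ∞)
    (hφ : φ ∈ IsManifold.maximalAtlas (𝓡 (2 * n + 1)) ∞ X)
    {F : CotBundle n X → ℝ} {y : RVec n × RVec n} (hy : y.1 ∈ φ.target)
    (hf : ContDiffAt ℝ ∞ (fun w => F (cotPoint φ w)) y) :
    S.PChart T nabla φ F y
      = ∑ i, ∑ j, (S.JEntry T φ j i y * fderiv ℝ (fderiv ℝ fun w => F (cotPoint φ w)) y
            (phaseVec (Sum.inl j)) (phaseVec (Sum.inr i))
          + 1 / 2 * S.GCoef T nabla φ j i y * fderiv ℝ (fderiv ℝ fun w => F (cotPoint φ w)) y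
            (phaseVec (Sum.inr j)) (phaseVec (Sum.inr i)))
        + ∑ i, 1 / 2 * S.firstCoef T nabla φ i y
          * fderiv ℝ (fun w => F (cotPoint φ w)) y (phaseVec (Sum.inr i)) := by
  set f := fun w => F (cotPoint φ w) with hfdef
  have hV := (JCot_hamiltonian_contDiffAt hT hn hφ hy hf).differentiableAt (by simp)
  have hdf := (hf.fderiv_right (m := ∞) (by simp)).differentiableAt (by simp)
  have hsymm : ∀ a b, fderiv ℝ (fderiv ℝ f) y a b = fderiv ℝ (fderiv ℝ f) y b a := fun a b =>
    (hf.isSymmSndFDerivAt (by simpa using ENat.LEInfty.out)) a b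
  have hp : ∀ v a, fderiv ℝ (fun y' => fderiv ℝ f y' v) y a = fderiv ℝ (fderiv ℝ f) y a v := by
    intro v a
    rw [fderiv_clm_apply hdf (differentiableAt_const v)]
    simp
  have hpd : ∀ v, DifferentiableAt ℝ (fun y' => fderiv ℝ f y' v) y := fun v =>
    (contDiffAt_fderiv_apply hf v).differentiableAt (by simp)
  have hJd : ∀ j i, DifferentiableAt ℝ (S.JEntry T φ j i) y := fun j i =>
    (JEntry_contDiffAt hT hφ j i hy).differentiableAt (by simp)
  have hGd : ∀ j i, DifferentiableAt ℝ (S.GCoef T nabla φ j i) y := fun j i =>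
    (GCoef_contDiffAt hT hn hφ j i hy).differentiableAt (by simp)
  have hJ0 : ∀ j i l, fderiv ℝ (S.JEntry T φ j i) y (phaseVec (Sum.inr l)) = 0 := by
    intro j i l
    rw [fderiv_JEntry hT hφ hy]
    simp [phaseVec]
  have hcomp1 : ∀ j, (fderiv ℝ (fun y' => S.JCot T nabla φ y' (hamiltonian f y')) y
      (phaseVec (Sum.inl j))).1 j = -∑ i, (S.JEntry T φ j i y
        * fderiv ℝ (fderiv ℝ f) y (phaseVec (Sum.inl j)) (phaseVec (Sum.inr i))
        + fderiv ℝ f y (phaseVec (Sum.inr i))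
          * fderiv ℝ (S.JEntry T φ j i) y (phaseVec (Sum.inl j))) := by
    intro j
    have h3 := (HasFDerivAt.fun_sum (u := Finset.univ) fun i _ => (hJd j i).hasFDerivAt.fun_mul
      (hpd (phaseVec (Sum.inr i))).hasFDerivAt).fun_neg.fderiv
    rw [fderiv_fst_apply hV]
    simp only [JCot_hamiltonian_fst, h3]
    simp [hp]
  have hcomp2 : ∀ l, (fderiv ℝ (fun y' => S.JCot T nabla φ y' (hamiltonian f y')) y
      (phaseVec (Sum.inr l))).2 l = -∑ i, (S.JEntry T φ i l y
        * fderiv ℝ (fderiv ℝ f) y (phaseVec (Sum.inr l)) (phaseVec (Sum.inl i))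
        + (S.GCoef T nabla φ l i y
          * fderiv ℝ (fderiv ℝ f) y (phaseVec (Sum.inr l)) (phaseVec (Sum.inr i))
        + fderiv ℝ f y (phaseVec (Sum.inr i))
          * fderiv ℝ (S.GCoef T nabla φ l i) y (phaseVec (Sum.inr l)))) := by
    intro l
    have h3 := (HasFDerivAt.fun_sum (u := Finset.univ) fun i _ =>
      ((hJd i l).hasFDerivAt.fun_mul (hpd (phaseVec (Sum.inl i))).hasFDerivAt).fun_add
      ((hGd l i).hasFDerivAt.fun_mul (hpd (phaseVec (Sum.inr i))).hasFDerivAt)).fun_neg.fderiv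
    rw [fderiv_snd_apply hV]
    simp only [JCot_hamiltonian_snd, h3]
    simp [hp, hJ0]
  unfold PChart divergence
  simp only [← hfdef, hcomp1, hcomp2, firstCoef]
  have e1 : ∑ j, ∑ i, S.JEntry T φ i j y
      * fderiv ℝ (fderiv ℝ f) y (phaseVec (Sum.inr j)) (phaseVec (Sum.inl i))
      = ∑ i, ∑ j, S.JEntry T φ j i y
      * fderiv ℝ (fderiv ℝ f) y (phaseVec (Sum.inl j)) (phaseVec (Sum.inr i)) :=
    Finset.sum_congr rfl fun j _ => Finset.sum_congr rfl fun i _ => by rw [hsymm]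
  have e2 : ∑ j, ∑ i, S.JEntry T φ j i y
      * fderiv ℝ (fderiv ℝ f) y (phaseVec (Sum.inl j)) (phaseVec (Sum.inr i))
      = ∑ i, ∑ j, S.JEntry T φ j i y
      * fderiv ℝ (fderiv ℝ f) y (phaseVec (Sum.inl j)) (phaseVec (Sum.inr i)) :=
    Finset.sum_comm
  simp only [Finset.sum_add_distrib, Finset.sum_neg_distrib, e1, e2]
  rw [Finset.sum_comm (f := fun j i => fderiv ℝ f y (phaseVec (Sum.inr i))
      * fderiv ℝ (S.JEntry T φ j i) y (phaseVec (Sum.inl j))),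
    Finset.sum_comm (f := fun j i => fderiv ℝ f y (phaseVec (Sum.inr i))
      * fderiv ℝ (S.GCoef T nabla φ j i) y (phaseVec (Sum.inr j))),
    Finset.sum_comm (f := fun j i => S.GCoef T nabla φ j i y
      * fderiv ℝ (fderiv ℝ f) y (phaseVec (Sum.inr j)) (phaseVec (Sum.inr i)))]
  simp only [mul_assoc, mul_add, add_mul, ← Finset.mul_sum,
    Finset.sum_add_distrib]
  simp only [mul_comm (fderiv ℝ f y _)]
  ring

end PseudohermitianStructure

/-! ### Change of coordinates on the cotangent bundle -/

/-- The change of the induced coordinates on `T*X`. -/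
def cotChange (φ ψ : OpenPartialHomeomorph X (RVec n)) (y : RVec n × RVec n) : RVec n × RVec n :=
  cotCoord ψ (cotPoint φ y)

/-- The phase space points whose base point lies in the domains of both charts. -/
def cotOverlap (φ ψ : OpenPartialHomeomorph X (RVec n)) : Set (RVec n × RVec n) :=
  Prod.fst ⁻¹' (φ.target ∩ φ.symm ⁻¹' ψ.source)

lemma isOpen_cotOverlap : IsOpen (cotOverlap φ ψ) :=
  (φ.isOpen_inter_preimage_symm ψ.open_source).preimage continuous_fst

lemma cotPoint_cotChange (hψ : ψ ∈ IsManifold.maximalAtlas (𝓡 (2 * n + 1)) ∞ X)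
    {y : RVec n × RVec n} (hy : y ∈ cotOverlap φ ψ) : cotPoint ψ (cotChange φ ψ y) = cotPoint φ y :=
  cotPoint_cotCoord hψ hy.2

lemma symm_cotChange {y : RVec n × RVec n} (hy : y ∈ cotOverlap φ ψ) : ψ.symm (cotChange φ ψ y).1 = φ.symm y.1 :=
  ψ.left_inv hy.2

lemma cotChange_mem_target {y : RVec n × RVec n} (hy : y ∈ cotOverlap φ ψ) : (cotChange φ ψ y).1 ∈ ψ.target := ψ.map_source hy.2

lemma cotChange_contDiffAt (hφ : φ ∈ IsManifold.maximalAtlas (𝓡 (2 * n + 1)) ∞ X)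
    (hψ : ψ ∈ IsManifold.maximalAtlas (𝓡 (2 * n + 1)) ∞ X)
    {y : RVec n × RVec n} (hy : y ∈ cotOverlap φ ψ) : ContDiffAt ℝ ∞ (cotChange φ ψ) y :=
  contMDiffAt_iff_contDiffAt.1
    (ContMDiffAt.comp y (cotCoord_contMDiffAt hψ hy.2) (cotPoint_contMDiffAt hφ hy.1))

lemma fderiv_cotChange_fst (hφ : φ ∈ IsManifold.maximalAtlas (𝓡 (2 * n + 1)) ∞ X)
    (hψ : ψ ∈ IsManifold.maximalAtlas (𝓡 (2 * n + 1)) ∞ X)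
    {y : RVec n × RVec n} (hy : y ∈ cotOverlap φ ψ) (W : RVec n × RVec n) :
    (fderiv ℝ (cotChange φ ψ) y W).1 = push ψ (φ.symm y.1) (pull φ (φ.symm y.1) W.1) := by
  have hd := (cotChange_contDiffAt hφ hψ hy).differentiableAt (by simp)
  ext j
  have hf : ContMDiffAt (𝓡 (2 * n + 1)) 𝓘(ℝ, ℝ) ∞ (fun q => ψ q j) (φ.symm y.1) :=
    (contDiffAt_euclidean.1 (contDiffAt_id (𝕜 := ℝ) (n := ∞) (x := ψ (φ.symm y.1))) j).contMDiffAt.comp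
      (φ.symm y.1) (contMDiffAt_of_mem_maximalAtlas hψ hy.2)
  have hfd := hf.mdifferentiableAt (by simp)
  have h1 := mvfderiv_eq_fderiv hφ (φ.map_target hy.1) hfd (pull φ (φ.symm y.1) W.1)
  have h2 := mvfderiv_eq_fderiv hψ hy.2 hfd (pull φ (φ.symm y.1) W.1)
  rw [push_pull hφ (φ.map_target hy.1), φ.right_inv hy.1] at h1
  have h3 : fderiv ℝ (fun x => ψ (ψ.symm x) j) (ψ (φ.symm y.1))
      = EuclideanSpace.proj (𝕜 := ℝ) j := by
    have : (fun x => ψ (ψ.symm x) j) =ᶠ[𝓝 (ψ (φ.symm y.1))] fun x => x j := by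
      filter_upwards [ψ.open_target.mem_nhds (ψ.map_source hy.2)] with x hx
      rw [ψ.right_inv hx]
    rw [this.fderiv_eq]
    exact (EuclideanSpace.proj (𝕜 := ℝ) j).fderiv
  rw [h3] at h2
  rw [fderiv_fst_apply hd]
  have h4 : (fun y' => (cotChange φ ψ y').1 j) = (fun x => ψ (φ.symm x) j) ∘ Prod.fst := rfl
  have h5 : DifferentiableAt ℝ (fun x => ψ (φ.symm x) j) y.1 :=
    (contMDiffAt_iff_contDiffAt.1 (hf.comp y.1
      (contMDiffAt_symm_of_mem_maximalAtlas hφ hy.1))).differentiableAt (by simp)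
  rw [h4, fderiv_comp y h5 differentiableAt_fst, ContinuousLinearMap.comp_apply, fderiv_fst]
  exact h1.symm.trans h2

/-- The fibre components of the coordinate change are `∑ₖ ξ_k V_k`, with `V_k` the components of a
coordinate vector field of `ψ` in the chart `φ`. -/
lemma fderiv_cotChange_snd (hφ : φ ∈ IsManifold.maximalAtlas (𝓡 (2 * n + 1)) ∞ X)
    (hψ : ψ ∈ IsManifold.maximalAtlas (𝓡 (2 * n + 1)) ∞ X)
    {y : RVec n × RVec n} (hy : y ∈ cotOverlap φ ψ) (W : RVec n × RVec n) (l : Fin (2 * n + 1)) :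
    (fderiv ℝ (cotChange φ ψ) y W).2 l
      = ∑ k, (W.2 k * push φ (φ.symm y.1) (coordField ψ l (φ.symm y.1)) k
        + y.2 k * fderiv ℝ (fun x => push φ (φ.symm x) (coordField ψ l (φ.symm x)) k) y.1 W.1) := by
  have hd := (cotChange_contDiffAt hφ hψ hy).differentiableAt (by simp)
  have hV : ∀ k, DifferentiableAt ℝ
      (fun x => push φ (φ.symm x) (coordField ψ l (φ.symm x)) k) y.1 := fun k =>
    (contDiffAt_euclidean.1 (contDiffAt_push hφ hy.1
      (coordField_smoothAt hψ l hy.2)) k).differentiableAt (by simp)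
  have h1 : (fun y' => (cotChange φ ψ y').2 l) = fun y' => ∑ k,
      y'.2 k * push φ (φ.symm y'.1) (coordField ψ l (φ.symm y'.1)) k := by
    funext y'
    exact cotPoint_apply y' _
  have h2 : ∀ k, HasFDerivAt (fun y' : RVec n × RVec n => y'.2 k)
      (EuclideanSpace.proj (𝕜 := ℝ) k ∘L ContinuousLinearMap.snd ℝ (RVec n) (RVec n)) y := fun k =>
    (EuclideanSpace.proj (𝕜 := ℝ) k ∘L ContinuousLinearMap.snd ℝ (RVec n) (RVec n)).hasFDerivAt
  have h3 := (HasFDerivAt.fun_sum (u := Finset.univ) fun k _ => (h2 k).fun_mul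
    ((hV k).hasFDerivAt.comp y hasFDerivAt_fst)).fderiv
  rw [fderiv_snd_apply hd, h1]
  refine (DFunLike.congr_fun h3 W).trans ?_
  simp [add_comm, mul_comm]

/-- The tautological one-form `∑ⱼ ξ_j dx_j` is invariant. -/
lemma inner_cotChange (hφ : φ ∈ IsManifold.maximalAtlas (𝓡 (2 * n + 1)) ∞ X)
    (hψ : ψ ∈ IsManifold.maximalAtlas (𝓡 (2 * n + 1)) ∞ X)
    {y : RVec n × RVec n} (hy : y ∈ cotOverlap φ ψ) (W : RVec n × RVec n) :
    inner ℝ (cotChange φ ψ y).2 (fderiv ℝ (cotChange φ ψ) y W).1 = inner ℝ y.2 W.1 := by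
  rw [fderiv_cotChange_fst hφ hψ hy]
  set w := pull φ (φ.symm y.1) W.1 with hw
  set α : TangentSpace (𝓡 (2 * n + 1)) (φ.symm y.1) →L[ℝ] ℝ :=
    (innerSL ℝ y.2).comp (push φ (φ.symm y.1)) with hα
  have h1 : inner ℝ y.2 W.1 = α w := by
    change _ = inner ℝ y.2 (push φ (φ.symm y.1) w)
    rw [hw, push_pull hφ (φ.map_target hy.1)]
  have h2 : ∀ l, (cotChange φ ψ y).2 l = α (coordField ψ l (φ.symm y.1)) := fun l => rfl
  rw [h1]
  conv_rhs => rw [eq_sum_coordField hψ hy.2 w]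
  rw [map_sum]
  simp only [PiLp.inner_apply, h2, map_smul]
  rfl

/-- The change of the induced coordinates on `T*X` is symplectic, being a map that preserves the
tautological one-form. -/
lemma sympl_cotChange (hφ : φ ∈ IsManifold.maximalAtlas (𝓡 (2 * n + 1)) ∞ X)
    (hψ : ψ ∈ IsManifold.maximalAtlas (𝓡 (2 * n + 1)) ∞ X)
    {y : RVec n × RVec n} (hy : y ∈ cotOverlap φ ψ) (U W : RVec n × RVec n) :
    sympl (fderiv ℝ (cotChange φ ψ) y U) (fderiv ℝ (cotChange φ ψ) y W) = sympl U W := by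
  have hc := cotChange_contDiffAt hφ hψ hy
  have hd := hc.differentiableAt (by simp)
  have hD := ((hc.fderiv_right (m := ∞) (by simp)).differentiableAt (by simp)).hasFDerivAt
  set D := fderiv ℝ (fderiv ℝ (cotChange φ ψ)) y with hDdef
  have hsymm : ∀ a b, D a b = D b a := fun a b =>
    (hc.isSymmSndFDerivAt (by simpa using ENat.LEInfty.out)) a b
  have hcol : ∀ a, HasFDerivAt (fun y' => fderiv ℝ (cotChange φ ψ) y' a) (D.flip a) y := fun a => by
    refine (hD.clm_apply (hasFDerivAt_const a y)).congr_fderiv (ContinuousLinearMap.ext fun b => ?_)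
    simp
  have key : ∀ U W : RVec n × RVec n,
      inner ℝ (cotChange φ ψ y).2 (D U W).1
        + inner ℝ (fderiv ℝ (cotChange φ ψ) y U).2 (fderiv ℝ (cotChange φ ψ) y W).1
      = inner ℝ U.2 W.1 := by
    intro U W
    have h1 := hd.hasFDerivAt.snd.inner ℝ (hcol W).fst
    have h2 : HasFDerivAt (fun y' : RVec n × RVec n => inner ℝ y'.2 W.1) _ y :=
      hasFDerivAt_snd.inner ℝ (hasFDerivAt_const W.1 y)
    have h3 := h1.congr_of_eventuallyEq (f₁ := fun y' : RVec n × RVec n => inner ℝ y'.2 W.1) (by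
      filter_upwards [isOpen_cotOverlap.mem_nhds hy] with y' hy'
      exact (inner_cotChange hφ hψ hy' W).symm)
    have h4 := DFunLike.congr_fun (h3.unique h2) U
    simpa [fderivInnerCLM_apply] using h4
  have h1 := key U W
  have h2 := key W U
  rw [hsymm W U] at h2
  rw [sympl_eq_inner, sympl_eq_inner, real_inner_comm _ U.1, real_inner_comm _ (_ : RVec n × RVec n).1,
    ← h1, ← h2]
  ring

/-- The horizontal lift does not depend on the coordinates. -/
lemma fderiv_cotChange_horLift (hφ : φ ∈ IsManifold.maximalAtlas (𝓡 (2 * n + 1)) ∞ X)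
    (hψ : ψ ∈ IsManifold.maximalAtlas (𝓡 (2 * n + 1)) ∞ X)
    {y : RVec n × RVec n} (hy : y ∈ cotOverlap φ ψ) (a : RVec n) :
    fderiv ℝ (cotChange φ ψ) y (horLift nabla φ y a)
      = horLift nabla ψ (cotChange φ ψ y) (push ψ (φ.symm y.1) (pull φ (φ.symm y.1) a)) := by
  refine Prod.ext (fderiv_cotChange_fst hφ hψ hy _) ?_
  ext l
  have hq := φ.map_target hy.1
  set u := pull φ (φ.symm y.1) a with hu
  set α : TangentSpace (𝓡 (2 * n + 1)) (φ.symm y.1) →L[ℝ] ℝ :=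
    (innerSL ℝ y.2).comp (push φ (φ.symm y.1)) with hα
  have hR : (horLift nabla ψ (cotChange φ ψ y) (push ψ (φ.symm y.1) u)).2 l
      = α (nabla (coordField ψ l) (φ.symm y.1) u) := by
    refine (congrArg (fun z : CotBundle n X => (z.2 (nabla (coordField ψ l) z.1
      (pull ψ z.1 (push ψ (φ.symm y.1) u))) : ℝ)) (cotPoint_cotChange hψ hy)).trans ?_
    change α (nabla (coordField ψ l) (φ.symm y.1) (pull ψ (φ.symm y.1)
      (push ψ (φ.symm y.1) u))) = _
    rw [pull_push hψ hy.2]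
  have hL : ∀ k, (horLift nabla φ y a).2 k = α (nabla (coordField φ k) (φ.symm y.1) u) :=
    fun k => rfl
  have hk : ∀ k, α (coordField φ k (φ.symm y.1)) = y.2 k := fun k => by
    change inner ℝ y.2 (push φ (φ.symm y.1) (coordField φ k (φ.symm y.1))) = _
    rw [push_coordField hφ hq]
    simp [stdVec, EuclideanSpace.inner_single_right]
  rw [hR, fderiv_cotChange_snd hφ hψ hy, nabla_eq_sum hφ hq (coordField_smoothAt hψ l hy.2),
    map_sum]
  refine Finset.sum_congr rfl fun k _ => ?_
  rw [map_add, map_smul, map_smul, hk, hL, φ.right_inv hy.1, hu, push_pull hφ hq]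
  simp only [smul_eq_mul]
  have h1 : (horLift nabla φ y a).1 = a := rfl
  rw [h1]
  ring

lemma fderiv_cotChange_verLift (hφ : φ ∈ IsManifold.maximalAtlas (𝓡 (2 * n + 1)) ∞ X)
    (hψ : ψ ∈ IsManifold.maximalAtlas (𝓡 (2 * n + 1)) ∞ X)
    {y : RVec n × RVec n} (hy : y ∈ cotOverlap φ ψ) (b : RVec n) :
    fderiv ℝ (cotChange φ ψ) y (verLift b) = verLift (cotChange φ ψ (y.1, b)).2 := by
  refine Prod.ext ?_ ?_
  · rw [fderiv_cotChange_fst hφ hψ hy]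
    simp [verLift]
  · ext l
    rw [fderiv_cotChange_snd hφ hψ hy]
    have h1 : (cotChange φ ψ (y.1, b)).2 l
        = (cotPoint φ (y.1, b)).2 (coordField ψ l (φ.symm y.1)) := rfl
    change _ = (cotChange φ ψ (y.1, b)).2 l
    rw [h1, cotPoint_apply]
    simp [verLift]

namespace PseudohermitianStructure

variable {S : PseudohermitianStructure n X} {T : VField n X}

lemma JCot_horLift_add_verLift (y : RVec n × RVec n) (a b : RVec n) :
    S.JCot T nabla φ y (horLift nabla φ y a + verLift b)
      = horLift nabla φ y (S.JCoord T φ y.1 a) - verLift (S.JDualCoord T φ y.1 b) := by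
  have h1 : (horLift nabla φ y a + verLift b).1 = a := add_zero a
  have h2 : (horLift nabla φ y a + verLift b - horLift nabla φ y a).2 = b := by
    rw [add_sub_cancel_left]
    rfl
  rw [JCot, h1, h2]

lemma JCoord_cotChange (hψ : ψ ∈ IsManifold.maximalAtlas (𝓡 (2 * n + 1)) ∞ X)
    (hφ : φ ∈ IsManifold.maximalAtlas (𝓡 (2 * n + 1)) ∞ X)
    {y : RVec n × RVec n} (hy : y ∈ cotOverlap φ ψ) (a : RVec n) :
    S.JCoord T ψ (cotChange φ ψ y).1 (push ψ (φ.symm y.1) (pull φ (φ.symm y.1) a))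
      = push ψ (φ.symm y.1) (pull φ (φ.symm y.1) (S.JCoord T φ y.1 a)) := by
  refine (congrArg (fun q : X => push ψ q (S.J T q (pull ψ q (push ψ (φ.symm y.1)
    (pull φ (φ.symm y.1) a))))) (symm_cotChange hy)).trans ?_
  rw [pull_push hψ hy.2, JCoord, pull_push hφ (φ.map_target hy.1)]

lemma JDualCoord_cotChange (hφ : φ ∈ IsManifold.maximalAtlas (𝓡 (2 * n + 1)) ∞ X)
    (hψ : ψ ∈ IsManifold.maximalAtlas (𝓡 (2 * n + 1)) ∞ X)
    {y : RVec n × RVec n} (hy : y ∈ cotOverlap φ ψ) (b : RVec n) :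
    S.JDualCoord T ψ (cotChange φ ψ y).1 (cotChange φ ψ (y.1, b)).2
      = (cotChange φ ψ (y.1, S.JDualCoord T φ y.1 b)).2 := by
  have hq := φ.map_target hy.1
  have hy' : ((y.1, b) : RVec n × RVec n) ∈ cotOverlap φ ψ := hy
  ext l
  set α : TangentSpace (𝓡 (2 * n + 1)) (φ.symm y.1) →L[ℝ] ℝ :=
    (innerSL ℝ b).comp (push φ (φ.symm y.1)) with hα
  have hL : S.JDualCoord T ψ (cotChange φ ψ y).1 (cotChange φ ψ (y.1, b)).2 l
      = α (S.J T (φ.symm y.1) (coordField ψ l (φ.symm y.1))) :=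
    congrArg (fun z : CotBundle n X => (z.2 (S.J T z.1 (coordField ψ l z.1)) : ℝ))
      (cotPoint_cotChange hψ hy')
  have hR : (cotChange φ ψ (y.1, S.JDualCoord T φ y.1 b)).2 l
      = (cotPoint φ (y.1, S.JDualCoord T φ y.1 b)).2 (coordField ψ l (φ.symm y.1)) := rfl
  have hk : ∀ k, S.JDualCoord T φ y.1 b k
      = α (S.J T (φ.symm y.1) (coordField φ k (φ.symm y.1))) := fun k => rfl
  rw [hL, hR, cotPoint_apply]
  conv_lhs => rw [eq_sum_coordField hφ hq (coordField ψ l (φ.symm y.1))]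
  rw [map_sum, map_sum]
  refine Finset.sum_congr rfl fun k _ => ?_
  rw [map_smul, map_smul, smul_eq_mul, mul_comm]
  exact congrArg (· * _) (hk k).symm

/-- The endomorphism `J_{T*X}` does not depend on the coordinates. -/
lemma JCot_cotChange (hφ : φ ∈ IsManifold.maximalAtlas (𝓡 (2 * n + 1)) ∞ X)
    (hψ : ψ ∈ IsManifold.maximalAtlas (𝓡 (2 * n + 1)) ∞ X)
    {y : RVec n × RVec n} (hy : y ∈ cotOverlap φ ψ) (W : RVec n × RVec n) :
    S.JCot T nabla ψ (cotChange φ ψ y) (fderiv ℝ (cotChange φ ψ) y W)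
      = fderiv ℝ (cotChange φ ψ) y (S.JCot T nabla φ y W) := by
  obtain ⟨a, b, rfl⟩ : ∃ a b, W = horLift nabla φ y a + verLift b :=
    ⟨W.1, W.2 - (horLift nabla φ y W.1).2, Prod.ext (add_zero W.1).symm
      (add_sub_cancel _ _).symm⟩
  rw [map_add, fderiv_cotChange_horLift hφ hψ hy, fderiv_cotChange_verLift hφ hψ hy,
    JCot_horLift_add_verLift, JCot_horLift_add_verLift, map_sub,
    fderiv_cotChange_horLift hφ hψ hy, fderiv_cotChange_verLift hφ hψ hy,
    JCoord_cotChange hψ hφ hy, JDualCoord_cotChange hφ hψ hy]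

lemma contDiffAt_comp_cotPoint {G : Type*} [NormedAddCommGroup G] [NormedSpace ℝ G]
    (hφ : φ ∈ IsManifold.maximalAtlas (𝓡 (2 * n + 1)) ∞ X)
    {F : CotBundle n X → G} (hF : ContMDiff (cotModel n) 𝓘(ℝ, G) ∞ F)
    {y : RVec n × RVec n} (hy : y.1 ∈ φ.target) :
    ContDiffAt ℝ ∞ (fun w => F (cotPoint φ w)) y :=
  contMDiffAt_iff_contDiffAt.1 (ContMDiffAt.comp y (hF _) (cotPoint_contMDiffAt hφ hy))

/-- The operator does not depend on the coordinates. -/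
lemma PChart_cotChange [T2Space X] (hT : S.IsReeb T)
    (hn : CovariantDerivative.ContMDiffCovariantDerivative nabla ∞)
    (hφ : φ ∈ IsManifold.maximalAtlas (𝓡 (2 * n + 1)) ∞ X)
    (hψ : ψ ∈ IsManifold.maximalAtlas (𝓡 (2 * n + 1)) ∞ X)
    {F : CotBundle n X → ℝ} (hF : ContMDiff (cotModel n) 𝓘(ℝ, ℝ) ∞ F)
    {y : RVec n × RVec n} (hy : y ∈ cotOverlap φ ψ) :
    S.PChart T nabla ψ F (cotChange φ ψ y) = S.PChart T nabla φ F y := by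
  unfold PChart
  congr 1
  have hev : ∀ y' ∈ cotOverlap φ ψ,
      S.JCot T nabla ψ (cotChange φ ψ y')
        (hamiltonian (fun w => F (cotPoint ψ w)) (cotChange φ ψ y'))
      = fderiv ℝ (cotChange φ ψ) y'
        (S.JCot T nabla φ y' (hamiltonian (fun w => F (cotPoint φ w)) y')) := by
    intro y' hy'
    have h1 : hamiltonian ((fun w => F (cotPoint ψ w)) ∘ cotChange φ ψ) y'
        = hamiltonian (fun w => F (cotPoint φ w)) y' := by
      have : ((fun w => F (cotPoint ψ w)) ∘ cotChange φ ψ) =ᶠ[𝓝 y']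
          fun w => F (cotPoint φ w) := by
        filter_upwards [isOpen_cotOverlap.mem_nhds hy'] with w hw
        exact congrArg F (cotPoint_cotChange hψ hw)
      unfold hamiltonian
      rw [this.fderiv_eq]
    rw [hamiltonian_comp ((cotChange_contDiffAt hφ hψ hy').differentiableAt (by simp))
      ((contDiffAt_comp_cotPoint hψ hF (cotChange_mem_target hy')).differentiableAt (by simp))
      (sympl_cotChange hφ hψ hy'), h1, JCot_cotChange hφ hψ hy']
  refine divergence_eq_of_symplectic (cotChange_contDiffAt hφ hψ hy) ?_ ?_ ?_ ?_
  · filter_upwards [isOpen_cotOverlap.mem_nhds hy] with y' hy'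
    exact sympl_cotChange hφ hψ hy'
  · exact (JCot_hamiltonian_contDiffAt hT hn hφ hy.1
      (contDiffAt_comp_cotPoint hφ hF hy.1)).differentiableAt (by simp)
  · exact (JCot_hamiltonian_contDiffAt hT hn hψ (cotChange_mem_target hy)
      (contDiffAt_comp_cotPoint hψ hF (cotChange_mem_target hy))).differentiableAt (by simp)
  · filter_upwards [isOpen_cotOverlap.mem_nhds hy] with y' hy'
    exact hev y' hy'

lemma PChart_eq_of_mem [T2Space X] (hT : S.IsReeb T)
    (hn : CovariantDerivative.ContMDiffCovariantDerivative nabla ∞)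
    (hφ : φ ∈ IsManifold.maximalAtlas (𝓡 (2 * n + 1)) ∞ X)
    (hψ : ψ ∈ IsManifold.maximalAtlas (𝓡 (2 * n + 1)) ∞ X)
    {F : CotBundle n X → ℝ} (hF : ContMDiff (cotModel n) 𝓘(ℝ, ℝ) ∞ F)
    {z : CotBundle n X} (hz : z.1 ∈ φ.source) (hz' : z.1 ∈ ψ.source) :
    S.PChart T nabla ψ F (cotCoord ψ z) = S.PChart T nabla φ F (cotCoord φ z) := by
  have hy : cotCoord φ z ∈ cotOverlap φ ψ :=
    ⟨φ.map_source hz, by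
      change φ.symm (φ z.1) ∈ ψ.source
      rwa [φ.left_inv hz]⟩
  rw [← PChart_cotChange hT hn hφ hψ hF hy, cotChange, cotPoint_cotCoord hφ hz]

end PseudohermitianStructure

/-! ### The operator on the cotangent bundle -/

namespace PseudohermitianStructure

variable {S : PseudohermitianStructure n X} {T : VField n X}

lemma P_eq_PChart [T2Space X] (hT : S.IsReeb T)
    (hn : CovariantDerivative.ContMDiffCovariantDerivative nabla ∞)
    (hφ : φ ∈ IsManifold.maximalAtlas (𝓡 (2 * n + 1)) ∞ X)
    {F : CotBundle n X → ℝ} (hF : ContMDiff (cotModel n) 𝓘(ℝ, ℝ) ∞ F)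
    {z : CotBundle n X} (hz : z.1 ∈ φ.source) :
    S.P T nabla F z = S.PChart T nabla φ F (cotCoord φ z) :=
  PChart_eq_of_mem hT hn hφ (IsManifold.chart_mem_maximalAtlas z.1) hF hz
    (mem_chart_source (RVec n) z.1)

lemma P_contMDiff [T2Space X] (hT : S.IsReeb T)
    (hn : CovariantDerivative.ContMDiffCovariantDerivative nabla ∞)
    {F : CotBundle n X → ℝ} (hF : ContMDiff (cotModel n) 𝓘(ℝ, ℝ) ∞ F) :
    ContMDiff (cotModel n) 𝓘(ℝ, ℝ) ∞ (S.P T nabla F) := by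
  intro z
  set φ := chartAt (RVec n) z.1 with hφdef
  have hφ : φ ∈ IsManifold.maximalAtlas (𝓡 (2 * n + 1)) ∞ X :=
    IsManifold.chart_mem_maximalAtlas z.1
  have hz : z.1 ∈ φ.source := mem_chart_source (RVec n) z.1
  have hy : (cotCoord φ z).1 ∈ φ.target := φ.map_source hz
  have hV := JCot_hamiltonian_contDiffAt hT hn hφ hy (contDiffAt_comp_cotPoint hφ hF hy)
  have hV' := hV.fderiv_right (m := ∞) (by simp)
  have h1 : ContDiffAt ℝ ∞ (S.PChart T nabla φ F) (cotCoord φ z) := by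
    refine contDiffAt_const.mul (ContDiffAt.sum fun j _ => ContDiffAt.add ?_ ?_)
    · exact contDiffAt_euclidean.1 (hV'.clm_apply contDiffAt_const).fst j
    · exact contDiffAt_euclidean.1 (hV'.clm_apply contDiffAt_const).snd j
  have h2 := h1.contMDiffAt.comp z (cotCoord_contMDiffAt hφ hz)
  refine h2.congr_of_eventuallyEq ?_
  have hopen : IsOpen ((TotalSpace.proj : CotBundle n X → X) ⁻¹' φ.source) :=
    φ.open_source.preimage (FiberBundle.continuous_proj _ _)
  filter_upwards [hopen.mem_nhds (x := z) hz] with w hw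
  exact P_eq_PChart hT hn hφ hF hw

/-- The coefficients of `P` as a differential operator of order two. -/
def coefP (S : PseudohermitianStructure n X) (T : VField n X)
    (nabla : CovariantDerivative (𝓡 (2 * n + 1)) (RVec n)
      (TangentSpace (𝓡 (2 * n + 1)) : X → Type))
    (φ : OpenPartialHomeomorph X (RVec n)) :
    ∀ k : ℕ, (Fin k → Fin (2 * n + 1) ⊕ Fin (2 * n + 1)) → RVec n × RVec n → ℝ
  | 1, s, y => Sum.elim (fun _ => 0) (fun i => 1 / 2 * S.firstCoef T nabla φ i y) (s 0)
  | 2, s, y => Sum.elim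
      (fun j => Sum.elim (fun _ => 0) (fun i => S.JEntry T φ j i y) (s 1))
      (fun j => Sum.elim (fun _ => 0) (fun i => 1 / 2 * S.GCoef T nabla φ j i y) (s 1)) (s 0)
  | _, _, _ => 0

lemma coefP_contDiffAt [T2Space X] (hT : S.IsReeb T)
    (hn : CovariantDerivative.ContMDiffCovariantDerivative nabla ∞)
    (hφ : φ ∈ IsManifold.maximalAtlas (𝓡 (2 * n + 1)) ∞ X) (k : ℕ)
    (s : Fin k → Fin (2 * n + 1) ⊕ Fin (2 * n + 1)) {y : RVec n × RVec n}
    (hy : y.1 ∈ φ.target) : ContDiffAt ℝ ∞ (S.coefP T nabla φ k s) y := by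
  match k, s with
  | 0, s => exact contDiffAt_const
  | 1, s =>
    change ContDiffAt ℝ ∞ (fun y => Sum.elim (fun _ => 0)
      (fun i => 1 / 2 * S.firstCoef T nabla φ i y) (s 0)) y
    rcases s 0 with j | i
    · exact contDiffAt_const
    · exact contDiffAt_const.mul (ContDiffAt.sum fun j _ =>
        (contDiffAt_fderiv_apply (JEntry_contDiffAt hT hφ j i hy) _).add
          (contDiffAt_fderiv_apply (GCoef_contDiffAt hT hn hφ j i hy) _))
  | 2, s =>
    change ContDiffAt ℝ ∞ (fun y => Sum.elim
      (fun j => Sum.elim (fun _ => 0) (fun i => S.JEntry T φ j i y) (s 1))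
      (fun j => Sum.elim (fun _ => 0) (fun i => 1 / 2 * S.GCoef T nabla φ j i y) (s 1)) (s 0)) y
    rcases s 0 with j | j <;> rcases s 1 with i | i
    · exact contDiffAt_const
    · exact JEntry_contDiffAt hT hφ j i hy
    · exact contDiffAt_const
    · exact contDiffAt_const.mul (GCoef_contDiffAt hT hn hφ j i hy)
  | k + 3, s => exact contDiffAt_const

lemma P_isDifferentialOperator [T2Space X] (hT : S.IsReeb T)
    (hn : CovariantDerivative.ContMDiffCovariantDerivative nabla ∞) :
    IsDifferentialOperator (S.P T nabla) := by
  intro φ hφ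
  refine ⟨2, S.coefP T nabla φ, fun k s y hy =>
    (coefP_contDiffAt hT hn hφ k s hy.1).contDiffWithinAt, fun F hF y hy => ?_⟩
  have hy1 : y.1 ∈ φ.target := hy.1
  rw [P_eq_PChart hT hn hφ hF (z := cotPoint φ y) (φ.map_target hy1), cotCoord_cotPoint hφ hy1,
    PChart_eq hT hn hφ hy1 (contDiffAt_comp_cotPoint hφ hF hy1)]
  rw [Finset.sum_range_succ, Finset.sum_range_succ, Finset.sum_range_one]
  rw [← (finTwoArrowEquiv (Fin (2 * n + 1) ⊕ Fin (2 * n + 1))).symm.sum_comp,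
    ← (Equiv.funUnique (Fin 1) (Fin (2 * n + 1) ⊕ Fin (2 * n + 1))).symm.sum_comp]
  simp only [zero_mul, Finset.sum_const_zero, zero_add, iteratedFDeriv_one_apply,
    iteratedFDeriv_two_apply, Fintype.sum_prod_type, Fintype.sum_sum_type, coefP]
  simp only [Equiv.funUnique_symm_apply, finTwoArrowEquiv_symm_apply, Matrix.cons_val_zero,
    Matrix.cons_val_one, uniqueElim_const, Sum.elim_inl, Sum.elim_inr, zero_mul,
    Finset.sum_const_zero, zero_add]
  rw [add_comm]
  congr 1
  rw [← Finset.sum_add_distrib, Finset.sum_comm]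
  refine Finset.sum_congr rfl fun i _ => ?_
  rw [← Finset.sum_add_distrib]

end PseudohermitianStructure

/-! ### The Tanaka–Webster connection -/

lemma smoothAt_pull (hφ : φ ∈ IsManifold.maximalAtlas (𝓡 (2 * n + 1)) ∞ X) (a : RVec n) {q : X}
    (hq : q ∈ φ.source) : VField.SmoothAt (fun q' => pull φ q' a) q := by
  have h1 : VField.SmoothAt (fun q' => ∑ k, a k • coordField φ k q') q :=
    ContMDiffAt.sum_section (t := fun k q' => a k • coordField φ k q')
      fun k _ => ContMDiffAt.const_smul_section (a := a k) (coordField_smoothAt hφ k hq)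
  refine h1.congr_of_eventuallyEq (Filter.Eventually.of_forall fun q' => ?_)
  simp only [VField.toBundle, pull_eq_sum]

lemma OneForm.contMDiffAt_ev (α : OneForm n X) {V : VField n X} {q : X} (hV : V.SmoothAt q) :
    ContMDiffAt (𝓡 (2 * n + 1)) 𝓘(ℝ, ℝ) ∞ (fun y => α.ev (V y)) q :=
  (contMDiffAt_totalSpace.1 (ContMDiffAt.clm_bundle_apply (b := fun y : X => y) (v := V)
    (ϕ := fun y => α y) α.contMDiff.contMDiffAt hV)).2

/-- The trace of an endomorphism of the tangent space, in coordinates. -/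
lemma sum_push_eq_trace (hφ : φ ∈ IsManifold.maximalAtlas (𝓡 (2 * n + 1)) ∞ X) {q : X}
    (hq : q ∈ φ.source)
    (L : TangentSpace (𝓡 (2 * n + 1)) q →ₗ[ℝ] TangentSpace (𝓡 (2 * n + 1)) q) :
    ∑ j, push φ q (L (coordField φ j q)) j = LinearMap.trace ℝ _ L := by
  obtain ⟨e, he⟩ := isInvertible_push hφ hq
  have he' : ∀ v, e v = push φ q v := fun v => DFunLike.congr_fun he v
  let b := (EuclideanSpace.basisFun (Fin (2 * n + 1)) ℝ).toBasis.map e.symm.toLinearEquiv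
  have hb : ∀ j, b j = coordField φ j q := fun j => by
    apply e.injective
    rw [he' (coordField φ j q), push_coordField hφ hq]
    simp [b, stdVec]
  rw [LinearMap.trace_eq_matrix_trace ℝ b, Matrix.trace]
  refine Finset.sum_congr rfl fun j _ => ?_
  rw [Matrix.diag_apply, LinearMap.toMatrix_apply, hb]
  simp [b, he']

/-- The trace of `u ↦ f(u) v` is `f(v)`, in coordinates. -/
lemma sum_push_smul (hφ : φ ∈ IsManifold.maximalAtlas (𝓡 (2 * n + 1)) ∞ X) {q : X}
    (hq : q ∈ φ.source) (f : TangentSpace (𝓡 (2 * n + 1)) q →ₗ[ℝ] ℝ)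
    (v : TangentSpace (𝓡 (2 * n + 1)) q) :
    ∑ j, f (coordField φ j q) * push φ q v j = f v := by
  conv_rhs => rw [eq_sum_coordField hφ hq v]
  rw [map_sum]
  refine Finset.sum_congr rfl fun j _ => ?_
  rw [map_smul, smul_eq_mul, mul_comm]

namespace PseudohermitianStructure

variable {S : PseudohermitianStructure n X} {T : VField n X}

/-- The projection of a vector to the Levi distribution along `𝒯`. -/
lemma add_reeb_mem_levi (hT : S.IsReeb T) {q : X} (v : TangentSpace (𝓡 (2 * n + 1)) q) :
    v + S.ω₀.ev v • T q ∈ S.levi q := by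
  rw [← S.ker_eq]
  have h1 : S.ω₀.ev (v + S.ω₀.ev v • T q) = S.ω₀.ev v + S.ω₀.ev v * S.ω₀.ev (T q) := by
    simp [OneForm.ev]
  rw [h1, hT.eval_eq]
  ring

lemma ev_J (hT : S.IsReeb T) {q : X} (v : TangentSpace (𝓡 (2 * n + 1)) q) :
    S.ω₀.ev (S.J T q v) = 0 := by
  have h2 : S.J T q v = S.J T q (v + S.ω₀.ev v • T q) := by
    rw [map_add, map_smul, J_reeb hT]
    simp
  rw [h2, S.ker_eq]
  exact J_mem_levi hT (add_reeb_mem_levi hT v)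

/-- The covariant derivative of the projection `V + ω₀(V) 𝒯` of `V` to the Levi distribution. -/
lemma nabla_add_reeb (hT : S.IsReeb T) (hN : S.IsTanakaWebster T nabla) {V : VField n X} {q : X}
    (hV : V.SmoothAt q) (u : TangentSpace (𝓡 (2 * n + 1)) q) :
    nabla (fun q' => V q' + S.ω₀.ev (V q') • T q') q u
      = nabla V q u + mvfderiv (𝓡 (2 * n + 1)) (fun y => S.ω₀.ev (V y)) q u • T q := by
  have hf := S.ω₀.contMDiffAt_ev hV
  have hTq : T.SmoothAt q := hT.smooth.smoothAt isOpen_univ (Set.mem_univ q)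
  have h2 : VField.SmoothAt ((fun y => S.ω₀.ev (V y)) • T) q := hf.smul_section hTq
  have h3 := nabla.isCovariantDerivativeOnUniv.add hV.mdiff h2.mdiff
  have h4 := nabla.isCovariantDerivativeOnUniv.leibniz hTq.mdiff
    (hf.mdifferentiableAt (by simp))
  have h5 : nabla (fun q' => V q' + S.ω₀.ev (V q') • T q') q
    = nabla V q + nabla ((fun y => S.ω₀.ev (V y)) • T) q := h3
  have h6 : nabla ((fun y => S.ω₀.ev (V y)) • T) q = _ := h4
  rw [h5, add_apply, h6]
  simp [hN.reeb]

lemma smoothOn_add_reeb (hT : S.IsReeb T) {V : VField n X} {U : Set X} (hU : IsOpen U)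
    (hV : V.SmoothOn U) : VField.SmoothOn (fun q' => V q' + S.ω₀.ev (V q') • T q') U := by
  intro q hq
  have hTq : T.SmoothAt q := hT.smooth.smoothAt isOpen_univ (Set.mem_univ q)
  exact ((hV.smoothAt hU hq).add_section ((S.ω₀.contMDiffAt_ev
    (hV.smoothAt hU hq)).smul_section hTq)).contMDiffWithinAt

/-- The contact form is parallel: `∇ω₀ = 0`. -/
lemma ev_nabla (hT : S.IsReeb T) (hN : S.IsTanakaWebster T nabla) {U : Set X} (hU : IsOpen U)
    {V : VField n X} (hV : V.SmoothOn U) {q : X} (hq : q ∈ U)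
    (u : TangentSpace (𝓡 (2 * n + 1)) q) :
    S.ω₀.ev (nabla V q u) = mvfderiv (𝓡 (2 * n + 1)) (fun y => S.ω₀.ev (V y)) q u := by
  have h1 := hN.preserves_levi U hU _ (smoothOn_add_reeb hT hU hV)
    (fun x _ => add_reeb_mem_levi hT (V x)) q hq u
  rw [nabla_add_reeb hT hN (hV.smoothAt hU hq), ← S.ker_eq] at h1
  have h2 : ∀ c : ℝ, S.ω₀.ev (nabla V q u + c • T q) = S.ω₀.ev (nabla V q u)
      + c * S.ω₀.ev (T q) := fun c => by simp [OneForm.ev]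
  rw [h2, hT.eval_eq] at h1
  linarith

/-- The extension of `J` by `J 𝒯 = 0` is parallel. -/
lemma nabla_JField (hT : S.IsReeb T) (hN : S.IsTanakaWebster T nabla) {U : Set X} (hU : IsOpen U)
    {V : VField n X} (hV : V.SmoothOn U) {q : X} (hq : q ∈ U)
    (u : TangentSpace (𝓡 (2 * n + 1)) q) :
    nabla (S.JField T V) q u = S.J T q (nabla V q u) := by
  have h1 := hN.complexStructure U hU _ (smoothOn_add_reeb hT hU hV)
    (fun x _ => add_reeb_mem_levi hT (V x)) q hq u
  have h2 : S.JField T (fun q' => V q' + S.ω₀.ev (V q') • T q') = S.JField T V := by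
    funext q'
    simp only [JField, map_add, map_smul, J_reeb hT, smul_zero, add_zero]
  rw [h2, nabla_add_reeb hT hN (hV.smoothAt hU hq), map_add, map_smul, J_reeb hT, smul_zero,
    add_zero] at h1
  exact h1

lemma torsion_coordField (hφ : φ ∈ IsManifold.maximalAtlas (𝓡 (2 * n + 1)) ∞ X) {q : X}
    (hq : q ∈ φ.source) (j k : Fin (2 * n + 1)) :
    nabla.torsion q (coordField φ j q) (coordField φ k q)
      = nabla (coordField φ k) q (coordField φ j q)
        - nabla (coordField φ j) q (coordField φ k q) := by
  have h := nabla.torsion_apply (coordField_smoothAt hφ j hq).mdiff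
    (coordField_smoothAt hφ k hq).mdiff
  have hb : mlieBracket (𝓡 (2 * n + 1)) (coordField φ j) (coordField φ k) q = 0 :=
    bracket_coordField hφ hq j k
  rw [hb, sub_zero] at h
  exact h

/-- Since `∇ω₀ = 0`, the component of the torsion along `𝒯` is `dω₀`. -/
lemma ev_torsion (hT : S.IsReeb T) (hN : S.IsTanakaWebster T nabla) {q : X}
    (u v : TangentSpace (𝓡 (2 * n + 1)) q) :
    S.ω₀.ev (nabla.torsion q u v) = S.ω₀.d q u v := by
  set φ := chartAt (RVec n) q
  have hφ : φ ∈ IsManifold.maximalAtlas (𝓡 (2 * n + 1)) ∞ X := IsManifold.chart_mem_maximalAtlas q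
  have hq : q ∈ φ.source := mem_chart_source (RVec n) q
  have key : ∀ a b : RVec n, S.ω₀.ev (nabla.torsion q (pull φ q a) (pull φ q b))
      = S.ω₀.d q (pull φ q a) (pull φ q b) := by
    intro a b
    have ha : VField.SmoothOn (fun q' => pull φ q' a) φ.source := fun q' hq' =>
      (smoothAt_pull hφ a hq').contMDiffWithinAt
    have hb : VField.SmoothOn (fun q' => pull φ q' b) φ.source := fun q' hq' =>
      (smoothAt_pull hφ b hq').contMDiffWithinAt
    have h1 := nabla.torsion_apply (smoothAt_pull hφ a hq).mdiff (smoothAt_pull hφ b hq).mdiff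
    have h2 := S.ω₀.d_apply (smoothAt_pull hφ a hq).mdiff (smoothAt_pull hφ b hq).mdiff
    rw [h1, h2, ← ev_nabla hT hN φ.open_source ha hq, ← ev_nabla hT hN φ.open_source hb hq]
    simp [OneForm.ev, VField.bracket]
  have h := key (push φ q u) (push φ q v)
  rwa [pull_push hφ hq, pull_push hφ hq] at h

/-- The torsion, decomposed with respect to `TX = HX ⊕ ℝ 𝒯`. -/
lemma torsion_eq (hT : S.IsReeb T) (hN : S.IsTanakaWebster T nabla) {q : X}
    (u v : TangentSpace (𝓡 (2 * n + 1)) q) :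
    nabla.torsion q u v = -(S.ω₀.d q u v) • T q - S.ω₀.ev u • nabla.torsion q (T q) v
      + S.ω₀.ev v • nabla.torsion q (T q) u := by
  have hd : ∀ w, S.ω₀.d q w (T q) = 0 := fun w => by
    rw [← ev_torsion hT hN, nabla.torsion_antisymm]
    have h1 : S.ω₀.ev (-nabla.torsion q (T q) w) = -S.ω₀.ev (nabla.torsion q (T q) w) := by
      simp [OneForm.ev]
    rw [h1, ev_torsion hT hN, hT.contract_eq, neg_zero]
  have h := hN.torsion_levi q _ (add_reeb_mem_levi hT u) _ (add_reeb_mem_levi hT v)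
  have h3 : S.ω₀.d q (u + S.ω₀.ev u • T q) (v + S.ω₀.ev v • T q) = S.ω₀.d q u v := by
    simp [hT.contract_eq, hd]
  rw [h3] at h
  have h4 : nabla.torsion q (u + S.ω₀.ev u • T q) (v + S.ω₀.ev v • T q)
      = nabla.torsion q u v + S.ω₀.ev u • nabla.torsion q (T q) v
        - S.ω₀.ev v • nabla.torsion q (T q) u := by
    have h5 : nabla.torsion q u (T q) = -nabla.torsion q (T q) u := nabla.torsion_antisymm ..
    simp [h5]
    abel
  rw [← h, h4]
  abel

/-- The pseudohermitian torsion `τ(𝒯, ·)` anticommutes with `J`. -/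
lemma torsion_reeb_J (hT : S.IsReeb T) (hN : S.IsTanakaWebster T nabla) {q : X}
    (v : TangentSpace (𝓡 (2 * n + 1)) q) :
    nabla.torsion q (T q) (S.J T q v) = -S.J T q (nabla.torsion q (T q) v) := by
  have h := hN.torsion_reeb q _ (add_reeb_mem_levi hT v)
  simpa [J_reeb hT] using h

/-- The trace of `v ↦ τ(v, Ju)` vanishes: by `torsion_eq` it is
`-dω₀(𝒯, Ju) - ω₀(τ(𝒯, Ju)) = -2 dω₀(𝒯, Ju)`. -/
lemma sum_torsion_J (hT : S.IsReeb T) (hN : S.IsTanakaWebster T nabla)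
    (hφ : φ ∈ IsManifold.maximalAtlas (𝓡 (2 * n + 1)) ∞ X) {q : X} (hq : q ∈ φ.source)
    (u : TangentSpace (𝓡 (2 * n + 1)) q) :
    ∑ j, push φ q (nabla.torsion q (coordField φ j q) (S.J T q u)) j = 0 := by
  have h1 := sum_push_smul hφ hq ((S.ω₀.d q).flip (S.J T q u)) (T q)
  have h2 := sum_push_smul hφ hq (S.ω₀ q).toLinearMap (nabla.torsion q (T q) (S.J T q u))
  have h3 : S.ω₀.ev (nabla.torsion q (T q) (S.J T q u)) = 0 := by
    rw [ev_torsion hT hN, hT.contract_eq]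
  have h4 : ∀ j, push φ q (nabla.torsion q (coordField φ j q) (S.J T q u)) j
      = -((S.ω₀.d q).flip (S.J T q u) (coordField φ j q) * push φ q (T q) j)
        - (S.ω₀ q).toLinearMap (coordField φ j q)
          * push φ q (nabla.torsion q (T q) (S.J T q u)) j := fun j => by
    rw [torsion_eq hT hN, ev_J hT]
    simp [OneForm.ev]
  simp only [h4, Finset.sum_sub_distrib, Finset.sum_neg_distrib]
  rw [h1, h2]
  have h5 : (S.ω₀.d q).flip (S.J T q u) (T q) = 0 := hT.contract_eq q _
  rw [h5]
  simpa [OneForm.ev] using h3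

/-- The trace of `v ↦ J τ(v, u)` vanishes: by `torsion_eq` it is `ω₀(u) tr(J τ(𝒯, ·))`, and
`τ(𝒯, ·)` anticommutes with `J`. -/
lemma sum_J_torsion (hT : S.IsReeb T) (hN : S.IsTanakaWebster T nabla)
    (hφ : φ ∈ IsManifold.maximalAtlas (𝓡 (2 * n + 1)) ∞ X) {q : X} (hq : q ∈ φ.source)
    (u : TangentSpace (𝓡 (2 * n + 1)) q) :
    ∑ j, push φ q (S.J T q (nabla.torsion q (coordField φ j q) u)) j = 0 := by
  have h1 := sum_push_smul hφ hq (S.ω₀ q).toLinearMap (S.J T q (nabla.torsion q (T q) u))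
  have h2 : S.ω₀.ev (S.J T q (nabla.torsion q (T q) u)) = 0 := ev_J hT _
  have h3 : LinearMap.trace ℝ _ (S.J T q * (nabla.torsion q (T q)).toLinearMap) = 0 := by
    have h5 : (nabla.torsion q (T q)).toLinearMap * S.J T q
        = -(S.J T q * (nabla.torsion q (T q)).toLinearMap) :=
      LinearMap.ext fun v => torsion_reeb_J hT hN v
    have h6 := LinearMap.trace_mul_comm ℝ (nabla.torsion q (T q)).toLinearMap (S.J T q)
    rw [h5, map_neg] at h6
    linarith
  rw [← sum_push_eq_trace hφ hq] at h3
  have h4 : ∀ j, push φ q (S.J T q (nabla.torsion q (coordField φ j q) u)) j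
      = -((S.ω₀ q).toLinearMap (coordField φ j q)
          * push φ q (S.J T q (nabla.torsion q (T q) u)) j)
        + S.ω₀.ev u * push φ q ((S.J T q * (nabla.torsion q (T q)).toLinearMap)
          (coordField φ j q)) j := fun j => by
    rw [torsion_eq hT hN]
    simp [OneForm.ev, J_reeb hT]
  simp only [h4, Finset.sum_add_distrib, Finset.sum_neg_distrib, ← Finset.mul_sum]
  rw [h1, h3]
  simpa [OneForm.ev] using h2

end PseudohermitianStructure

/-! ### The first order part of the operator -/

namespace PseudohermitianStructure

variable {S : PseudohermitianStructure n X} {T : VField n X}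

lemma fderiv_GCoef [T2Space X] (hT : S.IsReeb T)
    (hn : CovariantDerivative.ContMDiffCovariantDerivative nabla ∞)
    (hφ : φ ∈ IsManifold.maximalAtlas (𝓡 (2 * n + 1)) ∞ X)
    {y : RVec n × RVec n} (hy : y.1 ∈ φ.target) (l i k : Fin (2 * n + 1)) :
    fderiv ℝ (S.GCoef T nabla φ l i) y (phaseVec (Sum.inr k))
      = ∑ j, (S.JEntry T φ j i y * christ nabla φ j l y.1 k
        + christ nabla φ i j y.1 k * S.JEntry T φ j l y) := by
  have h1 : (S.GCoef T nabla φ l i) ∘ (fun ξ => (y.1, ξ)) = innerSL ℝ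
      (∑ j, (S.JEntry T φ j i y • christ nabla φ j l y.1
        + S.JEntry T φ j l y • christ nabla φ i j y.1)) := by
    funext ξ
    rw [innerSL_apply_apply, real_inner_comm, inner_sum]
    change ∑ j, (S.JEntry T φ j i y * chr nabla φ j l (y.1, ξ)
      + chr nabla φ i j (y.1, ξ) * S.JEntry T φ j l y) = _
    refine Finset.sum_congr rfl fun j _ => ?_
    simp only [inner_add_right, inner_smul_right]
    exact congrArg (S.JEntry T φ j i y * chr nabla φ j l (y.1, ξ) + ·) (mul_comm _ _)
  have h2 : HasFDerivAt (fun ξ : RVec n => (y.1, ξ))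
      (ContinuousLinearMap.inr ℝ (RVec n) (RVec n)) y.2 := hasFDerivAt_prodMk_right y.1 y.2
  have h3 := ((GCoef_contDiffAt hT hn hφ l i (y := y) hy).differentiableAt (by simp)).hasFDerivAt
  have h4 := (HasFDerivAt.comp y.2 (g := S.GCoef T nabla φ l i) h3 h2)
  rw [h1] at h4
  have h5 := DFunLike.congr_fun (h4.unique (innerSL ℝ _).hasFDerivAt) (stdVec k)
  refine h5.trans ?_
  simp [stdVec, EuclideanSpace.inner_single_right, mul_comm]

/-- The first order coefficients are `2 (div J)_i + 2 tr Γ_{J ∂_i}`, where `Γ_u ∂_l = ∇_u ∂_l`. Since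
`∇J = 0`, the term `tr(Γ_{∂_i} J)` is expressed through `div J` and the traces of the torsion, which vanish. -/
lemma firstCoef_eq [T2Space X] (hT : S.IsReeb T) (hN : S.IsTanakaWebster T nabla)
    (hφ : φ ∈ IsManifold.maximalAtlas (𝓡 (2 * n + 1)) ∞ X)
    {y : RVec n × RVec n} (hy : y.1 ∈ φ.target) (i : Fin (2 * n + 1)) :
    S.firstCoef T nabla φ i y
      = 2 * ∑ j, fderiv ℝ (fun x => S.JMat T φ x (stdVec i) j) y.1 (stdVec j)
        + 2 * ∑ j, S.JEntry T φ j i y * ∑ l, christ nabla φ j l y.1 l := by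
  have hq := φ.map_target hy
  set q := φ.symm y.1 with hqdef
  have hsm : ∀ k, VField.SmoothOn (coordField φ k) φ.source := fun k q' hq' =>
    (coordField_smoothAt hφ k hq').contMDiffWithinAt
  have hJe : ∀ k, S.J T q (coordField φ k q) = ∑ m, S.JEntry T φ m k y • coordField φ m q :=
    fun k => eq_sum_coordField hφ hq _
  have hc : ∀ k m, push φ q (coordField φ k (φ.symm y.1)) m = if m = k then 1 else 0 :=
    fun k m => by
      rw [push_coordField hφ hq]
      simp [stdVec]
  -- the components of `∇_{∂_j} (J ∂_i) = J ∇_{∂_j} ∂_i`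
  have hpar : ∀ j, ∑ k, S.JEntry T φ k i y * christ nabla φ j k y.1 j
      + fderiv ℝ (fun x => S.JMat T φ x (stdVec i) j) y.1 (stdVec j)
      = push φ q (S.J T q (nabla (coordField φ i) q (coordField φ j q))) j := by
    intro j
    have h1 := nabla_JField hT hN φ.open_source (hsm i) hq (coordField φ j q)
    rw [nabla_eq_sum hφ hq (JField_smoothAt hT hφ hq (coordField_smoothAt hφ i hq)),
      push_coordField hφ hq, hqdef, φ.right_inv hy] at h1
    rw [← h1, map_sum, WithLp.ofLp_sum, Finset.sum_apply]
    simp only [map_add, map_smul, PiLp.add_apply, PiLp.smul_apply, smul_eq_mul,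
      Finset.sum_add_distrib]
    congr 1
    simp only [hc, mul_ite, mul_one, mul_zero, Finset.sum_ite_eq, Finset.mem_univ, if_true]
    rfl
  have htor : ∀ j k, christ nabla φ j k y.1 j = christ nabla φ k j y.1 j
      + push φ q (nabla.torsion q (coordField φ j q) (coordField φ k q)) j := by
    intro j k
    rw [torsion_coordField hφ hq, map_sub]
    exact (add_sub_cancel _ _).symm
  have htor' : ∀ j, push φ q (S.J T q (nabla (coordField φ i) q (coordField φ j q))) j
      = push φ q (S.J T q (nabla (coordField φ j) q (coordField φ i q))) j
        + push φ q (S.J T q (nabla.torsion q (coordField φ j q) (coordField φ i q))) j := by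
    intro j
    rw [torsion_coordField hφ hq, map_sub, map_sub]
    exact (add_sub_cancel _ _).symm
  have h1 := sum_torsion_J hT hN hφ hq (coordField φ i q)
  have h2 := sum_J_torsion hT hN hφ hq (coordField φ i q)
  have h3 : ∑ j, ∑ k, S.JEntry T φ k i y * push φ q (nabla.torsion q (coordField φ j q)
      (coordField φ k q)) j = 0 := by
    rw [← h1]
    refine Finset.sum_congr rfl fun j _ => ?_
    rw [hJe i]
    simp [map_sum]
  have h4 : ∑ j, push φ q (S.J T q (nabla (coordField φ j) q (coordField φ i q))) j
      = ∑ l, ∑ j, christ nabla φ i j y.1 l * S.JEntry T φ j l y := by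
    rw [Finset.sum_comm]
    refine Finset.sum_congr rfl fun j _ => ?_
    conv_lhs => rw [eq_sum_coordField hφ hq (nabla (coordField φ j) q (coordField φ i q))]
    rw [map_sum, map_sum, WithLp.ofLp_sum, Finset.sum_apply]
    refine Finset.sum_congr rfl fun l _ => ?_
    rw [map_smul, map_smul]
    rfl
  have h5 := Finset.sum_congr rfl fun j (_ : j ∈ Finset.univ) => (hpar j).trans (htor' j)
  simp only [htor, mul_add, Finset.sum_add_distrib, h2, h3, h4, add_zero] at h5
  have h6 : ∑ j, ∑ l, S.JEntry T φ l i y * christ nabla φ l j y.1 j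
      = ∑ j, S.JEntry T φ j i y * ∑ l, christ nabla φ j l y.1 l := by
    rw [Finset.sum_comm]
    simp only [Finset.mul_sum]
  unfold firstCoef
  simp only [fderiv_JEntry hT hφ hy, fderiv_GCoef hT hN.smooth hφ hy, Finset.sum_add_distrib]
  rw [h6] at h5 ⊢
  rw [← h5]
  simp only [phaseVec]
  ring

end PseudohermitianStructure

/-! ### Indices and Taylor coefficients -/

lemma sum_index {M : Type*} [AddCommMonoid M] (f : Fin (2 * n + 1) → M) :
    ∑ k, f k = ∑ j : Fin n, (f (iOdd j) + f (iEven j)) + f (iLast n) := by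
  rw [Fin.sum_univ_castSucc]
  congr 1
  rw [← (finProdFinEquiv.trans (finCongr (mul_comm n 2))).sum_comp, Fintype.sum_prod_type]
  refine Finset.sum_congr rfl fun j _ => ?_
  rw [Fin.sum_univ_two]
  congr 2 <;> ext <;> simp [iOdd, iEven, finProdFinEquiv, add_comm]

lemma index_cases (k : Fin (2 * n + 1)) :
    (∃ j, k = iOdd j) ∨ (∃ j, k = iEven j) ∨ k = iLast n := by
  have hk := k.2
  rcases Nat.lt_or_ge k.1 (2 * n) with h | h
  · rcases Nat.even_or_odd' k.1 with ⟨m, hm | hm⟩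
    · exact Or.inl ⟨⟨m, by omega⟩, Fin.ext hm⟩
    · exact Or.inr (Or.inl ⟨⟨m, by omega⟩, Fin.ext hm⟩)
  · exact Or.inr (Or.inr (Fin.ext (by simp [iLast]; omega)))

@[simp] lemma iOdd_inj {i j : Fin n} : iOdd i = iOdd j ↔ i = j := by
  simp [iOdd, Fin.ext_iff]

@[simp] lemma iEven_inj {i j : Fin n} : iEven i = iEven j ↔ i = j := by
  simp [iEven, Fin.ext_iff]

@[simp] lemma iOdd_ne_iEven (i j : Fin n) : iOdd i ≠ iEven j := by
  simp [iOdd, iEven, Fin.ext_iff]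
  omega

@[simp] lemma iEven_ne_iOdd (i j : Fin n) : iEven i ≠ iOdd j := (iOdd_ne_iEven j i).symm

@[simp] lemma iOdd_ne_iLast (i : Fin n) : iOdd i ≠ iLast n := by
  have := i.2
  simp [iOdd, iLast, Fin.ext_iff]
  omega

@[simp] lemma iEven_ne_iLast (i : Fin n) : iEven i ≠ iLast n := by
  have := i.2
  simp [iEven, iLast, Fin.ext_iff]
  omega

section Taylor

variable {E F : Type*} [NormedAddCommGroup E] [NormedSpace ℝ E] [NormedAddCommGroup F]
  [NormedSpace ℝ F]

lemma eq_zero_of_isBigO {h : E → F} {m : ℕ} (hm : m ≠ 0)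
    (hO : h =O[𝓝 0] fun x => ‖x‖ ^ m) : h 0 = 0 := by
  obtain ⟨C, hC⟩ := hO.bound
  simpa [hm] using hC.self_of_nhds

/-- A function which agrees with an affine map up to `O(|x|^m)`, `m > 1`, has the one-jet of that
map. -/
lemma hasFDerivAt_of_isBigO {f : E → F} {c : F} {L : E →L[ℝ] F} {m : ℕ} (hm : 1 < m)
    (hO : (fun x => f x - (c + L x)) =O[𝓝 0] fun x => ‖x‖ ^ m) :
    f 0 = c ∧ HasFDerivAt f L 0 := by
  have h0 := eq_zero_of_isBigO (by omega) hO
  have h1 : HasFDerivAt (fun x => f x - (c + L x)) (0 : E →L[ℝ] F) 0 :=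
    Asymptotics.IsBigO.hasFDerivAt (x₀ := (0 : E)) (n := m) (by simpa using hO) hm
  refine ⟨by simpa [sub_eq_zero] using h0, ?_⟩
  have h2 := h1.fun_add (L.hasFDerivAt.const_add c)
  simpa using h2

/-- A function which is `O(|x|³)` has vanishing second derivative at the origin. -/
lemma fderiv_fderiv_eq_zero_of_isBigO {h : E → F} (hh : ContDiffAt ℝ ∞ h 0)
    (hO : h =O[𝓝 0] fun x => ‖x‖ ^ 3) : fderiv ℝ (fderiv ℝ h) 0 = 0 := by
  have hD0 : fderiv ℝ h 0 = 0 :=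
    (Asymptotics.IsBigO.hasFDerivAt (x₀ := (0 : E)) (n := 3) (by simpa using hO)
      (by norm_num)).fderiv
  have h00 : h 0 = 0 := eq_zero_of_isBigO (by norm_num) hO
  have hD : HasFDerivAt (fderiv ℝ h) (fderiv ℝ (fderiv ℝ h) 0) 0 :=
    ((hh.fderiv_right (m := ∞) (by simp)).differentiableAt (by simp)).hasFDerivAt
  set D := fderiv ℝ (fderiv ℝ h) 0 with hDdef
  have hdiff : ∀ᶠ x in 𝓝 (0 : E), DifferentiableAt ℝ h x :=
    ((hh.of_le (m := 1) (by simp)).eventually (by simp)).mono fun x hx =>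
      hx.differentiableAt (by simp)
  obtain ⟨ε, hε, hball⟩ := Metric.eventually_nhds_iff_ball.1 hdiff
  have hint : interior (Metric.ball (0 : E) ε) = Metric.ball 0 ε := Metric.isOpen_ball.interior_eq
  -- along rays, `h` and its linear part are `o(t²)`
  have hray : ∀ v : E, (fun t : ℝ => h (t • v)) =o[𝓝[>] 0] fun t => t ^ 2 := by
    intro v
    have ht : Filter.Tendsto (fun t : ℝ => t • v) (𝓝[>] 0) (𝓝 0) := by
      have : Filter.Tendsto (fun t : ℝ => t • v) (𝓝 0) (𝓝 ((0 : ℝ) • v)) :=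
        (continuous_id.smul continuous_const).tendsto 0
      rw [zero_smul] at this
      exact this.mono_left nhdsWithin_le_nhds
    have h1 := hO.comp_tendsto ht
    have h2 : ((fun x : E => ‖x‖ ^ 3) ∘ fun t : ℝ => t • v) =O[𝓝[>] 0] fun t : ℝ => t ^ 3 := by
      refine Asymptotics.IsBigO.of_bound (‖v‖ ^ 3) (Filter.Eventually.of_forall fun t => ?_)
      simp [norm_smul, mul_pow, mul_comm]
    have h3 : (fun t : ℝ => t ^ 3) =o[𝓝[>] 0] fun t : ℝ => t ^ 2 :=
      (Asymptotics.isLittleO_pow_pow (by norm_num)).mono nhdsWithin_le_nhds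
    exact (h1.trans h2).trans_isLittleO h3
  have key : ∀ v w : E, v ∈ Metric.ball 0 ε → v + w ∈ Metric.ball 0 ε →
      D v w + (1 / 2 : ℝ) • D w w = 0 := by
    intro v w hv hw
    have h1 := Convex.taylor_approx_two_segment (convex_ball (0 : E) ε)
      (f := h) (f' := fderiv ℝ h) (f'' := D)
      (fun x hx => (hball x (by rwa [hint] at hx)).hasFDerivAt) (Metric.mem_ball_self hε)
      hD.hasFDerivWithinAt (v := v) (w := w) (by simpa [hint] using hv) (by simpa [hint] using hw)
    have h2 := ((hray (v + w)).sub (hray v)).sub h1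
    have h3 : (fun t : ℝ => t ^ 2 • (D v w + (1 / 2 : ℝ) • D w w)) =o[𝓝[>] 0]
        fun t : ℝ => t ^ 2 := by
      refine h2.congr' (Filter.Eventually.of_forall fun t => ?_) Filter.EventuallyEq.rfl
      simp only [hD0, zero_apply, smul_zero, zero_add, smul_add, smul_smul]
      rw [show t ^ 2 / 2 = t ^ 2 * (1 / 2) by ring]
      abel
    have h4 : (fun t : ℝ => D v w + (1 / 2 : ℝ) • D w w) =o[𝓝[>] 0] fun _ : ℝ => (1 : ℝ) := by
      refine Asymptotics.isLittleO_iff.2 fun c hc => ?_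
      filter_upwards [Asymptotics.isLittleO_iff.1 h3 hc, self_mem_nhdsWithin] with t ht ht0
      have ht0' : (0 : ℝ) < t ^ 2 := pow_pos ht0 2
      rw [norm_smul, Real.norm_of_nonneg ht0'.le, mul_comm] at ht
      rw [norm_one, mul_one]
      exact le_of_mul_le_mul_right ht ht0'
    exact Asymptotics.isLittleO_const_const_iff.1 h4
  have hdiag : ∀ w ∈ Metric.ball (0 : E) ε, D w w = 0 := fun w hw => by
    have := key 0 w (Metric.mem_ball_self hε) (by simpa using hw)
    simpa using this
  -- `key` concerns small vectors; the general case follows by scaling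
  have hsmall : ∀ v w : E, ∃ c : ℝ, c ≠ 0 ∧ ‖c • v‖ < ε / 2 ∧ ‖c • w‖ < ε / 2 := by
    intro v w
    have h1 : ∀ u : E, ∀ᶠ c : ℝ in 𝓝[≠] 0, ‖c • u‖ < ε / 2 := fun u => by
      have : Filter.Tendsto (fun t : ℝ => ‖t • u‖) (𝓝 0) (𝓝 ‖(0 : ℝ) • u‖) :=
        (continuous_id.smul continuous_const).norm.tendsto 0
      rw [zero_smul, norm_zero] at this
      exact (this.mono_left nhdsWithin_le_nhds).eventually_lt_const (by positivity)
    obtain ⟨c, hc⟩ := ((h1 v).and ((h1 w).and self_mem_nhdsWithin)).exists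
    exact ⟨c, hc.2.2, hc.1, hc.2.1⟩
  ext v w
  obtain ⟨c, hc, hv, hw⟩ := hsmall v w
  have hv' : c • v ∈ Metric.ball (0 : E) ε := by
    rw [mem_ball_zero_iff]
    linarith
  have hw' : c • w ∈ Metric.ball (0 : E) ε := by
    rw [mem_ball_zero_iff]
    linarith
  have h1 := key (c • v) (c • w) hv' (by
    rw [mem_ball_zero_iff]
    exact (norm_add_le _ _).trans_lt (by linarith))
  rw [hdiag _ hw'] at h1
  simpa [hc] using h1

end Taylor

/-! ### The contact form in normal coordinates -/

/-- The linear form `B(·, v)`, where `B = ∑ⱼ dx_{2j} ⊗ dx_{2j-1} - dx_{2j-1} ⊗ dx_{2j}`; the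
linear part of the model contact form at `x` is `B(x, ·)`. -/
def heisenbergB (v : RVec n) : RVec n →L[ℝ] ℝ :=
  ∑ j : Fin n, (v (iOdd j) • EuclideanSpace.proj (iEven j)
    - v (iEven j) • EuclideanSpace.proj (iOdd j))

lemma heisenbergB_apply (v x : RVec n) :
    heisenbergB v x = ∑ j : Fin n, (v (iOdd j) * x (iEven j) - v (iEven j) * x (iOdd j)) := by
  simp [heisenbergB]

lemma heisenbergB_swap (v x : RVec n) : heisenbergB x v = -heisenbergB v x := by
  rw [heisenbergB_apply, heisenbergB_apply, ← Finset.sum_neg_distrib]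
  exact Finset.sum_congr rfl fun j _ => by ring

lemma heisenbergB_stdVec_iEven (j : Fin n) (x : RVec n) :
    heisenbergB (stdVec (iEven j)) x = -x (iOdd j) := by
  rw [heisenbergB_apply]
  simp [stdVec]

lemma heisenbergB_stdVec_iOdd (j : Fin n) (x : RVec n) :
    heisenbergB (stdVec (iOdd j)) x = x (iEven j) := by
  rw [heisenbergB_apply]
  simp [stdVec]

lemma heisenbergB_stdVec_iLast (x : RVec n) : heisenbergB (stdVec (iLast n)) x = 0 := by
  rw [heisenbergB_apply]
  simp [stdVec]

lemma sum_mul_heisenbergB (v w : RVec n) :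
    ∑ k, w k * heisenbergB (stdVec k) v = heisenbergB w v := by
  have h : ∀ k, heisenbergB (stdVec k) v = -heisenbergB v (stdVec k) := fun k =>
    heisenbergB_swap _ _
  rw [heisenbergB_swap v w]
  conv_rhs => rw [eq_sum_stdVec w]
  simp [h]

lemma heisenbergForm_eq (x v : RVec n) :
    heisenbergForm x v = ((v (iLast n) + heisenbergB v x : ℝ) : ℂ) := by
  rw [heisenbergB_apply, heisenbergForm]
  push_cast
  rw [Finset.mul_sum]
  congr 1
  refine Finset.sum_congr rfl fun j _ => ?_
  simp only [zCoord, map_add, map_mul, Complex.conj_I, Complex.conj_ofReal]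
  linear_combination ((v (iEven j) : ℂ) * x (iOdd j) - v (iOdd j) * x (iEven j)) * Complex.I_sq

namespace PseudohermitianStructure

variable {S : PseudohermitianStructure n X} {T : VField n X}

/-- The coefficient of `dx_k` in `ω₀`. -/
def evCoef (S : PseudohermitianStructure n X) (φ : OpenPartialHomeomorph X (RVec n))
    (k : Fin (2 * n + 1)) (x : RVec n) : ℝ := S.ω₀.ev (coordField φ k (φ.symm x))

lemma evCoef_contDiffAt (hφ : φ ∈ IsManifold.maximalAtlas (𝓡 (2 * n + 1)) ∞ X)
    (k : Fin (2 * n + 1)) {x : RVec n} (hx : x ∈ φ.target) :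
    ContDiffAt ℝ ∞ (S.evCoef φ k) x :=
  contMDiffAt_iff_contDiffAt.1 (ContMDiffAt.comp x
    (S.ω₀.contMDiffAt_ev (coordField_smoothAt hφ k (φ.map_target hx)))
    (contMDiffAt_symm_of_mem_maximalAtlas hφ hx))

lemma d_coordField (hφ : φ ∈ IsManifold.maximalAtlas (𝓡 (2 * n + 1)) ∞ X)
    {x : RVec n} (hx : x ∈ φ.target) (l m : Fin (2 * n + 1)) :
    S.ω₀.d (φ.symm x) (coordField φ l (φ.symm x)) (coordField φ m (φ.symm x))
      = fderiv ℝ (S.evCoef φ m) x (stdVec l) - fderiv ℝ (S.evCoef φ l) x (stdVec m) := by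
  have hq := φ.map_target hx
  have hd : ∀ k, MDifferentiableAt (𝓡 (2 * n + 1)) 𝓘(ℝ, ℝ)
      (fun y => S.ω₀.ev (coordField φ k y)) (φ.symm x) := fun k =>
    S.ω₀.mdifferentiableAt_ev (coordField_smoothAt hφ k hq).mdiff
  rw [S.ω₀.d_apply (coordField_smoothAt hφ l hq).mdiff (coordField_smoothAt hφ m hq).mdiff,
    mvfderiv_eq_fderiv hφ hq (hd m), mvfderiv_eq_fderiv hφ hq (hd l), push_coordField hφ hq,
    push_coordField hφ hq, bracket_coordField hφ hq, φ.right_inv hx]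
  have h0 : S.ω₀.ev (0 : TangentSpace (𝓡 (2 * n + 1)) (φ.symm x)) = 0 := map_zero (S.ω₀ (φ.symm x))
  rw [h0, sub_zero]
  rfl

lemma ev_nabla_coordField (hT : S.IsReeb T) (hN : S.IsTanakaWebster T nabla)
    (hφ : φ ∈ IsManifold.maximalAtlas (𝓡 (2 * n + 1)) ∞ X)
    {x : RVec n} (hx : x ∈ φ.target) (j l : Fin (2 * n + 1)) :
    S.ω₀.ev (nabla (coordField φ l) (φ.symm x) (coordField φ j (φ.symm x)))
      = fderiv ℝ (S.evCoef φ l) x (stdVec j) := by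
  have hq := φ.map_target hx
  rw [ev_nabla hT hN φ.open_source (fun q' hq' =>
    (coordField_smoothAt hφ l hq').contMDiffWithinAt) hq, mvfderiv_eq_fderiv hφ hq
    (S.ω₀.mdifferentiableAt_ev (coordField_smoothAt hφ l hq).mdiff), push_coordField hφ hq,
    φ.right_inv hx]
  rfl

section Normal

variable {p : X}

lemma IsNormalChart.zero_mem_target (h : S.IsNormalChart T p φ) : (0 : RVec n) ∈ φ.target := by
  rw [← h.center]
  exact φ.map_source h.mem_source

lemma IsNormalChart.symm_zero (h : S.IsNormalChart T p φ) : φ.symm 0 = p := by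
  rw [← h.center]
  exact φ.left_inv h.mem_source

lemma IsNormalChart.evCoef_isBigO (h : S.IsNormalChart T p φ) (k : Fin (2 * n + 1)) :
    (fun x => S.evCoef φ k x - (stdVec k (iLast n) + heisenbergB (stdVec k) x))
      =O[𝓝 0] fun x => ‖x‖ ^ 3 := by
  refine (Asymptotics.isBigO_of_le _ fun x => ?_).trans (h.contact k)
  rw [heisenbergForm_eq, ← Complex.ofReal_sub, Complex.norm_real]
  rfl

lemma IsNormalChart.evCoef_zero (h : S.IsNormalChart T p φ) (k : Fin (2 * n + 1)) :
    S.evCoef φ k 0 = stdVec k (iLast n) :=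
  (hasFDerivAt_of_isBigO (by norm_num) (h.evCoef_isBigO k)).1

lemma IsNormalChart.fderiv_evCoef (h : S.IsNormalChart T p φ) (k : Fin (2 * n + 1)) :
    fderiv ℝ (S.evCoef φ k) 0 = heisenbergB (stdVec k) :=
  (hasFDerivAt_of_isBigO (by norm_num) (h.evCoef_isBigO k)).2.fderiv

/-- The second derivatives of the coefficients of `ω₀` vanish at the origin. -/
lemma IsNormalChart.hasFDerivAt_fderiv_evCoef (h : S.IsNormalChart T p φ)
    (k : Fin (2 * n + 1)) (v : RVec n) :
    HasFDerivAt (fun x => fderiv ℝ (S.evCoef φ k) x v) (0 : RVec n →L[ℝ] ℝ) 0 := by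
  set g : RVec n → ℝ := fun x => S.evCoef φ k x - (stdVec k (iLast n) + heisenbergB (stdVec k) x)
  have he := evCoef_contDiffAt (S := S) h.mem_atlas k h.zero_mem_target
  have hg : ContDiffAt ℝ ∞ g 0 :=
    he.sub (contDiffAt_const.add (heisenbergB (stdVec k)).contDiff.contDiffAt)
  have h0 := fderiv_fderiv_eq_zero_of_isBigO hg (h.evCoef_isBigO k)
  have h1 : HasFDerivAt (fderiv ℝ g) (0 : RVec n →L[ℝ] RVec n →L[ℝ] ℝ) 0 := by
    rw [← h0]
    exact ((hg.fderiv_right (m := ∞) (by simp)).differentiableAt (by simp)).hasFDerivAt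
  have h2 : HasFDerivAt (fun x => fderiv ℝ g x v + heisenbergB (stdVec k) v)
      (0 : RVec n →L[ℝ] ℝ) 0 := by
    have := (h1.clm_apply (hasFDerivAt_const v 0)).add_const (heisenbergB (stdVec k) v)
    refine this.congr_fderiv (ContinuousLinearMap.ext fun b => ?_)
    simp
  refine h2.congr_of_eventuallyEq ?_
  filter_upwards [(he.of_le (m := 1) (by simp)).eventually (by simp)] with x hx
  have h3 : HasFDerivAt g (fderiv ℝ (S.evCoef φ k) x - heisenbergB (stdVec k)) x :=
    (hx.differentiableAt (by simp)).hasFDerivAt.sub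
      ((heisenbergB (stdVec k)).hasFDerivAt.const_add _)
  rw [h3.fderiv]
  simp

/-- At the origin of normal coordinates, `ω₀ = dx_{2n+1}`. -/
lemma IsNormalChart.ev_eq (h : S.IsNormalChart T p φ)
    (v : TangentSpace (𝓡 (2 * n + 1)) (φ.symm 0)) :
    S.ω₀.ev v = push φ (φ.symm 0) v (iLast n) := by
  have h1 := sum_push_smul h.mem_atlas (φ.map_target h.zero_mem_target)
    (S.ω₀ (φ.symm 0)).toLinearMap v
  have h2 : ∀ k, (S.ω₀ (φ.symm 0)).toLinearMap (coordField φ k (φ.symm 0)) = stdVec k (iLast n) :=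
    fun k => h.evCoef_zero k
  simp only [h2] at h1
  refine h1.symm.trans ?_
  simp [stdVec]

lemma IsNormalChart.christ_iLast (h : S.IsNormalChart T p φ) (hT : S.IsReeb T)
    (hN : S.IsTanakaWebster T nabla) (j l : Fin (2 * n + 1)) :
    christ nabla φ j l 0 (iLast n) = heisenbergB (stdVec l) (stdVec j) := by
  rw [christ, ← h.ev_eq, ev_nabla_coordField hT hN h.mem_atlas h.zero_mem_target,
    h.fderiv_evCoef]

lemma IsNormalChart.d_eq (h : S.IsNormalChart T p φ)
    (u v : TangentSpace (𝓡 (2 * n + 1)) (φ.symm 0)) :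
    S.ω₀.d (φ.symm 0) u v
      = 2 * heisenbergB (push φ (φ.symm 0) v) (push φ (φ.symm 0) u) := by
  have hq := φ.map_target h.zero_mem_target
  have h1 : ∀ l m, S.ω₀.d (φ.symm 0) (coordField φ l (φ.symm 0)) (coordField φ m (φ.symm 0))
      = 2 * heisenbergB (stdVec m) (stdVec l) := fun l m => by
    rw [d_coordField h.mem_atlas h.zero_mem_target, h.fderiv_evCoef, h.fderiv_evCoef,
      heisenbergB_swap (stdVec m) (stdVec l)]
    ring
  conv_lhs => rw [eq_sum_coordField h.mem_atlas hq u, eq_sum_coordField h.mem_atlas hq v]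
  simp only [map_sum, map_smul, LinearMap.sum_apply, LinearMap.smul_apply, smul_eq_mul, h1]
  rw [← sum_mul_heisenbergB, Finset.mul_sum]
  refine Finset.sum_congr rfl fun m _ => ?_
  conv_rhs => rw [eq_sum_stdVec (push φ (φ.symm 0) u)]
  simp only [map_sum, map_smul, smul_eq_mul, Finset.mul_sum]
  exact Finset.sum_congr rfl fun l _ => by ring

/-- The Christoffel symbols preserve the form `B`, since `dω₀` is parallel and its coefficients have
vanishing derivatives at the origin. -/
lemma IsNormalChart.heisenbergB_christ (h : S.IsNormalChart T p φ)
    (hN : S.IsTanakaWebster T nabla) (a l m : Fin (2 * n + 1)) :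
    heisenbergB (stdVec m) (christ nabla φ a l 0) + heisenbergB (christ nabla φ a m 0) (stdVec l)
      = 0 := by
  have h0 := h.zero_mem_target
  have hq := φ.map_target h0
  have hsm : ∀ k, VField.SmoothOn (coordField φ k) φ.source := fun k q' hq' =>
    (coordField_smoothAt h.mem_atlas k hq').contMDiffWithinAt
  have h1 := hN.dform φ.source φ.open_source _ _ (hsm l) (hsm m) _ hq (coordField φ a (φ.symm 0))
  rw [h.d_eq, h.d_eq, push_coordField h.mem_atlas hq, push_coordField h.mem_atlas hq] at h1
  have h2 : HasFDerivAt (fun x => fderiv ℝ (S.evCoef φ m) x (stdVec l)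
      - fderiv ℝ (S.evCoef φ l) x (stdVec m)) (0 : RVec n →L[ℝ] ℝ) 0 := by
    simpa using (h.hasFDerivAt_fderiv_evCoef m (stdVec l)).fun_sub
      (h.hasFDerivAt_fderiv_evCoef l (stdVec m))
  have hd : ∀ k v, ContDiffAt ℝ ∞ (fun x => fderiv ℝ (S.evCoef φ k) x v) 0 := fun k v =>
    ((evCoef_contDiffAt h.mem_atlas k h0).fderiv_right (m := ∞) (by simp)).clm_apply
      contDiffAt_const
  have h3 : MDifferentiableAt (𝓡 (2 * n + 1)) 𝓘(ℝ, ℝ) (fun q => S.ω₀.d q (coordField φ l q)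
      (coordField φ m q)) (φ.symm 0) := by
    have h4 : ContDiffAt ℝ ∞ (fun x => fderiv ℝ (S.evCoef φ m) x (stdVec l)
      - fderiv ℝ (S.evCoef φ l) x (stdVec m)) (φ (φ.symm 0)) := by
      rw [φ.right_inv h0]
      exact (hd m _).sub (hd l _)
    refine (h4.contMDiffAt.comp (φ.symm 0)
      (contMDiffAt_of_mem_maximalAtlas h.mem_atlas hq)).mdifferentiableAt (by simp)
      |>.congr_of_eventuallyEq ?_
    filter_upwards [φ.open_source.mem_nhds hq] with q' hq'
    refine Eq.trans ?_ (d_coordField h.mem_atlas (φ.map_source hq') l m)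
    rw [φ.left_inv hq']
  rw [mvfderiv_eq_fderiv h.mem_atlas hq h3, φ.right_inv h0] at h1
  have h5 : (fun x => S.ω₀.d (φ.symm x) (coordField φ l (φ.symm x)) (coordField φ m (φ.symm x)))
      =ᶠ[𝓝 0] fun x => fderiv ℝ (S.evCoef φ m) x (stdVec l)
      - fderiv ℝ (S.evCoef φ l) x (stdVec m) := by
    filter_upwards [φ.open_target.mem_nhds h0] with x hx
    exact d_coordField h.mem_atlas hx l m
  rw [h5.fderiv_eq, h2.fderiv, zero_apply] at h1
  change 0 = 2 * heisenbergB (stdVec m) (christ nabla φ a l 0)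
    + 2 * heisenbergB (christ nabla φ a m 0) (stdVec l) at h1
  linarith

/-- The connection one-forms are traceless at the origin. -/
lemma IsNormalChart.sum_christ (h : S.IsNormalChart T p φ) (hT : S.IsReeb T)
    (hN : S.IsTanakaWebster T nabla) (a : Fin (2 * n + 1)) :
    ∑ l, christ nabla φ a l 0 l = 0 := by
  rw [sum_index, h.christ_iLast hT hN, heisenbergB_stdVec_iLast, add_zero]
  refine Finset.sum_eq_zero fun j _ => ?_
  have h1 := h.heisenbergB_christ hN a (iOdd j) (iEven j)
  rw [heisenbergB_stdVec_iEven, heisenbergB_swap, heisenbergB_stdVec_iOdd] at h1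
  linarith

/-- At the point `-ω₀(p)` the second order coefficients `G_{li}` are antisymmetric. -/
lemma IsNormalChart.GCoef_swap (h : S.IsNormalChart T p φ) (hT : S.IsReeb T)
    (hN : S.IsTanakaWebster T nabla) (l i : Fin (2 * n + 1)) :
    S.GCoef T nabla φ i l (0, -stdVec (iLast n))
      = -S.GCoef T nabla φ l i (0, -stdVec (iLast n)) := by
  have hchr : ∀ j k, chr nabla φ j k (0, -stdVec (iLast n))
      = -heisenbergB (stdVec k) (stdVec j) := fun j k => by
    rw [← h.christ_iLast hT hN]
    simp [chr, stdVec, EuclideanSpace.inner_single_left]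
  unfold GCoef
  rw [← Finset.sum_neg_distrib]
  refine Finset.sum_congr rfl fun j _ => ?_
  simp only [hchr]
  rw [heisenbergB_swap (stdVec i) (stdVec j), heisenbergB_swap (stdVec j) (stdVec l)]
  ring

end Normal

end PseudohermitianStructure

/-! ### The complex structure in normal coordinates -/

lemma heisenbergFrame_eq (j : Fin n) (x : RVec n) (k : Fin (2 * n + 1)) :
    heisenbergFrame j x k
      = ((√2 / 2 * (stdVec (iOdd j) k - x (iEven j) * stdVec (iLast n) k) : ℝ) : ℂ)
        + Complex.I * ((-(√2 / 2) * (stdVec (iEven j) k + x (iOdd j) * stdVec (iLast n) k) : ℝ) : ℂ)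
      := by
  have h : ∀ m : Fin (2 * n + 1), (if k = m then (1 : ℂ) else 0) = ((stdVec m k : ℝ) : ℂ) := by
    intro m
    simp only [stdVec, EuclideanSpace.single, PiLp.single_apply]
    split_ifs <;> simp
  simp only [heisenbergFrame, zCoord, h, map_add, map_mul, Complex.conj_I, Complex.conj_ofReal]
  push_cast
  linear_combination (√2 / 2 * x (iEven j) * stdVec (iLast n) k : ℂ) * Complex.I_sq

/-- A vector-valued function whose components agree with an affine map up to `O(|x|^m)`. -/
lemma hasFDerivAt_of_isBigO_apply {f : RVec n → RVec n} {c : RVec n} {L : RVec n →L[ℝ] RVec n}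
    {m : ℕ} (hm : 1 < m) (hO : ∀ k, (fun x => f x k - (c k + L x k)) =O[𝓝 0] fun x => ‖x‖ ^ m) :
    f 0 = c ∧ HasFDerivAt f L 0 := by
  have h := fun k => hasFDerivAt_of_isBigO (f := fun x => f x k) (c := c k)
    (L := EuclideanSpace.proj (𝕜 := ℝ) k ∘L L) hm (hO k)
  refine ⟨?_, ?_⟩
  · ext k
    exact (h k).1
  · rw [← hasFDerivWithinAt_univ, hasFDerivWithinAt_euclidean]
    exact fun k => (h k).2.hasFDerivWithinAt

namespace PseudohermitianStructure

variable {S : PseudohermitianStructure n X} {T : VField n X}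

section Normal

variable {p : X}

lemma IsNormalChart.hasFDerivAt_reeb (h : S.IsNormalChart T p φ) :
    push φ (φ.symm 0) (T (φ.symm 0)) = -stdVec (iLast n)
      ∧ HasFDerivAt (fun x => push φ (φ.symm x) (T (φ.symm x))) (0 : RVec n →L[ℝ] RVec n) 0 :=
  hasFDerivAt_of_isBigO (f := fun x => push φ (φ.symm x) (T (φ.symm x)))
    (L := (0 : RVec n →L[ℝ] RVec n)) (m := 2) (by norm_num) (by simpa using h.reeb)

/-- The one-jet at the origin of the matrix of `J`: it follows from `J A = -B`, `J B = A` for the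
frame `A + i B` and from `J 𝒯 = 0`. -/
lemma IsNormalChart.hasFDerivAt_JMat (h : S.IsNormalChart T p φ) (hT : S.IsReeb T) :
    (∀ j, S.JMat T φ 0 (stdVec (iOdd j)) = stdVec (iEven j)) ∧
    (∀ j, S.JMat T φ 0 (stdVec (iEven j)) = -stdVec (iOdd j)) ∧
    S.JMat T φ 0 (stdVec (iLast n)) = 0 ∧
    (∀ j a, fderiv ℝ (S.JMat T φ) 0 a (stdVec (iOdd j)) = a (iOdd j) • stdVec (iLast n)) ∧
    (∀ j a, fderiv ℝ (S.JMat T φ) 0 a (stdVec (iEven j)) = a (iEven j) • stdVec (iLast n)) ∧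
    ∀ a, fderiv ℝ (S.JMat T φ) 0 a (stdVec (iLast n)) = 0 := by
  have h0 := h.zero_mem_target
  obtain ⟨A, B, hAB, -, hO⟩ := h.frame
  have hM := ((JMat_contDiffAt hT h.mem_atlas h0).differentiableAt (by simp)).hasFDerivAt
  set M' := fderiv ℝ (S.JMat T φ) 0 with hM'
  have hs : √2 / 2 ≠ 0 := by positivity
  have hmem : ∀ j, ∀ x ∈ φ.target, cvec (A j (φ.symm x)) (B j (φ.symm x)) ∈ S.T10 (φ.symm x) :=
    fun j x hx => by
      rw [← hAB.span_eq _ (φ.map_target hx)]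
      exact Submodule.subset_span ⟨j, rfl⟩
  -- one-jets of the frame: `A_j = (√2/2) (∂_{x_{2j-1}} - x_{2j} ∂_{x_{2n+1}})` and
  -- `B_j = -(√2/2) (∂_{x_{2j}} + x_{2j-1} ∂_{x_{2n+1}})` up to `O(|x|³)`
  have hre : ∀ j, push φ (φ.symm 0) (A j (φ.symm 0)) = (√2 / 2) • stdVec (iOdd j) ∧
      HasFDerivAt (fun x => push φ (φ.symm x) (A j (φ.symm x)))
        ((EuclideanSpace.proj (𝕜 := ℝ) (iEven j)).smulRight (-(√2 / 2) • stdVec (iLast n))) 0 := by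
    intro j
    refine hasFDerivAt_of_isBigO_apply (f := fun x => push φ (φ.symm x) (A j (φ.symm x)))
      (m := 3) (by norm_num) fun k =>
      (Asymptotics.isBigO_of_le _ fun x => ?_).trans (hO j k)
    refine le_trans (le_of_eq ?_) (Complex.abs_re_le_norm _)
    rw [heisenbergFrame_eq, Real.norm_eq_abs]
    congr 1
    simp
    ring
  have him : ∀ j, push φ (φ.symm 0) (B j (φ.symm 0)) = -(√2 / 2) • stdVec (iEven j) ∧
      HasFDerivAt (fun x => push φ (φ.symm x) (B j (φ.symm x)))
        ((EuclideanSpace.proj (𝕜 := ℝ) (iOdd j)).smulRight (-(√2 / 2) • stdVec (iLast n))) 0 := by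
    intro j
    refine hasFDerivAt_of_isBigO_apply (f := fun x => push φ (φ.symm x) (B j (φ.symm x)))
      (m := 3) (by norm_num) fun k =>
      (Asymptotics.isBigO_of_le _ fun x => ?_).trans (hO j k)
    refine le_trans (le_of_eq ?_) (Complex.abs_im_le_norm _)
    rw [heisenbergFrame_eq, Real.norm_eq_abs]
    congr 1
    simp
    ring
  obtain ⟨hT0, hTd⟩ := h.hasFDerivAt_reeb
  have hlast : S.JMat T φ 0 (stdVec (iLast n)) = 0 := by
    have h1 := JMat_push h.mem_atlas h0 (S := S) (T := T) (T (φ.symm 0))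
    rw [J_reeb hT, hT0] at h1
    simpa using h1
  have hMA : ∀ j, ∀ x ∈ φ.target, S.JMat T φ x (push φ (φ.symm x) (A j (φ.symm x)))
      = -push φ (φ.symm x) (B j (φ.symm x)) := fun j x hx => by
    rw [JMat_push h.mem_atlas hx, J_re hT (hmem j x hx), map_neg]
  have hMB : ∀ j, ∀ x ∈ φ.target, S.JMat T φ x (push φ (φ.symm x) (B j (φ.symm x)))
      = push φ (φ.symm x) (A j (φ.symm x)) := fun j x hx => by
    rw [JMat_push h.mem_atlas hx, J_im hT (hmem j x hx)]
  have hMT : ∀ x ∈ φ.target, S.JMat T φ x (push φ (φ.symm x) (T (φ.symm x))) = 0 :=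
    fun x hx => by
      rw [JMat_push h.mem_atlas hx, J_reeb hT, map_zero]
  -- values at the origin, then derivatives at the origin, of `hMA`, `hMB` and `hMT`
  refine ⟨fun j => ?_, fun j => ?_, hlast, fun j a => ?_, fun j a => ?_, fun a => ?_⟩
  · have h1 := hMA j 0 h0
    rw [(hre j).1, (him j).1, map_smul, neg_smul, neg_neg] at h1
    exact smul_right_injective _ hs h1
  · have h1 := hMB j 0 h0
    rw [(hre j).1, (him j).1, map_smul, neg_smul, ← smul_neg] at h1
    have h2 := smul_right_injective _ hs h1
    exact neg_eq_iff_eq_neg.1 h2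
  · have h1 := (hM.clm_apply (hre j).2).congr_of_eventuallyEq (f₁ := fun x =>
      -push φ (φ.symm x) (B j (φ.symm x))) (by
        filter_upwards [φ.open_target.mem_nhds h0] with x hx
        exact (hMA j x hx).symm)
    have h2 := DFunLike.congr_fun (h1.unique (him j).2.fun_neg) a
    simp only [(hre j).1, add_apply, ContinuousLinearMap.comp_apply, map_smul, smul_apply,
      ContinuousLinearMap.flip_apply, ContinuousLinearMap.smulRight_apply, hlast, map_neg,
      smul_zero, neg_zero, zero_add, neg_apply, neg_smul, smul_neg, neg_neg] at h2
    exact smul_right_injective _ hs (h2.trans (smul_comm _ _ _))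
  · have h1 := (hM.clm_apply (him j).2).congr_of_eventuallyEq (f₁ := fun x =>
      push φ (φ.symm x) (A j (φ.symm x))) (by
        filter_upwards [φ.open_target.mem_nhds h0] with x hx
        exact (hMB j x hx).symm)
    have h2 := DFunLike.congr_fun (h1.unique (hre j).2) a
    simp only [(him j).1, add_apply, ContinuousLinearMap.comp_apply, map_smul, smul_apply,
      ContinuousLinearMap.flip_apply, ContinuousLinearMap.smulRight_apply, hlast, map_neg,
      smul_zero, neg_zero, zero_add, neg_apply, neg_smul, smul_neg, neg_inj] at h2
    exact smul_right_injective _ hs (h2.trans (smul_comm _ _ _))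
  · have h1 := (hM.clm_apply hTd).congr_of_eventuallyEq (f₁ := fun x => (0 : RVec n)) (by
        filter_upwards [φ.open_target.mem_nhds h0] with x hx
        exact (hMT x hx).symm)
    have h2 := DFunLike.congr_fun (h1.unique (hasFDerivAt_const (0 : RVec n) 0)) a
    simpa [hT0] using h2

/-- Every term of the divergence of `J` vanishes at the origin. -/
lemma IsNormalChart.fderiv_JMat_apply (h : S.IsNormalChart T p φ) (hT : S.IsReeb T)
    (i j : Fin (2 * n + 1)) :
    fderiv ℝ (fun x => S.JMat T φ x (stdVec i) j) 0 (stdVec j) = 0 := by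
  obtain ⟨-, -, -, hodd, heven, hlast⟩ := h.hasFDerivAt_JMat hT
  have hM := ((JMat_contDiffAt hT h.mem_atlas h.zero_mem_target).differentiableAt
    (by simp)).hasFDerivAt
  have h1 := (EuclideanSpace.proj (𝕜 := ℝ) j).hasFDerivAt.comp (0 : RVec n)
    (hM.clm_apply (hasFDerivAt_const (stdVec i) 0))
  have h2 : fderiv ℝ (fun x => S.JMat T φ x (stdVec i) j) 0 (stdVec j)
      = fderiv ℝ (S.JMat T φ) 0 (stdVec j) (stdVec i) j := by
    refine (DFunLike.congr_fun h1.fderiv (stdVec j)).trans ?_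
    simp
  rw [h2]
  rcases index_cases i with ⟨k, rfl⟩ | ⟨k, rfl⟩ | rfl
  · rw [hodd]
    rcases eq_or_ne j (iLast n) with rfl | hj
    · simp [stdVec]
    · simp only [PiLp.smul_apply, smul_eq_mul, stdVec, PiLp.single_eq_of_ne _ hj, mul_zero]
  · rw [heven]
    rcases eq_or_ne j (iLast n) with rfl | hj
    · simp [stdVec]
    · simp only [PiLp.smul_apply, smul_eq_mul, stdVec, PiLp.single_eq_of_ne _ hj, mul_zero]
  · rw [hlast]
    rfl

lemma IsNormalChart.cotCoord_negForm (h : S.IsNormalChart T p φ) :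
    cotCoord φ (negForm S.ω₀ p) = (0, -stdVec (iLast n)) := by
  refine Prod.ext h.center ?_
  ext k
  have h1 := h.evCoef_zero k
  rw [evCoef, h.symm_zero] at h1
  change -S.ω₀.ev (coordField φ k p) = _
  rw [h1]
  simp [stdVec, eq_comm]

/-- The operator at the point `-ω₀(p)`, in normal coordinates at `p`. -/
lemma IsNormalChart.P_negForm [T2Space X] (h : S.IsNormalChart T p φ) (hT : S.IsReeb T)
    (hN : S.IsTanakaWebster T nabla) {F : CotBundle n X → ℝ}
    (hF : ContMDiff (cotModel n) 𝓘(ℝ, ℝ) ∞ F) :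
    S.P T nabla F (negForm S.ω₀ p)
      = ∑ j : Fin n, (mixedDeriv φ (iEven j) (iOdd j) F (negForm S.ω₀ p)
        - mixedDeriv φ (iOdd j) (iEven j) F (negForm S.ω₀ p)) := by
  have h0 := h.zero_mem_target
  have hy : ((0, -stdVec (iLast n)) : RVec n × RVec n).1 ∈ φ.target := h0
  have hf := contDiffAt_comp_cotPoint h.mem_atlas hF hy
  rw [P_eq_PChart hT hN.smooth h.mem_atlas hF (z := negForm S.ω₀ p) h.mem_source]
  simp only [mixedDeriv, h.cotCoord_negForm]
  rw [PChart_eq hT hN.smooth h.mem_atlas hy hf]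
  set f := fun w => F (cotPoint φ w) with hfdef
  have hdf := (hf.fderiv_right (m := ∞) (by simp)).differentiableAt (by simp)
  have hp : ∀ v a, fderiv ℝ (fun y' => fderiv ℝ f y' v) (0, -stdVec (iLast n)) a
      = fderiv ℝ (fderiv ℝ f) (0, -stdVec (iLast n)) a v := by
    intro v a
    rw [fderiv_clm_apply hdf (differentiableAt_const v)]
    simp
  have hsymm : ∀ a b, fderiv ℝ (fderiv ℝ f) (0, -stdVec (iLast n)) a b
      = fderiv ℝ (fderiv ℝ f) (0, -stdVec (iLast n)) b a := fun a b =>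
    (hf.isSymmSndFDerivAt (by simpa using ENat.LEInfty.out)) a b
  simp only [hp]
  set D := fderiv ℝ (fderiv ℝ f) (0, -stdVec (iLast n)) with hDdef
  have hfirst : ∀ i, S.firstCoef T nabla φ i (0, -stdVec (iLast n)) = 0 := fun i => by
    rw [firstCoef_eq hT hN h.mem_atlas hy]
    simp only [h.fderiv_JMat_apply hT, h.sum_christ hT hN]
    simp
  -- a symmetric matrix is contracted with an antisymmetric one
  have hG : ∑ i, ∑ j, 1 / 2 * S.GCoef T nabla φ j i (0, -stdVec (iLast n))
      * D (phaseVec (Sum.inr j)) (phaseVec (Sum.inr i)) = 0 := by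
    have h1 : ∑ i, ∑ j, 1 / 2 * S.GCoef T nabla φ j i (0, -stdVec (iLast n))
        * D (phaseVec (Sum.inr j)) (phaseVec (Sum.inr i))
        = -∑ i, ∑ j, 1 / 2 * S.GCoef T nabla φ j i (0, -stdVec (iLast n))
        * D (phaseVec (Sum.inr j)) (phaseVec (Sum.inr i)) := by
      conv_lhs => rw [Finset.sum_comm]
      simp only [← Finset.sum_neg_distrib]
      refine Finset.sum_congr rfl fun i _ => Finset.sum_congr rfl fun j _ => ?_
      rw [h.GCoef_swap hT hN, hsymm]
      ring
    linarith
  obtain ⟨hodd, heven, hlast, -⟩ := h.hasFDerivAt_JMat hT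
  simp only [hfirst, mul_zero, zero_mul, Finset.sum_const_zero, add_zero, Finset.sum_add_distrib,
    hG]
  rw [sum_index]
  simp only [JEntry, hodd, heven, hlast]
  simp [stdVec, sub_eq_add_neg]

end Normal

end PseudohermitianStructure

/-! ### Complex-valued functions -/

namespace PseudohermitianStructure

variable {S : PseudohermitianStructure n X} {T : VField n X}

lemma mixedDeriv_clm_comp {G H : Type*} [NormedAddCommGroup G] [NormedSpace ℝ G]
    [NormedAddCommGroup H] [NormedSpace ℝ H] (L : G →L[ℝ] H)
    (hφ : φ ∈ IsManifold.maximalAtlas (𝓡 (2 * n + 1)) ∞ X) {F : CotBundle n X → G}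
    (hF : ContMDiff (cotModel n) 𝓘(ℝ, G) ∞ F) (j k : Fin (2 * n + 1)) {z : CotBundle n X}
    (hz : z.1 ∈ φ.source) :
    mixedDeriv φ j k (fun w => L (F w)) z = L (mixedDeriv φ j k F z) := by
  have hf := contDiffAt_comp_cotPoint hφ hF (y := cotCoord φ z) (φ.map_source hz)
  have h1 : (fun y => fderiv ℝ (fun w => L (F (cotPoint φ w))) y (phaseVec (Sum.inr k)))
      =ᶠ[𝓝 (cotCoord φ z)]
      fun y => L (fderiv ℝ (fun w => F (cotPoint φ w)) y (phaseVec (Sum.inr k))) := by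
    filter_upwards [(hf.of_le (m := 1) (by simp)).eventually (by simp)] with y hy
    exact DFunLike.congr_fun (L.hasFDerivAt.comp y
      (hy.differentiableAt (by simp)).hasFDerivAt).fderiv (phaseVec (Sum.inr k))
  have h2 : DifferentiableAt ℝ
      (fun y => fderiv ℝ (fun w => F (cotPoint φ w)) y (phaseVec (Sum.inr k))) (cotCoord φ z) :=
    ((hf.fderiv_right (m := ∞) (by simp)).clm_apply contDiffAt_const).differentiableAt (by simp)
  unfold mixedDeriv
  rw [h1.fderiv_eq]
  exact DFunLike.congr_fun (L.hasFDerivAt.comp (cotCoord φ z) h2.hasFDerivAt).fderiv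
    (phaseVec (Sum.inl j))

lemma IsNormalChart.PComplex_negForm [T2Space X] {p : X} (h : S.IsNormalChart T p φ)
    (hT : S.IsReeb T) (hN : S.IsTanakaWebster T nabla) {F : CotBundle n X → ℂ}
    (hF : ContMDiff (cotModel n) 𝓘(ℝ, ℂ) ∞ F) :
    S.PComplex T nabla F (negForm S.ω₀ p)
      = ∑ j : Fin n, (mixedDeriv φ (iEven j) (iOdd j) F (negForm S.ω₀ p)
        - mixedDeriv φ (iOdd j) (iEven j) F (negForm S.ω₀ p)) := by
  have hL : ∀ L : ℂ →L[ℝ] ℝ, S.P T nabla (fun w => L (F w)) (negForm S.ω₀ p)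
      = L (∑ j : Fin n, (mixedDeriv φ (iEven j) (iOdd j) F (negForm S.ω₀ p)
        - mixedDeriv φ (iOdd j) (iEven j) F (negForm S.ω₀ p))) := by
    intro L
    rw [h.P_negForm hT hN (F := fun w => L (F w)) (L.contDiff.contMDiff.comp hF), map_sum]
    refine Finset.sum_congr rfl fun j _ => ?_
    rw [mixedDeriv_clm_comp L h.mem_atlas hF _ _ (z := negForm S.ω₀ p) h.mem_source,
      mixedDeriv_clm_comp L h.mem_atlas hF _ _ (z := negForm S.ω₀ p) h.mem_source, map_sub]
  have hre := hL Complex.reCLM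
  have him := hL Complex.imCLM
  simp only [Complex.reCLM_apply, Complex.imCLM_apply] at hre him
  rw [PComplex, hre, him, mul_comm, Complex.re_add_im]

end PseudohermitianStructure

end

end CRGeom

theorem mainTheorem8 (n : ℕ) (hn : 1 ≤ n) (X : Type*) [TopologicalSpace X] [T2Space X]
    [ChartedSpace (CRGeom.RVec n) X] [IsManifold (𝓡 (2 * n + 1)) ∞ X]
    (S : CRGeom.PseudohermitianStructure n X) (T : CRGeom.VField n X) (hT : S.IsReeb T)
    (nabla : CovariantDerivative (𝓡 (2 * n + 1)) (CRGeom.RVec n)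
      (TangentSpace (𝓡 (2 * n + 1)) : X → Type))
    (hnabla : S.IsTanakaWebster T nabla) :
    -- `P` maps smooth functions to smooth functions and is a linear differential operator
    (∀ F : CRGeom.CotBundle n X → ℝ, ContMDiff (CRGeom.cotModel n) 𝓘(ℝ, ℝ) ∞ F →
      ContMDiff (CRGeom.cotModel n) 𝓘(ℝ, ℝ) ∞ (S.P T nabla F)) ∧
    CRGeom.IsDifferentialOperator (S.P T nabla) ∧
    -- `P` is given by `-(1/2) Div(J_{T*X} X_F)` in the coordinates induced by any chart
    (∀ φ ∈ IsManifold.maximalAtlas (𝓡 (2 * n + 1)) ∞ X,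
      ∀ F : CRGeom.CotBundle n X → ℝ, ContMDiff (CRGeom.cotModel n) 𝓘(ℝ, ℝ) ∞ F →
      ∀ z : CRGeom.CotBundle n X, z.1 ∈ φ.source →
        S.P T nabla F z = S.PChart T nabla φ F (CRGeom.cotCoord φ z)) ∧
    -- the formula for `P` in normal coordinates, for real-valued functions
    (∀ (p : X) (φ : OpenPartialHomeomorph X (CRGeom.RVec n)), S.IsNormalChart T p φ →
      ∀ F : CRGeom.CotBundle n X → ℝ, ContMDiff (CRGeom.cotModel n) 𝓘(ℝ, ℝ) ∞ F →
        S.P T nabla F (CRGeom.negForm S.ω₀ p) = ∑ j : Fin n,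
          (CRGeom.mixedDeriv φ (CRGeom.iEven j) (CRGeom.iOdd j) F (CRGeom.negForm S.ω₀ p)
            - CRGeom.mixedDeriv φ (CRGeom.iOdd j) (CRGeom.iEven j) F
              (CRGeom.negForm S.ω₀ p))) ∧
    -- the same formula for complex-valued functions
    (∀ (p : X) (φ : OpenPartialHomeomorph X (CRGeom.RVec n)), S.IsNormalChart T p φ →
      ∀ F : CRGeom.CotBundle n X → ℂ, ContMDiff (CRGeom.cotModel n) 𝓘(ℝ, ℂ) ∞ F →
        S.PComplex T nabla F (CRGeom.negForm S.ω₀ p) = ∑ j : Fin n,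
          (CRGeom.mixedDeriv φ (CRGeom.iEven j) (CRGeom.iOdd j) F (CRGeom.negForm S.ω₀ p)
            - CRGeom.mixedDeriv φ (CRGeom.iOdd j) (CRGeom.iEven j) F
              (CRGeom.negForm S.ω₀ p))) := by
  refine ⟨fun F hF => ?_, ?_, fun φ hφ F hF z hz => ?_, fun p φ h F hF => ?_, fun p φ h F hF => ?_⟩
  · exact CRGeom.PseudohermitianStructure.P_contMDiff hT hnabla.smooth hF
  · exact CRGeom.PseudohermitianStructure.P_isDifferentialOperator hT hnabla.smooth
  · exact CRGeom.PseudohermitianStructure.P_eq_PChart hT hnabla.smooth hφ hF hz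
  · exact h.P_negForm hT hnabla hF
  · exact h.PComplex_negForm hT hnabla hF
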